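/- **Setting.** Let $\lambda\in\{1,-1\}$, let $m,n\ge 1$ be integers and let $g_0,g_1,g_2:[0,\infty)\to\mathbb R$ satisfy, for $j=0,1,2$ (with $[\cdot]$ the integer part and one-sided derivatives at $0$), $$g_j\in C^{[\frac{m+5-j}{3}]}([0,\infty)),\qquad (1+t)^n g_j^{(i)}(t)\in L^1([0,\infty)),\quad i=0,1,\dots,\Big[\tfrac{m+5-j}{3}\Big].$$ Put $\sigma_3=\begin{pmatrix}1&0\\0&-1\end{pmatrix}$, $\sigma_\lambda=\begin{pmatrix}0&1\\-\lambda&0\end{pmatrix}$, $e^{s\hat\sigma_3}A=e^{s\sigma_3}Ae^{-s\sigma_3}$ and $$\mathsf V(t,k)=\begin{pmatrix}-2i\lambda kg_0^2&-4k^2g_0+2ikg_1-2\lambda g_0^3+g_2\\-4\lambda k^2g_0-2i\lambda kg_1-2g_0^3+\lambda g_2&2i\lambda kg_0^2\end{pmatrix}.$$ Let $D_+=\{\operatorname{Im}k\neq0,\ \operatorname{Im}k^3>0\}$ and $D_-=\{\operatorname{Im}k\ne0,\ \operatorname{Im}k^3<0\}$, with closures $\bar D_\pm$. The notation $k\in(\bar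 D_-,\bar D_+)$ means that the statement concerns the first column for $k\in\bar D_-$ and the second column for $k\in\bar D_+$; similarly for $(\bar D_+,\bar D_-)$. A column is measured in its Euclidean norm $|\cdot|$. Derivatives in $k$ at boundary points of the domain of a column of $T$ are taken within that domain. *Eigenfunctions.* $T(t,k)$ and $U(t,k)$ are the $2\times2$-matrix valued solutions, for $t\ge0$, of $$T(t,k)=I+\int_\infty^t e^{4ik^3(t'-t)\hat\sigma_3}(\mathsf VT)(t',k)\,dt',\qquad U(t,k)=I+\int_0^t e^{4ik^3(t'-t)\hat\sigma_3}(\mathsf VU)(t',k)\,dt',$$ where $T$ is considered for $k\in(\bar D_-,\bar D_+)$, with columns continuous and bounded in $t\geq 0$, and $U$ for $k\in\mathbb C$, continuous in $t\ge0$. *Formal coefficients.* For a matrix $A$ let $A^{(d)}$ and $A^{(o)}$ be its diagonal and off-diagonal parts. Consider the recursion, for $j\ge1$, $$T_j^{(o)}=\tfrac i8\sigma_3\Big(\partial_tT_{j-3}^{(o)}+4g_0\sigma_3\sigma_\lambda T_{j-1}^{(d)}+2i\lambda g_0^2\sigma_3T_{j-2}^{(o)}-2ig_1\sigma_\lambda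 T_{j-2}^{(d)}-(g_2-2\lambda g_0^3)\sigma_3\sigma_\lambda T_{j-3}^{(d)}\Big),$$ $$\begin{aligned}\partial_tT_j^{(d)}={}&\tfrac{ig_0}2\sigma_\lambda\partial_tT_{j-1}^{(o)}+\tfrac14g_1\sigma_3\sigma_\lambda\partial_tT_{j-2}^{(o)}-\tfrac i8(g_2-\lambda g_0^3)\sigma_\lambda\partial_tT_{j-3}^{(o)}-\tfrac{i\lambda}2g_1g_0^2\sigma_\lambda T_{j-1}^{(o)}\\&+\tfrac i2(3g_0^4-2\lambda g_2g_0+\lambda g_1^2)\sigma_3T_{j-1}^{(d)}-\tfrac14(\lambda g_2-g_0^3)g_0^2\sigma_3\sigma_\lambda T_{j-2}^{(o)}\\&+\tfrac14g_0^3g_1T_{j-2}^{(d)}+\tfrac i8(g_2-\lambda g_0^3)(\lambda g_2-2g_0^3)\sigma_3T_{j-3}^{(d)}.\end{aligned}$$ The $T_j$ are determined by this recursion, $T_{-2}=T_{-1}=0$, $T_0=I$ and $\lim_{t\to\infty}T_j(t)=0$ for $j\ge1$. The $V_j$ satisfy the same recursion with $V_{-2}=V_{-1}=0$, $V_0=I$;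 the $W_j$ satisfy the recursion obtained by replacing $T_j^{(d)},T_j^{(o)}$ by $W_j^{(o)},W_j^{(d)}$ respectively, with $W_{-2}=W_{-1}=W_0=0$; and the constants of integration are fixed by $V_j(0)+W_j(0)=0$ for $j\ge1$. **Theorem.** The coefficients $T_j,V_j,W_j$, $1\le j\le m+3$, are well defined: they are $C^1$ on $[0,\infty)$, the integrals $\int_\infty^t$ defining $T_j^{(d)}$ converge absolutely, and the above recursions and normalizations hold. Hence the functions $$\hat T(t,k)=I+\sum_{j=1}^{m+3}\frac{T_j(t)}{k^j},\qquad \hat U(t,k)=I+\sum_{j=1}^{m+3}\frac{V_j(t)}{k^j}+\bigg(\sum_{j=1}^{m+3}\frac{W_j(t)}{k^j}\bigg)e^{8ik^3t\sigma_3}$$ are well defined for $k\ne0$. The eigenfunctions $T$ and $U$ exist and are unique, and $U(t,\cdot)$ is entire for each $t\ge0$. Moreover there are constants $K>0$ and $C>0$ such that, for each $t\geq 0$, $T(t,\cdot)$ is $n$ times continuously differentiable for $k\in(\bar D_-,\bar D_+)$, $|k|>K$, and, for all $t\ge0$ and $j=0,1,\dots,n$, $$\bigg|\frac{\partial^j}{\partial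 k^j}\big(T-\hat T\big)\bigg|\le\frac{C}{|k|^{m+1-2j}(1+t)^{n-j}},\qquad k\in(\bar D_-,\bar D_+),\ |k|>K,$$ $$\bigg|\frac{\partial^j}{\partial k^j}\big(U-\hat U\big)\bigg|\le\frac{C(1+t)^{j+2}e^{\frac{Ct}{|k|^{m+1}}}}{|k|^{m+1-2j}},\qquad k\in(\bar D_+,\bar D_-),\ |k|>K,$$ $$\bigg|\frac{\partial^j}{\partial k^j}\Big(\big(U-\hat U\big)e^{-8ik^3t\sigma_3}\Big)\bigg|\le\frac{C(1+t)^{j+2}e^{\frac{Ct}{|k|^{m+1}}}}{|k|^{m+1-2j}},\qquad k\in(\bar D_-,\bar D_+),\ |k|>K.$$ -/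

import Mathlib

open Set Filter Topology MeasureTheory

noncomputable section

namespace MKdV

/-- Complex `2 × 2` matrices. Index `0` is the first row or column, index `1` the second. -/
abbrev Mat : Type := Matrix (Fin 2) (Fin 2) ℂ

/-- The third Pauli matrix. -/
def sigma3 : Mat := !![1, 0; 0, -1]

def sigmaLam (lam : ℝ) : Mat := !![0, 1; -(lam : ℂ), 0]

/-- The matrix `exp (s σ₃)`. -/
def expSigma3 (s : ℂ) : Mat := !![Complex.exp s, 0; 0, Complex.exp (-s)]

/-- The action `exp (s σ̂₃) A = exp (s σ₃) A exp (-s σ₃)`. -/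
def expHatSigma3 (s : ℂ) (A : Mat) : Mat := expSigma3 s * A * expSigma3 (-s)

/-- The Euclidean norm of a column. -/
def colNorm (v : Fin 2 → ℂ) : ℝ := Real.sqrt (∑ i, ‖v i‖ ^ 2)

def D1 : Set ℂ := {k | k.im < 0} ∩ {k | 0 < (k ^ 3).im}
def D2 : Set ℂ := {k | k.im < 0} ∩ {k | (k ^ 3).im < 0}
def D3 : Set ℂ := {k | 0 < k.im} ∩ {k | 0 < (k ^ 3).im}
def D4 : Set ℂ := {k | 0 < k.im} ∩ {k | (k ^ 3).im < 0}

def Dplus : Set ℂ := D1 ∪ D3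
def Dminus : Set ℂ := D2 ∪ D4

/-- `k ∈ (D̄₋, D̄₊)`: the set of `k` for which the column with index `c` is considered. -/
def domMP (c : Fin 2) : Set ℂ := if c = 0 then closure Dminus else closure Dplus

/-- `k ∈ (D̄₊, D̄₋)`. -/
def domPM (c : Fin 2) : Set ℂ := if c = 0 then closure Dplus else closure Dminus

/-- The part `|k| > K` of `domMP c`. -/
def domMPLarge (K : ℝ) (c : Fin 2) : Set ℂ := domMP c ∩ {k | K < ‖k‖}

/-- The part `|k| > K` of `domPM c`. -/
def domPMLarge (K : ℝ) (c : Fin 2) : Set ℂ := domPM c ∩ {k | K < ‖k‖}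

/-- Regularity and decay of the boundary values: `g_j ∈ C^{[(m+5-j)/3]}([0,∞))` and
`(1+t)^n g_j^{(i)} ∈ L¹([0,∞))` for `0 ≤ i ≤ [(m+5-j)/3]` (derivatives at `0` are one-sided). -/
def BoundaryAssumption (m n : ℕ) (g : Fin 3 → ℝ → ℝ) : Prop :=
  ∀ j : Fin 3,
    ContDiffOn ℝ (((m + 5 - (j : ℕ)) / 3 : ℕ) : WithTop ℕ∞) (g j) (Ici 0) ∧
    ∀ i : ℕ, i ≤ (m + 5 - (j : ℕ)) / 3 →
      IntegrableOn (fun t => (1 + t) ^ n * iteratedDerivWithin i (g j) (Ici 0) t) (Ici 0) volume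

/-- The coefficient matrix `V(t,k)` of the `t`-part. -/
def laxV (g : Fin 3 → ℝ → ℝ) (lam : ℝ) (t : ℝ) (k : ℂ) : Mat :=
  !![-2 * Complex.I * lam * k * (g 0 t) ^ 2,
      -4 * k ^ 2 * g 0 t + 2 * Complex.I * k * g 1 t - 2 * lam * (g 0 t) ^ 3 + g 2 t;
     -4 * lam * k ^ 2 * g 0 t - 2 * Complex.I * lam * k * g 1 t - 2 * (g 0 t) ^ 3 + lam * g 2 t,
      2 * Complex.I * lam * k * (g 0 t) ^ 2]

/-- `T` is the eigenfunction normalized at `t = ∞`: for `k ∈ (D̄₋, D̄₊)` its columns are bounded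
continuous solutions on `[0,∞)` of the Volterra equation
`T = I + ∫_∞^t exp(4ik³(t'-t)σ̂₃) (V T)(t',k) dt'`.
The column `c` of the integrand involves only the column `c` of `T`. -/
def IsEigenT (g : Fin 3 → ℝ → ℝ) (lam : ℝ) (T : ℝ → ℂ → Mat) : Prop :=
  ∀ c : Fin 2, ∀ k ∈ domMP c,
    (∀ i, ContinuousOn (fun t => T t k i c) (Ici 0)) ∧
    (∃ B : ℝ, ∀ t : ℝ, 0 ≤ t → ∀ i, ‖T t k i c‖ ≤ B) ∧
    ∀ t : ℝ, 0 ≤ t → ∀ i,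
      T t k i c = (1 : Mat) i c -
        ∫ s in Ioi t, expHatSigma3 (4 * Complex.I * k ^ 3 * ((s : ℂ) - t))
          (laxV g lam s k * T s k) i c

/-- `U` is the eigenfunction normalized at `t = 0`: for every `k`, it is the continuous solution
on `[0,∞)` of `U = I + ∫_0^t exp(4ik³(t'-t)σ̂₃) (V U)(t',k) dt'`. -/
def IsEigenU (g : Fin 3 → ℝ → ℝ) (lam : ℝ) (U : ℝ → ℂ → Mat) : Prop :=
  ∀ k : ℂ, ∀ c : Fin 2,
    (∀ i, ContinuousOn (fun t => U t k i c) (Ici 0)) ∧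
    ∀ t : ℝ, 0 ≤ t → ∀ i,
      U t k i c = (1 : Mat) i c +
        ∫ s in (0 : ℝ)..t, expHatSigma3 (4 * Complex.I * k ^ 3 * ((s : ℂ) - t))
          (laxV g lam s k * U s k) i c

/-- Entrywise `t`-derivative on `[0,∞)`. -/
def dt (A : ℝ → Mat) (t : ℝ) : Mat :=
  Matrix.of fun i l => derivWithin (fun s => A s i l) (Ici 0) t

/-- A coefficient of a formal solution, split into the part `alg` given algebraically by the
recursion and the part `int` whose `t`-derivative is given by the recursion. For `T_j` and `V_j`,
`alg` is the off-diagonal and `int` the diagonal part; for `W_j` it is the other way round. -/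
structure Coef where
  alg : ℝ → Mat
  int : ℝ → Mat

def Coef.val (c : Coef) (t : ℝ) : Mat := c.alg t + c.int t

/-- The algebraic part of the coefficient of order `j`, from the coefficients `p₁, p₂, p₃` of
orders `j-1, j-2, j-3`. -/
def algStep (g : Fin 3 → ℝ → ℝ) (lam : ℝ) (p₁ p₂ p₃ : Coef) (t : ℝ) : Mat :=
  let g0 : ℂ := g 0 t
  let g1 : ℂ := g 1 t
  let g2 : ℂ := g 2 t
  (Complex.I / 8) • (sigma3 *
    (dt p₃.alg t
      + (4 * g0) • (sigma3 * sigmaLam lam * p₁.int t)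
      + (2 * Complex.I * lam * g0 ^ 2) • (sigma3 * p₂.alg t)
      - (2 * Complex.I * g1) • (sigmaLam lam * p₂.int t)
      - (g2 - 2 * lam * g0 ^ 3) • (sigma3 * sigmaLam lam * p₃.int t)))

/-- The `t`-derivative of the other part of the coefficient of order `j`. -/
def intRate (g : Fin 3 → ℝ → ℝ) (lam : ℝ) (p₁ p₂ p₃ : Coef) (t : ℝ) : Mat :=
  let g0 : ℂ := g 0 t
  let g1 : ℂ := g 1 t
  let g2 : ℂ := g 2 t
  (Complex.I * g0 / 2) • (sigmaLam lam * dt p₁.alg t)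
    + (g1 / 4) • (sigma3 * sigmaLam lam * dt p₂.alg t)
    - (Complex.I / 8 * (g2 - lam * g0 ^ 3)) • (sigmaLam lam * dt p₃.alg t)
    - (Complex.I * lam / 2 * g1 * g0 ^ 2) • (sigmaLam lam * p₁.alg t)
    + (Complex.I / 2 * (3 * g0 ^ 4 - 2 * lam * g2 * g0 + lam * g1 ^ 2)) • (sigma3 * p₁.int t)
    - (1 / 4 * (lam * g2 - g0 ^ 3) * g0 ^ 2) • (sigma3 * sigmaLam lam * p₂.alg t)
    + (1 / 4 * g0 ^ 3 * g1) • p₂.int t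
    + (Complex.I / 8 * (g2 - lam * g0 ^ 3) * (lam * g2 - 2 * g0 ^ 3)) • (sigma3 * p₃.int t)

/-- The coefficients `T_j`, with the index shifted by two: `tSeq (j + 2)` is `T_j`, `j ≥ -2`. -/
def tSeq (g : Fin 3 → ℝ → ℝ) (lam : ℝ) : ℕ → Coef
  | 0 => ⟨fun _ => 0, fun _ => 0⟩
  | 1 => ⟨fun _ => 0, fun _ => 0⟩
  | 2 => ⟨fun _ => 0, fun _ => 1⟩
  | j + 3 =>
    let p₁ := tSeq g lam (j + 2)
    let p₂ := tSeq g lam (j + 1)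
    let p₃ := tSeq g lam j
    ⟨algStep g lam p₁ p₂ p₃,
      fun t => Matrix.of fun i l => -∫ s in Ioi t, intRate g lam p₁ p₂ p₃ s i l⟩

/-- The coefficients `(V_j, W_j)`, with the index shifted by two. The constants of integration
are fixed by `V_j(0) + W_j(0) = 0` for `j ≥ 1`. -/
def vwSeq (g : Fin 3 → ℝ → ℝ) (lam : ℝ) : ℕ → Coef × Coef
  | 0 => (⟨fun _ => 0, fun _ => 0⟩, ⟨fun _ => 0, fun _ => 0⟩)
  | 1 => (⟨fun _ => 0, fun _ => 0⟩, ⟨fun _ => 0, fun _ => 0⟩)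
  | 2 => (⟨fun _ => 0, fun _ => 1⟩, ⟨fun _ => 0, fun _ => 0⟩)
  | j + 3 =>
    let p₁ := vwSeq g lam (j + 2)
    let p₂ := vwSeq g lam (j + 1)
    let p₃ := vwSeq g lam j
    let algV := algStep g lam p₁.1 p₂.1 p₃.1
    let algW := algStep g lam p₁.2 p₂.2 p₃.2
    (⟨algV, fun t => Matrix.of fun i l =>
        -(algW 0 i l) + ∫ s in (0 : ℝ)..t, intRate g lam p₁.1 p₂.1 p₃.1 s i l⟩,
     ⟨algW, fun t => Matrix.of fun i l =>
        -(algV 0 i l) + ∫ s in (0 : ℝ)..t, intRate g lam p₁.2 p₂.2 p₃.2 s i l⟩)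

def tCoef (g : Fin 3 → ℝ → ℝ) (lam : ℝ) (j : ℕ) : ℝ → Mat := (tSeq g lam (j + 2)).val
def vCoef (g : Fin 3 → ℝ → ℝ) (lam : ℝ) (j : ℕ) : ℝ → Mat := (vwSeq g lam (j + 2)).1.val
def wCoef (g : Fin 3 → ℝ → ℝ) (lam : ℝ) (j : ℕ) : ℝ → Mat := (vwSeq g lam (j + 2)).2.val

/-- Every entry is continuously differentiable on `[0,∞)`. -/
def IsC1 (A : ℝ → Mat) : Prop := ∀ i l, ContDiffOn ℝ 1 (fun t => A t i l) (Ici 0)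

/-- On `[0,∞)` the derivative of `A` is `B`. -/
def HasDt (A B : ℝ → Mat) : Prop :=
  ∀ t : ℝ, 0 ≤ t → ∀ i l, HasDerivWithinAt (fun s => A s i l) (B t i l) (Ici 0) t

/-- `T_j` (`j ≥ 1`) is well defined: it is `C¹`, the integral defining it converges, it satisfies
the differential part of the recursion, and it vanishes at infinity. -/
def TWellDefined (g : Fin 3 → ℝ → ℝ) (lam : ℝ) (j : ℕ) : Prop :=
  IsC1 (tCoef g lam j) ∧
  (∀ i l, IntegrableOn
    (fun s => intRate g lam (tSeq g lam (j + 1)) (tSeq g lam j) (tSeq g lam (j - 1)) s i l)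
    (Ici 0) volume) ∧
  HasDt (tSeq g lam (j + 2)).int
    (intRate g lam (tSeq g lam (j + 1)) (tSeq g lam j) (tSeq g lam (j - 1))) ∧
  ∀ i l, Tendsto (fun t => tCoef g lam j t i l) atTop (𝓝 0)

/-- `V_j` and `W_j` (`j ≥ 1`) are well defined: they are `C¹`, satisfy the differential part of the
recursion, and `V_j(0) + W_j(0) = 0`. -/
def VWWellDefined (g : Fin 3 → ℝ → ℝ) (lam : ℝ) (j : ℕ) : Prop :=
  IsC1 (vCoef g lam j) ∧ IsC1 (wCoef g lam j) ∧
  HasDt (vwSeq g lam (j + 2)).1.int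
    (intRate g lam (vwSeq g lam (j + 1)).1 (vwSeq g lam j).1 (vwSeq g lam (j - 1)).1) ∧
  HasDt (vwSeq g lam (j + 2)).2.int
    (intRate g lam (vwSeq g lam (j + 1)).2 (vwSeq g lam j).2 (vwSeq g lam (j - 1)).2) ∧
  vCoef g lam j 0 + wCoef g lam j 0 = 0

/-- `T̂ = I + T_1/k + ⋯ + T_{m+3}/k^{m+3}`. -/
def That (g : Fin 3 → ℝ → ℝ) (lam : ℝ) (m : ℕ) (t : ℝ) (k : ℂ) : Mat :=
  1 + ∑ j ∈ Finset.Icc 1 (m + 3), (1 / k ^ j) • tCoef g lam j t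

/-- `Û = I + V_1/k + ⋯ + V_{m+3}/k^{m+3} + (W_1/k + ⋯ + W_{m+3}/k^{m+3}) exp(8ik³tσ₃)`. -/
def Uhat (g : Fin 3 → ℝ → ℝ) (lam : ℝ) (m : ℕ) (t : ℝ) (k : ℂ) : Mat :=
  1 + ∑ j ∈ Finset.Icc 1 (m + 3), (1 / k ^ j) • vCoef g lam j t
    + (∑ j ∈ Finset.Icc 1 (m + 3), (1 / k ^ j) • wCoef g lam j t)
      * expSigma3 (8 * Complex.I * k ^ 3 * t)

end MKdV

end

/-!
The column equation `x' = -4ik³(σ₃ - η) x + V x` is compared with its formal solutions in powers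
of `1/k`.

*Coefficients.* The recursion loses one derivative of the boundary values every three steps, and
the assumed regularity is exactly what is needed up to order `m + 3` (`tSeq_regAt`,
`vwSeq_regAt`). All decay and integrability statements are carried by the classes `Dec` and `Reg`.
Substituting the truncated sum into the equation, all orders cancel but the last three
(`Formal.pres_eq`), so the remainder is `O(|k|^{-m-1})` with a majorant in `t` that is integrable
against `(1+t)^n` (`Formal.exists_bound`).

*Eigenfunctions.* Solutions with a prescribed value at a finite time exist and are entire in `k`
(`exists_entire_solution`, by a Neumann series in a weighted space). `U` is one of them, and the
columns of `T` are limits of solutions whose value at `b` is a unit vector, as `b → ∞`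
(`exists_colT`).

*Undifferentiated bounds.* `V` grows like `k²`, so Grönwall's inequality cannot be applied
directly. For large `k` the truncated expansion `P` of `T` is invertible, and `x = P y` transforms
the equation into one with a coefficient bounded by the remainder (`hasDerivAt_adjVec`). Hence
solutions are controlled uniformly in `k` as long as the exponentials are (`exists_large_bound`).
Applied to `U - Û`, which vanishes at `t = 0`, this gives a bound of order `|k|^{-m-1}`.

*Derivatives in `k`.* Moving `k` by at most a constant times `|k|⁻²(1+t)⁻¹` changes `k³t` by a
bounded amount only, so the bounds persist on discs of this radius around the points of the closed
domain, even where these leave the domain. Cauchy's estimate then costs `|k|²(1+t)` per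
derivative, which settles `U`. `T` is only defined on the closed domain. It is approximated by the
solutions `w_b` with the value of the expansion at time `b`, which are analytic in `k ≠ 0`. Along
the times `b_l = 2^l (1+t) - 1` the difference of consecutive approximations is bounded by
`|k|^{-m-1} ∫ f` over `[b_l, b_{l+1}]`, on discs of radius comparable to `|k|⁻²(1+b_l)⁻¹`. After
`j` derivatives the factor `(1+b_l)^j` is absorbed by the weight `(1+s)^n` of `f`, with a gain of
`(1+t)^{j-n}`, and the sum over `l` converges (`exists_tErr_series`). Since the closed domain is
locally convex away from the origin, such a series can be differentiated termwise up to the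
boundary (`contDiffOn_tsum_within`).
-/

noncomputable section

namespace MKdV

/-! ### Weighted function classes on the half-line -/

/-- `f'` is the derivative of `f` on `[0,∞)`, one-sided at `0`. -/
def HasD (f f' : ℝ → ℂ) : Prop := ∀ t : ℝ, 0 ≤ t → HasDerivWithinAt f (f' t) (Ici 0) t

/-- `f` is continuous on `[0,∞)` and `(1+t)^n f` is integrable there. -/
def WInt (n : ℕ) (f : ℝ → ℂ) : Prop :=
  ContinuousOn f (Ici 0) ∧ IntegrableOn (fun t => (1 + t) ^ n * ‖f t‖) (Ici 0)

/-- `f ∈ C^r([0,∞))`, and `(1+t)^n f^{(i)}` is integrable for `i ≤ r`. -/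
def Dec (n : ℕ) : ℕ → (ℝ → ℂ) → Prop
  | 0, f => WInt n f
  | r + 1, f => WInt n f ∧ ∃ f', HasD f f' ∧ Dec n r f'

/-- `f` is bounded on `[0,∞)` and its derivative lies in `Dec n r`. Such functions have a limit at
infinity which need not be `0`; they multiply `Dec n a` for `a ≤ r + 1`. -/
def Reg (n r : ℕ) (f : ℝ → ℂ) : Prop :=
  (∃ B, ∀ t, 0 ≤ t → ‖f t‖ ≤ B) ∧ ∃ f', HasD f f' ∧ Dec n r f'

theorem HasD.continuousOn {f f' : ℝ → ℂ} (h : HasD f f') : ContinuousOn f (Ici 0) :=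
  fun t ht => (h t ht).continuousWithinAt

theorem HasD.hasDerivAt {f f' : ℝ → ℂ} (h : HasD f f') {t : ℝ} (ht : 0 < t) :
    HasDerivAt f (f' t) t := (h t ht.le).hasDerivAt (Ici_mem_nhds ht)

theorem HasD.derivWithin {f f' : ℝ → ℂ} (h : HasD f f') {t : ℝ} (ht : 0 ≤ t) :
    derivWithin f (Ici 0) t = f' t := (h t ht).derivWithin (uniqueDiffOn_Ici 0 t ht)

theorem HasD.congr {f f' g g' : ℝ → ℂ} (h : HasD f f') (hg : ∀ t, 0 ≤ t → g t = f t)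
    (hg' : ∀ t, 0 ≤ t → g' t = f' t) : HasD g g' := fun t ht => by
  rw [hg' t ht]
  exact (h t ht).congr (fun s hs => hg s hs) (hg t ht)

theorem WInt.congr {n : ℕ} {f g : ℝ → ℂ} (h : WInt n f) (hg : ∀ t, 0 ≤ t → g t = f t) :
    WInt n g := by
  refine ⟨h.1.congr hg, h.2.congr_fun (fun t ht => ?_) measurableSet_Ici⟩
  simp only [hg t ht]

theorem continuousOn_weight (n : ℕ) {f : ℝ → ℂ} (hf : ContinuousOn f (Ici 0)) :
    ContinuousOn (fun t : ℝ => (1 + t) ^ n * ‖f t‖) (Ici 0) :=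
  (by fun_prop : Continuous fun t : ℝ => (1 + t) ^ n).continuousOn.mul hf.norm

/-- Membership in `WInt n` from a pointwise bound. -/
theorem WInt.of_le {n : ℕ} {f : ℝ → ℂ} (hf : ContinuousOn f (Ici 0)) {φ : ℝ → ℝ}
    (hφ : IntegrableOn (fun t => (1 + t) ^ n * φ t) (Ici 0))
    (h : ∀ t, 0 ≤ t → ‖f t‖ ≤ φ t) : WInt n f := by
  refine ⟨hf, hφ.mono' ((continuousOn_weight n hf).aestronglyMeasurable measurableSet_Ici) ?_⟩
  filter_upwards [ae_restrict_mem measurableSet_Ici] with t ht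
  have ht' : (0 : ℝ) ≤ t := ht
  rw [Real.norm_of_nonneg (by positivity)]
  exact mul_le_mul_of_nonneg_left (h t ht) (by positivity)

theorem WInt.add {n : ℕ} {f g : ℝ → ℂ} (hf : WInt n f) (hg : WInt n g) :
    WInt n (fun t => f t + g t) := by
  refine WInt.of_le (φ := fun t => ‖f t‖ + ‖g t‖) (hf.1.add hg.1) ?_ fun t _ => norm_add_le _ _
  simp only [mul_add]
  exact hf.2.add hg.2

theorem WInt.mul_bounded {n : ℕ} {f g : ℝ → ℂ} (hf : WInt n f) (hg : ContinuousOn g (Ici 0))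
    {B : ℝ} (hB : ∀ t, 0 ≤ t → ‖g t‖ ≤ B) : WInt n (fun t => f t * g t) := by
  refine WInt.of_le (φ := fun t => ‖f t‖ * B) (hf.1.mul hg) ?_ fun t ht => ?_
  · simp only [← mul_assoc]
    exact hf.2.mul_const B
  · rw [norm_mul]; exact mul_le_mul_of_nonneg_left (hB t ht) (norm_nonneg _)

theorem WInt.const_mul {n : ℕ} {f : ℝ → ℂ} (c : ℂ) (hf : WInt n f) :
    WInt n (fun t => c * f t) := by
  simpa only [mul_comm] using hf.mul_bounded (g := fun _ => c) continuousOn_const (B := ‖c‖)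
    fun _ _ => le_rfl

theorem WInt.zero (n : ℕ) : WInt n (fun _ => 0) :=
  ⟨continuousOn_const, by simp⟩

theorem WInt.integrableOn {n : ℕ} {f : ℝ → ℂ} (hf : WInt n f) : IntegrableOn f (Ici 0) := by
  refine hf.2.mono' (hf.1.aestronglyMeasurable measurableSet_Ici) ?_
  filter_upwards [ae_restrict_mem measurableSet_Ici] with t ht
  have ht' : (0 : ℝ) ≤ t := ht
  exact le_mul_of_one_le_left (norm_nonneg _) (one_le_pow₀ (by linarith))

theorem Dec.wInt {n : ℕ} : ∀ {r : ℕ} {f : ℝ → ℂ}, Dec n r f → WInt n f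
  | 0, _, h => h
  | _ + 1, _, h => h.1

theorem Dec.congr {n : ℕ} : ∀ {r : ℕ} {f g : ℝ → ℂ}, Dec n r f →
    (∀ t, 0 ≤ t → g t = f t) → Dec n r g
  | 0, _, _, h, e => WInt.congr h e
  | _ + 1, _, _, ⟨h, f', h1, h2⟩, e => ⟨h.congr e, f', h1.congr e fun _ _ => rfl, h2⟩

theorem Dec.mono {n : ℕ} : ∀ {r r' : ℕ} {f : ℝ → ℂ}, Dec n r f → r' ≤ r → Dec n r' f
  | _, 0, _, h, _ => h.wInt
  | 0, _ + 1, _, _, e => absurd e (by omega)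
  | _ + 1, _ + 1, _, ⟨h, f', h1, h2⟩, e => ⟨h, f', h1, h2.mono (by omega)⟩

theorem Dec.add {n : ℕ} : ∀ {r : ℕ} {f g : ℝ → ℂ}, Dec n r f → Dec n r g →
    Dec n r (fun t => f t + g t)
  | 0, _, _, hf, hg => WInt.add hf hg
  | _ + 1, _, _, ⟨hf, f', h1, h2⟩, ⟨hg, g', h3, h4⟩ =>
    ⟨hf.add hg, fun t => f' t + g' t, fun t ht => (h1 t ht).add (h3 t ht), h2.add h4⟩

theorem Dec.const_mul {n : ℕ} (c : ℂ) : ∀ {r : ℕ} {f : ℝ → ℂ}, Dec n r f →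
    Dec n r (fun t => c * f t)
  | 0, _, hf => WInt.const_mul c hf
  | _ + 1, _, ⟨hf, f', h1, h2⟩ =>
    ⟨hf.const_mul c, fun t => c * f' t, fun t ht => (h1 t ht).const_mul c, h2.const_mul c⟩

theorem Dec.sub {n r : ℕ} {f g : ℝ → ℂ} (hf : Dec n r f) (hg : Dec n r g) :
    Dec n r (fun t => f t - g t) :=
  (hf.add (hg.const_mul (-1))).congr fun t _ => by ring

theorem Dec.zero (n : ℕ) : ∀ r, Dec n r (fun _ => 0)
  | 0 => WInt.zero n
  | r + 1 => ⟨WInt.zero n, fun _ => 0, fun _ _ => hasDerivWithinAt_const _ _ _, Dec.zero n r⟩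

/-- A function with integrable derivative is bounded. -/
theorem HasD.bounded {f f' : ℝ → ℂ} (h : HasD f f') (hc : ContinuousOn f' (Ici 0))
    (hi : IntegrableOn f' (Ici 0)) : ∃ B, ∀ t, 0 ≤ t → ‖f t‖ ≤ B := by
  refine ⟨‖f 0‖ + ∫ s in Ici (0 : ℝ), ‖f' s‖, fun t ht => ?_⟩
  have hsub : Icc (0 : ℝ) t ⊆ Ici 0 := Icc_subset_Ici_self
  have e : ∫ s in (0 : ℝ)..t, f' s = f t - f 0 := by
    refine intervalIntegral.integral_eq_sub_of_hasDerivAt_of_le ht (h.continuousOn.mono hsub)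
      (fun x hx => h.hasDerivAt hx.1) ?_
    exact ContinuousOn.intervalIntegrable (by rw [uIcc_of_le ht]; exact hc.mono hsub)
  have e2 : f t = f 0 + ∫ s in (0 : ℝ)..t, f' s := by rw [e]; ring
  rw [e2]
  refine (norm_add_le _ _).trans (add_le_add le_rfl ?_)
  refine (intervalIntegral.norm_integral_le_integral_norm ht).trans ?_
  rw [intervalIntegral.integral_of_le ht]
  exact setIntegral_mono_set hi.norm (Eventually.of_forall fun _ => norm_nonneg _)
    (Ioc_subset_Icc_self.trans hsub).eventuallyLE

theorem Dec.toReg {n r : ℕ} {f : ℝ → ℂ} (h : Dec n (r + 1) f) : Reg n r f := by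
  obtain ⟨_, f', h1, h2⟩ := h
  exact ⟨h1.bounded h2.wInt.1 h2.wInt.integrableOn, f', h1, h2⟩

theorem Reg.congr {n r : ℕ} {f g : ℝ → ℂ} (h : Reg n r f) (e : ∀ t, 0 ≤ t → g t = f t) :
    Reg n r g := by
  obtain ⟨⟨B, hB⟩, f', h1, h2⟩ := h
  exact ⟨⟨B, fun t ht => by rw [e t ht]; exact hB t ht⟩, f', h1.congr e fun _ _ => rfl, h2⟩

theorem Reg.mono {n r r' : ℕ} {f : ℝ → ℂ} (h : Reg n r f) (e : r' ≤ r) : Reg n r' f :=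
  ⟨h.1, h.2.choose, h.2.choose_spec.1, h.2.choose_spec.2.mono e⟩

theorem Reg.const (n r : ℕ) (c : ℂ) : Reg n r (fun _ => c) :=
  ⟨⟨‖c‖, fun _ _ => le_rfl⟩, fun _ => 0, fun _ _ => hasDerivWithinAt_const _ _ _, Dec.zero n r⟩

theorem Reg.continuousOn {n r : ℕ} {f : ℝ → ℂ} (h : Reg n r f) : ContinuousOn f (Ici 0) :=
  h.2.choose_spec.1.continuousOn

theorem Reg.add {n r : ℕ} {f g : ℝ → ℂ} (hf : Reg n r f) (hg : Reg n r g) :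
    Reg n r (fun t => f t + g t) := by
  obtain ⟨⟨B, hB⟩, f', h1, h2⟩ := hf
  obtain ⟨⟨B', hB'⟩, g', h3, h4⟩ := hg
  exact ⟨⟨B + B', fun t ht => (norm_add_le _ _).trans (add_le_add (hB t ht) (hB' t ht))⟩,
    fun t => f' t + g' t, fun t ht => (h1 t ht).add (h3 t ht), h2.add h4⟩

/-- Multiplication by a function in `Reg n b` preserves one derivative more than `b`: the derivative
of such a function is itself in `Dec n b`. -/
theorem Dec.mul_reg {n : ℕ} : ∀ {a b : ℕ} {f g : ℝ → ℂ}, Dec n a f → Reg n b g → a ≤ b + 1 →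
    Dec n a (fun t => f t * g t)
  | 0, _, _, _, hf, hg, _ => hf.wInt.mul_bounded hg.continuousOn hg.1.choose_spec
  | a + 1, b, f, g, hf, hg, hab => by
    have h0 := hf.wInt.mul_bounded hg.continuousOn hg.1.choose_spec
    have hfr := hf.toReg
    obtain ⟨_, f', h1, h2⟩ := hf
    have hg0 := hg
    obtain ⟨_, g', h3, h4⟩ := hg0
    refine ⟨h0, fun t => f' t * g t + f t * g' t, fun t ht => (h1 t ht).mul (h3 t ht), ?_⟩
    refine (h2.mul_reg hg (by omega)).add ?_
    refine ((h4.mono (by omega : a ≤ b)).mul_reg hfr (by omega)).congr fun _ _ => mul_comm _ _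

theorem Reg.mul_dec {n a b : ℕ} {f g : ℝ → ℂ} (hg : Reg n b g) (hf : Dec n a f) (h : a ≤ b + 1) :
    Dec n a (fun t => g t * f t) := (hf.mul_reg hg h).congr fun _ _ => mul_comm _ _

theorem Reg.mul {n a : ℕ} {f g : ℝ → ℂ} (hf : Reg n a f) (hg : Reg n a g) :
    Reg n a (fun t => f t * g t) := by
  obtain ⟨⟨B, hB⟩, f', h1, h2⟩ := id hf
  obtain ⟨⟨B', hB'⟩, g', h3, h4⟩ := id hg
  refine ⟨⟨B * B', fun t ht => ?_⟩, fun t => f' t * g t + f t * g' t,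
    fun t ht => (h1 t ht).mul (h3 t ht),
    (h2.mul_reg hg (Nat.le_succ _)).add (hf.mul_dec h4 (Nat.le_succ _))⟩
  rw [norm_mul]
  exact mul_le_mul (hB t ht) (hB' t ht) (norm_nonneg _) ((norm_nonneg _).trans (hB t ht))

theorem Dec.mul {n a : ℕ} {f g : ℝ → ℂ} (hf : Dec n (a + 1) f) (hg : Dec n (a + 1) g) :
    Dec n (a + 1) (fun t => f t * g t) := hf.mul_reg hg.toReg le_rfl

theorem Dec.pow {n a : ℕ} {f : ℝ → ℂ} (hf : Dec n (a + 1) f) : ∀ p : ℕ,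
    Dec n (a + 1) (fun t => f t ^ (p + 1))
  | 0 => by simpa using hf
  | p + 1 => ((Dec.pow hf p).mul hf).congr fun _ _ => pow_succ _ _

theorem Reg.contDiffOn_one {n r : ℕ} {f : ℝ → ℂ} (h : Reg n r f) : ContDiffOn ℝ 1 f (Ici 0) := by
  obtain ⟨_, f', h1, h2⟩ := h
  have := (contDiffOn_succ_iff_derivWithin (𝕜 := ℝ) (n := 0) (f := f) (uniqueDiffOn_Ici 0)).2
  rw [zero_add] at this
  refine this ⟨fun t ht => (h1 t ht).differentiableWithinAt, by simp, ?_⟩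
  exact contDiffOn_zero.2 (h2.wInt.1.congr fun t ht => h1.derivWithin ht)

theorem Dec.tendsto_zero {n r : ℕ} {f : ℝ → ℂ} (h : Dec n (r + 1) f) :
    Tendsto f atTop (𝓝 0) := by
  obtain ⟨h0, f', h1, h2⟩ := h
  exact tendsto_zero_of_hasDerivAt_of_integrableOn_Ioi (a := 0) (fun t ht => h1.hasDerivAt ht)
    (h2.wInt.integrableOn.mono_set Ioi_subset_Ici_self)
    (h0.integrableOn.mono_set Ioi_subset_Ici_self)

/-- The derivative of the primitive of a function continuous on `[0,∞)`. -/
theorem hasD_primitive {q : ℝ → ℂ} (hq : ContinuousOn q (Ici 0)) (c : ℂ) :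
    HasD (fun t => c + ∫ s in (0 : ℝ)..t, q s) q := by
  -- Continuous extension of `q` by its value at `0` to the whole line.
  have hQ : Continuous fun t : ℝ => q (max t 0) :=
    hq.comp_continuous (by fun_prop) fun t => mem_Ici.2 (le_max_right t 0)
  intro t ht
  have h := ((hQ.integral_hasStrictDerivAt 0 t).hasDerivAt.const_add c).hasDerivWithinAt
    (s := Ici 0)
  rw [max_eq_left ht] at h
  have e : ∀ x ∈ Ici (0 : ℝ), (c + ∫ s in (0 : ℝ)..x, q s)
      = c + ∫ s in (0 : ℝ)..x, q (max s 0) := fun x hx => by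
    congr 1
    refine intervalIntegral.integral_congr fun s hs => ?_
    rw [uIcc_of_le hx] at hs
    simp only [max_eq_left hs.1]
  exact h.congr e (e t ht)

theorem Dec.reg_primitive {n r : ℕ} {q : ℝ → ℂ} (hq : Dec n r q) (c : ℂ) :
    Reg n r (fun t => c + ∫ s in (0 : ℝ)..t, q s) :=
  have h := hasD_primitive hq.wInt.1 c
  ⟨h.bounded hq.wInt.1 hq.wInt.integrableOn, q, h, hq⟩

theorem neg_integral_Ioi_eq {E : Type*} [NormedAddCommGroup E] [NormedSpace ℝ E] {q : ℝ → E}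
    (hq : IntegrableOn q (Ici 0)) {t : ℝ} (ht : 0 ≤ t) :
    -∫ s in Ioi t, q s = -(∫ s in Ioi (0 : ℝ), q s) + ∫ s in (0 : ℝ)..t, q s := by
  have h := intervalIntegral.integral_Ioi_sub_Ioi (μ := volume) (f := q) (a := 0) (b := t)
    (hq.mono_set Ioi_subset_Ici_self) ht
  rw [← h]; abel

theorem hasD_neg_integral_Ioi {q : ℝ → ℂ} (hq : ContinuousOn q (Ici 0))
    (hi : IntegrableOn q (Ici 0)) : HasD (fun t => -∫ s in Ioi t, q s) q :=
  (hasD_primitive hq _).congr (fun _ ht => neg_integral_Ioi_eq hi ht) fun _ _ => rfl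

theorem Dec.reg_neg_integral_Ioi {n r : ℕ} {q : ℝ → ℂ} (hq : Dec n r q) :
    Reg n r (fun t => -∫ s in Ioi t, q s) :=
  (hq.reg_primitive _).congr fun _ ht => neg_integral_Ioi_eq hq.wInt.integrableOn ht

theorem tendsto_neg_integral_Ioi {E : Type*} [NormedAddCommGroup E] [NormedSpace ℝ E]
    [CompleteSpace E] {q : ℝ → E} (hi : IntegrableOn q (Ici 0)) :
    Tendsto (fun t => -∫ s in Ioi t, q s) atTop (𝓝 0) := by
  have h := intervalIntegral_tendsto_integral_Ioi (0 : ℝ) (hi.mono_set Ioi_subset_Ici_self)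
    tendsto_id
  have h2 := h.const_add (-(∫ s in Ioi (0 : ℝ), q s))
  rw [neg_add_cancel] at h2
  refine h2.congr' ?_
  filter_upwards [eventually_ge_atTop 0] with t ht
  exact (neg_integral_Ioi_eq hi ht).symm

/-- The hypotheses on a boundary value, in terms of the classes used here. -/
theorem Dec.of_real (n : ℕ) : ∀ (r : ℕ) (f : ℝ → ℝ), ContDiffOn ℝ r f (Ici 0) →
    (∀ i ≤ r, IntegrableOn (fun t => (1 + t) ^ n * iteratedDerivWithin i f (Ici 0) t) (Ici 0)) →
    Dec n r (fun t => (f t : ℂ)) := by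
  have key : ∀ (r : ℕ) (f : ℝ → ℝ), ContDiffOn ℝ r f (Ici 0) →
      (∀ i ≤ r, IntegrableOn (fun t => (1 + t) ^ n * iteratedDerivWithin i f (Ici 0) t) (Ici 0)) →
      WInt n (fun t => (f t : ℂ)) := by
    intro r f hf hi
    refine ⟨Complex.continuous_ofReal.comp_continuousOn hf.continuousOn, ?_⟩
    refine IntegrableOn.congr_fun (Integrable.norm (hi 0 (Nat.zero_le _))) (fun t ht => ?_)
      measurableSet_Ici
    have ht' : (0 : ℝ) ≤ t := ht
    simp [abs_of_nonneg (by positivity : (0 : ℝ) ≤ 1 + t)]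
  intro r
  induction r with
  | zero => exact fun f hf hi => key 0 f hf hi
  | succ r ih =>
    intro f hf hi
    refine ⟨key _ f hf hi, fun t => ((derivWithin f (Ici 0) t : ℝ) : ℂ), fun t ht => ?_, ih _ ?_ ?_⟩
    · exact ((hf.differentiableOn (by simp) t ht).hasDerivWithinAt).ofReal_comp
    · push_cast at hf
      exact ((contDiffOn_succ_iff_derivWithin (uniqueDiffOn_Ici 0)).1 hf).2.2
    · intro i hir
      have := hi (i + 1) (by omega)
      simpa only [iteratedDerivWithin_succ'] using this

/-! ### Regularity of the coefficients -/

/-- Every entry lies in `Dec n r`. -/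
def MDec (n r : ℕ) (A : ℝ → Mat) : Prop := ∀ i l, Dec n r fun t => A t i l

/-- Every entry lies in `Reg n r`. -/
def MReg (n r : ℕ) (A : ℝ → Mat) : Prop := ∀ i l, Reg n r fun t => A t i l

section Closure
variable {n r a b : ℕ} {A B : ℝ → Mat} {f : ℝ → ℂ}

theorem MDec.mono (h : MDec n r A) (e : a ≤ r) : MDec n a A := fun i l => (h i l).mono e

theorem MDec.add (hA : MDec n r A) (hB : MDec n r B) : MDec n r fun t => A t + B t :=
  fun i l => (hA i l).add (hB i l)

theorem MDec.sub (hA : MDec n r A) (hB : MDec n r B) : MDec n r fun t => A t - B t :=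
  fun i l => (hA i l).sub (hB i l)

theorem MDec.zero (n r : ℕ) : MDec n r fun _ => 0 := fun _ _ => Dec.zero n r

theorem MDec.const_smul (c : ℂ) (hA : MDec n r A) : MDec n r fun t => c • A t :=
  fun i l => (hA i l).const_mul c

theorem MDec.left_mul (M : Mat) (hA : MDec n r A) : MDec n r fun t => M * A t := fun i l =>
  (((hA 0 l).const_mul (M i 0)).add ((hA 1 l).const_mul (M i 1))).congr fun t _ => by
    simp [Matrix.mul_apply]

theorem MDec.toReg (hA : MDec n (r + 1) A) : MReg n r A := fun i l => (hA i l).toReg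

theorem MReg.left_mul (M : Mat) (hA : MReg n r A) : MReg n r fun t => M * A t := fun i l =>
  (((Reg.const n r (M i 0)).mul (hA 0 l)).add ((Reg.const n r (M i 1)).mul (hA 1 l))).congr
    fun t _ => by simp [Matrix.mul_apply]

theorem MReg.smul (hf : Dec n a f) (hA : MReg n b A) (h : a ≤ b + 1) :
    MDec n a fun t => f t • A t := fun i l => hf.mul_reg (hA i l) h

theorem MDec.smul (hf : Reg n b f) (hA : MDec n a A) (h : a ≤ b + 1) :
    MDec n a fun t => f t • A t := fun i l => hf.mul_dec (hA i l) h

theorem MDec.dt (hA : MDec n (r + 1) A) : MDec n r (dt A) := fun i l => by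
  obtain ⟨_, f', h1, h2⟩ := hA i l
  exact h2.congr fun t ht => h1.derivWithin ht

end Closure

/-- The order of differentiability attached to the (shifted) index `N` of a coefficient. The
boundary value `g_j` has order `lev m j`, and each step of the recursion by three costs one
derivative. -/
def lev (m N : ℕ) : ℕ := (m + 5 - N) / 3

/-- The regularity of the coefficient with shifted index `N`: the algebraic part decays and has one
derivative more than that of the other part, which has a limit at infinity only. -/
def RegAt (m n N : ℕ) (c : Coef) : Prop :=
  MDec n (lev m N + 1) c.alg ∧ MReg n (lev m N) c.int

section Step
variable {lam : ℝ} {m n : ℕ} {g : Fin 3 → ℝ → ℝ}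

theorem BoundaryAssumption.dec (hg : BoundaryAssumption m n g) (j : Fin 3) :
    Dec n (lev m j) fun t => (g j t : ℂ) := Dec.of_real n _ _ (hg j).1 (hg j).2

/-- A bound on the regularity shared by the three boundary values. -/
theorem BoundaryAssumption.dec' (hg : BoundaryAssumption m n g) (j : Fin 3) :
    Dec n (lev m 5 + 1) fun t => (g j t : ℂ) :=
  (hg.dec j).mono (by have := j.2; unfold lev; omega)

/-- The algebraic part of the recursion gains what is needed. The coefficient of order `j - 2`
(`j - 3`) is multiplied by `g₁` (`g₂`), whose regularity suffices for `j ≥ 2` (`j ≥ 3`) only; for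
smaller `j` the coefficient vanishes. -/
theorem algStep_dec (hg : BoundaryAssumption m n g) {N : ℕ} (hN : N + 3 ≤ m + 5)
    {p₁ p₂ p₃ : Coef} (h₁ : RegAt m n (N + 2) p₁) (h₂ : RegAt m n (N + 1) p₂)
    (h₃ : RegAt m n N p₃) (z₂ : 1 ≤ N ∨ p₂.int = fun _ => 0) (z₃ : 2 ≤ N ∨ p₃.int = fun _ => 0) :
    MDec n (lev m (N + 3) + 1) (algStep g lam p₁ p₂ p₃) := by
  have hl : lev m (N + 3) + 1 = lev m N := by unfold lev; omega
  obtain ⟨a, ha⟩ : ∃ a, lev m 0 = a + 1 := ⟨lev m 3, by unfold lev; omega⟩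
  obtain ⟨b, hb⟩ : ∃ b, lev m 2 = b + 1 := ⟨lev m 5, by unfold lev; omega⟩
  have d0 : Dec n (a + 1) fun t => (g 0 t : ℂ) := ha ▸ hg.dec 0
  have d1 := hg.dec 1
  have d2 : Dec n (b + 1) fun t => (g 2 t : ℂ) := hb ▸ hg.dec 2
  have m0 : lev m N ≤ a + 1 := by rw [← ha]; unfold lev; omega
  have e1 : MDec n (lev m N) (dt p₃.alg) := h₃.1.dt
  have e2 : MDec n (lev m N) fun t => (4 * (g 0 t : ℂ)) • (sigma3 * sigmaLam lam * p₁.int t) :=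
    MReg.smul ((d0.const_mul 4).mono m0) (h₁.2.left_mul _) (by unfold lev; omega)
  have e3 : MDec n (lev m N)
      fun t => (2 * Complex.I * lam * (g 0 t : ℂ) ^ 2) • (sigma3 * p₂.alg t) :=
    MReg.smul (((d0.pow 1).const_mul _).mono m0) (h₂.1.toReg.left_mul _) (by unfold lev; omega)
  have e4 : MDec n (lev m N)
      fun t => (2 * Complex.I * (g 1 t : ℂ)) • (sigmaLam lam * p₂.int t) := by
    rcases z₂ with hz | hz
    · exact MReg.smul ((d1.const_mul _).mono (by simp only [lev, Fin.coe_ofNat_eq_mod]; omega))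
        (h₂.2.left_mul _) (by unfold lev; omega)
    · simpa [hz] using MDec.zero n (lev m N)
  have e5 : MDec n (lev m N) fun t => ((g 2 t : ℂ) - 2 * lam * (g 0 t : ℂ) ^ 3) •
      (sigma3 * sigmaLam lam * p₃.int t) := by
    rcases z₃ with hz | hz
    · have hmb : lev m N ≤ b + 1 := by rw [← hb]; unfold lev; omega
      exact MReg.smul ((d2.mono hmb).sub (((d0.pow 2).const_mul _).mono m0))
        (h₃.2.left_mul _) (by omega)
    · simpa [hz] using MDec.zero n (lev m N)
  rw [hl]
  exact ((((e1.add e2).add e3).sub e4).sub e5 |>.left_mul sigma3).const_smul (Complex.I / 8)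

theorem intRate_dec (hg : BoundaryAssumption m n g) {N : ℕ} (hN : N + 3 ≤ m + 5)
    {p₁ p₂ p₃ : Coef} (h₁ : RegAt m n (N + 2) p₁) (h₂ : RegAt m n (N + 1) p₂)
    (h₃ : RegAt m n N p₃) : MDec n (lev m (N + 3)) (intRate g lam p₁ p₂ p₃) := by
  have d0 := hg.dec' 0
  have d1 := hg.dec' 1
  have d2 := hg.dec' 2
  have ml : lev m (N + 3) ≤ lev m 5 + 1 := by unfold lev; omega
  have l1 : lev m (N + 3) ≤ lev m (N + 2) := by unfold lev; omega
  have l2 : lev m (N + 3) ≤ lev m (N + 1) := by unfold lev; omega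
  have l3 : lev m (N + 3) ≤ lev m N := by unfold lev; omega
  have A {c : ℝ → ℂ} {r : ℕ} {M : ℝ → Mat} (hc : Dec n (lev m 5 + 1) c) (hM : MDec n r M)
      (hr : lev m (N + 3) ≤ r) : MDec n (lev m (N + 3)) fun t => c t • M t :=
    MDec.smul hc.toReg (hM.mono hr) ml
  have B {c : ℝ → ℂ} {r : ℕ} {M : ℝ → Mat} (hc : Dec n (lev m 5 + 1) c) (hM : MReg n r M)
      (hr : lev m (N + 3) ≤ r) : MDec n (lev m (N + 3)) fun t => c t • M t :=
    MReg.smul (hc.mono ml) hM (by omega)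
  have c1 : Dec n (lev m 5 + 1) fun t => Complex.I * (g 0 t : ℂ) / 2 :=
    (d0.const_mul (Complex.I / 2)).congr fun t _ => by ring
  have c2 : Dec n (lev m 5 + 1) fun t => (g 1 t : ℂ) / 4 :=
    (d1.const_mul (1 / 4)).congr fun t _ => by ring
  have q : Dec n (lev m 5 + 1) fun t => (g 2 t : ℂ) - lam * (g 0 t : ℂ) ^ 3 :=
    d2.sub ((d0.pow 2).const_mul _)
  have c3 := q.const_mul (Complex.I / 8)
  have c4 : Dec n (lev m 5 + 1)
      fun t => Complex.I * lam / 2 * (g 1 t : ℂ) * (g 0 t : ℂ) ^ 2 :=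
    (d1.const_mul _).mul (d0.pow 1)
  have c5 : Dec n (lev m 5 + 1) fun t => Complex.I / 2 *
      (3 * (g 0 t : ℂ) ^ 4 - 2 * lam * (g 2 t : ℂ) * (g 0 t : ℂ) + lam * (g 1 t : ℂ) ^ 2) :=
    ((((d0.pow 3).const_mul 3).sub ((d2.const_mul (2 * lam)).mul d0)).add
      ((d1.pow 1).const_mul lam)).const_mul _
  have c6 : Dec n (lev m 5 + 1)
      fun t => 1 / 4 * (lam * (g 2 t : ℂ) - (g 0 t : ℂ) ^ 3) * (g 0 t : ℂ) ^ 2 :=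
    (((d2.const_mul (lam : ℂ)).sub (d0.pow 2)).const_mul (1 / 4)).mul (d0.pow 1)
  have c7 : Dec n (lev m 5 + 1) fun t => 1 / 4 * (g 0 t : ℂ) ^ 3 * (g 1 t : ℂ) :=
    ((d0.pow 2).const_mul (1 / 4)).mul d1
  have c8 : Dec n (lev m 5 + 1) fun t => Complex.I / 8 * ((g 2 t : ℂ) - lam * (g 0 t : ℂ) ^ 3) *
      (lam * (g 2 t : ℂ) - 2 * (g 0 t : ℂ) ^ 3) :=
    c3.mul ((d2.const_mul (lam : ℂ)).sub ((d0.pow 2).const_mul 2))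
  have a1 := A c1 (h₁.1.dt.left_mul (sigmaLam lam)) l1
  have a2 := A c2 (h₂.1.dt.left_mul (sigma3 * sigmaLam lam)) l2
  have a3 := A c3 (h₃.1.dt.left_mul (sigmaLam lam)) l3
  have a4 := A c4 (h₁.1.left_mul (sigmaLam lam)) (l1.trans (Nat.le_succ _))
  have a5 := B c5 (h₁.2.left_mul sigma3) l1
  have a6 := A c6 (h₂.1.left_mul (sigma3 * sigmaLam lam)) (l2.trans (Nat.le_succ _))
  have a7 := B c7 h₂.2 l2
  have a8 := B c8 (h₃.2.left_mul sigma3) l3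
  exact ((((((a1.add a2).sub a3).sub a4).add a5).sub a6).add a7).add a8

theorem regAt_zero (N : ℕ) : RegAt m n N ⟨fun _ => 0, fun _ => 0⟩ :=
  ⟨MDec.zero _ _, fun _ _ => Reg.const _ _ 0⟩

theorem regAt_const (N : ℕ) (M : Mat) : RegAt m n N ⟨fun _ => 0, fun _ => M⟩ :=
  ⟨MDec.zero _ _, fun i l => Reg.const _ _ (M i l)⟩

theorem tSeq_regAt (lam : ℝ) (hg : BoundaryAssumption m n g) :
    ∀ N, N ≤ m + 5 → RegAt m n N (tSeq g lam N)
  | 0, _ => regAt_zero 0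
  | 1, _ => regAt_zero 1
  | 2, _ => regAt_const 2 1
  | N + 3, hN => by
    have h₁ := tSeq_regAt lam hg (N + 2) (by omega)
    have h₂ := tSeq_regAt lam hg (N + 1) (by omega)
    have h₃ := tSeq_regAt lam hg N (by omega)
    refine ⟨algStep_dec hg hN h₁ h₂ h₃ ?_ ?_, fun i l => ?_⟩
    · rcases N with _ | N
      · exact Or.inr rfl
      · exact Or.inl (by omega)
    · rcases N with _ | _ | N
      · exact Or.inr rfl
      · exact Or.inr rfl
      · exact Or.inl (by omega)
    · exact (intRate_dec hg hN h₁ h₂ h₃ i l).reg_neg_integral_Ioi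

theorem vwSeq_regAt (lam : ℝ) (hg : BoundaryAssumption m n g) :
    ∀ N, N ≤ m + 5 → RegAt m n N (vwSeq g lam N).1 ∧ RegAt m n N (vwSeq g lam N).2
  | 0, _ => ⟨regAt_zero 0, regAt_zero 0⟩
  | 1, _ => ⟨regAt_zero 1, regAt_zero 1⟩
  | 2, _ => ⟨regAt_const 2 1, regAt_zero 2⟩
  | N + 3, hN => by
    have h₁ := vwSeq_regAt lam hg (N + 2) (by omega)
    have h₂ := vwSeq_regAt lam hg (N + 1) (by omega)
    have h₃ := vwSeq_regAt lam hg N (by omega)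
    have z₂ : 1 ≤ N ∨ vwSeq g lam (N + 1) =
        (⟨fun _ => 0, fun _ => 0⟩, ⟨fun _ => 0, fun _ => 0⟩) := by
      rcases N with _ | N
      · exact Or.inr rfl
      · exact Or.inl (by omega)
    have z₃ : 2 ≤ N ∨ vwSeq g lam N = (⟨fun _ => 0, fun _ => 0⟩, ⟨fun _ => 0, fun _ => 0⟩) := by
      rcases N with _ | _ | N
      · exact Or.inr rfl
      · exact Or.inr rfl
      · exact Or.inl (by omega)
    refine ⟨⟨algStep_dec hg hN h₁.1 h₂.1 h₃.1 ?_ ?_, fun i l => ?_⟩,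
      ⟨algStep_dec hg hN h₁.2 h₂.2 h₃.2 ?_ ?_, fun i l => ?_⟩⟩
    · exact z₂.imp_right fun h => by rw [h]
    · exact z₃.imp_right fun h => by rw [h]
    · exact (intRate_dec hg hN h₁.1 h₂.1 h₃.1 i l).reg_primitive _
    · exact z₂.imp_right fun h => by rw [h]
    · exact z₃.imp_right fun h => by rw [h]
    · exact (intRate_dec hg hN h₁.2 h₂.2 h₃.2 i l).reg_primitive _

theorem RegAt.isC1 {N : ℕ} {c : Coef} (h : RegAt m n N c) : IsC1 c.val := fun i l =>
  (h.1 i l).toReg.contDiffOn_one.add (h.2 i l).contDiffOn_one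

theorem tSeq_hasDt (lam : ℝ) (hg : BoundaryAssumption m n g) {N : ℕ} (hN : N + 3 ≤ m + 5) :
    HasDt (tSeq g lam (N + 3)).int
      (intRate g lam (tSeq g lam (N + 2)) (tSeq g lam (N + 1)) (tSeq g lam N)) := by
  have h := fun i l => (intRate_dec (lam := lam) hg hN (tSeq_regAt lam hg (N + 2) (by omega))
    (tSeq_regAt lam hg (N + 1) (by omega)) (tSeq_regAt lam hg N (by omega)) i l).wInt
  exact fun t ht i l => hasD_neg_integral_Ioi (h i l).1 (h i l).integrableOn t ht

theorem vwSeq_hasDt (lam : ℝ) (hg : BoundaryAssumption m n g) {N : ℕ} (hN : N + 3 ≤ m + 5) :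
    HasDt (vwSeq g lam (N + 3)).1.int
      (intRate g lam (vwSeq g lam (N + 2)).1 (vwSeq g lam (N + 1)).1 (vwSeq g lam N).1) ∧
    HasDt (vwSeq g lam (N + 3)).2.int
      (intRate g lam (vwSeq g lam (N + 2)).2 (vwSeq g lam (N + 1)).2 (vwSeq g lam N).2) := by
  have h₁ := vwSeq_regAt lam hg (N + 2) (by omega)
  have h₂ := vwSeq_regAt lam hg (N + 1) (by omega)
  have h₃ := vwSeq_regAt lam hg N (by omega)
  exact ⟨fun t ht i l => hasD_primitive (intRate_dec hg hN h₁.1 h₂.1 h₃.1 i l).wInt.1 _ t ht,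
    fun t ht i l => hasD_primitive (intRate_dec hg hN h₁.2 h₂.2 h₃.2 i l).wInt.1 _ t ht⟩

theorem tCoef_tendsto (lam : ℝ) (hg : BoundaryAssumption m n g) {j : ℕ} (h1 : 1 ≤ j)
    (hj : j ≤ m + 3) (i l : Fin 2) : Tendsto (fun t => tCoef g lam j t i l) atTop (𝓝 0) := by
  obtain ⟨N, rfl⟩ : ∃ N, j = N + 1 := ⟨j - 1, by omega⟩
  have ha := ((tSeq_regAt lam hg (N + 3) (by omega)).1 i l).tendsto_zero
  have h := (intRate_dec (lam := lam) hg (by omega : N + 3 ≤ m + 5)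
    (tSeq_regAt lam hg (N + 2) (by omega))
    (tSeq_regAt lam hg (N + 1) (by omega)) (tSeq_regAt lam hg N (by omega)) i l).wInt
  have h2 := ha.add (tendsto_neg_integral_Ioi h.integrableOn)
  rw [add_zero] at h2
  exact h2

theorem tWellDefined (lam : ℝ) (hg : BoundaryAssumption m n g) {j : ℕ} (h1 : 1 ≤ j)
    (hj : j ≤ m + 3) : TWellDefined g lam j := by
  refine ⟨(tSeq_regAt lam hg (j + 2) (by omega)).isC1, ?_, ?_, tCoef_tendsto lam hg h1 hj⟩
  all_goals obtain ⟨N, rfl⟩ : ∃ N, j = N + 1 := ⟨j - 1, by omega⟩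
  · exact fun i l => (intRate_dec hg (by omega : N + 3 ≤ m + 5)
      (tSeq_regAt lam hg (N + 2) (by omega))
      (tSeq_regAt lam hg (N + 1) (by omega)) (tSeq_regAt lam hg N (by omega)) i l).wInt.integrableOn
  · exact tSeq_hasDt lam hg (by omega)

theorem vCoef_add_wCoef (g : Fin 3 → ℝ → ℝ) (lam : ℝ) (N : ℕ) :
    vCoef g lam (N + 1) 0 + wCoef g lam (N + 1) 0 = 0 := by
  ext i l
  simp only [vCoef, wCoef, vwSeq, Coef.val, Matrix.add_apply, Matrix.of_apply,
    intervalIntegral.integral_same, Matrix.zero_apply]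
  ring

theorem vwWellDefined (lam : ℝ) (hg : BoundaryAssumption m n g) {j : ℕ} (h1 : 1 ≤ j)
    (hj : j ≤ m + 3) : VWWellDefined g lam j := by
  have h := vwSeq_regAt lam hg (j + 2) (by omega)
  obtain ⟨N, rfl⟩ : ∃ N, j = N + 1 := ⟨j - 1, by omega⟩
  have h2 := vwSeq_hasDt lam hg (N := N) (by omega)
  exact ⟨h.1.isC1, h.2.isC1, h2.1, h2.2, vCoef_add_wCoef g lam N⟩

end Step

/-! ### The remainder of a truncated formal solution -/

/-- Coefficient of `k²` in `laxV`. -/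
def lax2 (g : Fin 3 → ℝ → ℝ) (lam : ℝ) (t : ℝ) : Mat :=
  (-4 * (g 0 t : ℂ)) • (sigma3 * sigmaLam lam)

/-- Diagonal part of the coefficient of `k` in `laxV`. -/
def lax1d (g : Fin 3 → ℝ → ℝ) (lam : ℝ) (t : ℝ) : Mat :=
  (-2 * Complex.I * lam * (g 0 t : ℂ) ^ 2) • sigma3

/-- Off-diagonal part of the coefficient of `k` in `laxV`. -/
def lax1o (g : Fin 3 → ℝ → ℝ) (lam : ℝ) (t : ℝ) : Mat :=
  (2 * Complex.I * (g 1 t : ℂ)) • sigmaLam lam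

/-- Coefficient of `k⁰` in `laxV`. -/
def lax0 (g : Fin 3 → ℝ → ℝ) (lam : ℝ) (t : ℝ) : Mat :=
  ((g 2 t : ℂ) - 2 * lam * (g 0 t : ℂ) ^ 3) • (sigma3 * sigmaLam lam)

theorem laxV_eq {lam : ℝ} (hlam : lam = 1 ∨ lam = -1) (g : Fin 3 → ℝ → ℝ) (t : ℝ) (k : ℂ) :
    laxV g lam t k =
      k ^ 2 • lax2 g lam t + k • (lax1d g lam t + lax1o g lam t) + lax0 g lam t := by
  have h : (lam : ℂ) ^ 2 = 1 := by rcases hlam with rfl | rfl <;> norm_num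
  ext i l
  fin_cases i <;> fin_cases l <;>
    simp [laxV, lax2, lax1d, lax1o, lax0, sigma3, sigmaLam] <;>
    first | ring1 | linear_combination (2 * (g 0 t : ℂ) ^ 3) * h

theorem sigma3_mul_apply_zero (A : Mat) (l : Fin 2) : (sigma3 * A) 0 l = A 0 l := by
  simp [sigma3, Matrix.mul_apply, -Matrix.cons_mul]

theorem sigma3_mul_apply_one (A : Mat) (l : Fin 2) : (sigma3 * A) 1 l = -A 1 l := by
  simp [sigma3, Matrix.mul_apply, -Matrix.cons_mul]

theorem sigmaLam_mul_apply_zero (lam : ℝ) (A : Mat) (l : Fin 2) :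
    (sigmaLam lam * A) 0 l = A 1 l := by
  simp [sigmaLam, Matrix.mul_apply, -Matrix.cons_mul]

theorem sigmaLam_mul_apply_one (lam : ℝ) (A : Mat) (l : Fin 2) :
    (sigmaLam lam * A) 1 l = -lam * A 0 l := by
  simp [sigmaLam, Matrix.mul_apply, -Matrix.cons_mul]

theorem sigma3_mul_algStep (g : Fin 3 → ℝ → ℝ) (lam : ℝ) (p₁ p₂ p₃ : Coef) (t : ℝ) :
    (8 * Complex.I) • (sigma3 * algStep g lam p₁ p₂ p₃ t) =
      -(dt p₃.alg t - lax2 g lam t * p₁.int t - lax1d g lam t * p₂.alg t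
        - lax1o g lam t * p₂.int t - lax0 g lam t * p₃.int t) := by
  have hI : Complex.I ^ 2 = -1 := Complex.I_sq
  ext i l
  fin_cases i <;>
    simp only [algStep, lax2, lax1d, lax1o, lax0, Matrix.mul_assoc, Matrix.smul_mul,
      Matrix.mul_smul, Matrix.add_apply, Matrix.sub_apply, Matrix.neg_apply, Matrix.smul_apply,
      smul_eq_mul, sigma3_mul_apply_zero, sigma3_mul_apply_one, sigmaLam_mul_apply_zero,
      sigmaLam_mul_apply_one, Fin.mk_one, Fin.zero_eta] <;>
    generalize Complex.I = ι at * <;> grind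

/-- Eliminating the algebraic parts from the integrated half of the equation leaves `intRate`. -/
theorem intRate_eq {lam : ℝ} (hlam : lam = 1 ∨ lam = -1) (g : Fin 3 → ℝ → ℝ) (t : ℝ)
    {c₀ c₁ c₂ q₁ q₂ q₃ : Coef} (h₂ : c₂.alg t = algStep g lam q₁ q₂ q₃ t)
    (h₁ : c₁.alg t = algStep g lam c₂ q₁ q₂ t) (h₀ : c₀.alg t = algStep g lam c₁ c₂ q₁ t) :
    intRate g lam q₁ q₂ q₃ t = lax2 g lam t * c₀.alg t + lax1d g lam t * c₁.int t
      + lax1o g lam t * c₁.alg t + lax0 g lam t * c₂.alg t := by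
  have hI : Complex.I ^ 2 = -1 := Complex.I_sq
  have h : (lam : ℂ) ^ 2 = 1 := by rcases hlam with rfl | rfl <;> norm_num
  rw [h₀, h₁]
  ext i l
  have h0 := congrFun (congrFun h₂ 0) l
  have h1 := congrFun (congrFun h₂ 1) l
  simp only [algStep, Matrix.mul_assoc, Matrix.add_apply, Matrix.sub_apply, Matrix.smul_apply,
      smul_eq_mul, sigma3_mul_apply_zero, sigma3_mul_apply_one, sigmaLam_mul_apply_zero,
      sigmaLam_mul_apply_one] at h0 h1
  fin_cases i <;>
    simp only [algStep, intRate, lax2, lax1d, lax1o, lax0, Matrix.mul_assoc, Matrix.smul_mul,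
      Matrix.mul_smul, Matrix.add_apply, Matrix.sub_apply, Matrix.smul_apply,
      smul_eq_mul, sigma3_mul_apply_zero, sigma3_mul_apply_one, sigmaLam_mul_apply_zero,
      sigmaLam_mul_apply_one, Fin.mk_one, Fin.zero_eta] <;>
    generalize Complex.I = ι at * <;> grind

/-- The `t`-derivative of `c.val`. -/
def Coef.dval (c : Coef) (t : ℝ) : Mat := dt c.alg t + dt c.int t

/-- `c` has complementary zero patterns: `alg` vanishes at the entries selected by `q`, `int` at
the others. -/
def Coef.Parity (q : Fin 2 → Fin 2 → Prop) (c : Coef) : Prop :=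
  (∀ i l, q i l → ∀ t, c.alg t i l = 0) ∧ ∀ i l, ¬ q i l → ∀ t, c.int t i l = 0

/-- `p` is a formal solution `∑ⱼ p (j+2) / k^j` of the recursion, up to the order `j = m + 3`. -/
structure Formal (m n : ℕ) (g : Fin 3 → ℝ → ℝ) (lam : ℝ) (q : Fin 2 → Fin 2 → Prop)
    (p : ℕ → Coef) : Prop where
  reg : ∀ N, N ≤ m + 5 → RegAt m n N (p N)
  zero : p 0 = ⟨fun _ => 0, fun _ => 0⟩
  one : p 1 = ⟨fun _ => 0, fun _ => 0⟩
  two : ∃ M, p 2 = ⟨fun _ => 0, fun _ => M⟩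
  alg_succ : ∀ N, (p (N + 3)).alg = algStep g lam (p (N + 2)) (p (N + 1)) (p N)
  int_succ : ∀ N, N + 3 ≤ m + 5 →
    HasDt (p (N + 3)).int (intRate g lam (p (N + 2)) (p (N + 1)) (p N))
  parity : ∀ N, (p N).Parity q

section Parity
variable {q : Fin 2 → Fin 2 → Prop} {p₁ p₂ p₃ : Coef}

theorem Coef.Parity.dt_alg {c : Coef} (h : c.Parity q) {i l : Fin 2} (hq : q i l) (t : ℝ) :
    dt c.alg t i l = 0 := by
  have e : (fun s => c.alg s i l) = fun _ => (0 : ℂ) := funext (h.1 i l hq)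
  simp [dt, e]

theorem algStep_parity (hq : ∀ l, q 0 l ↔ ¬ q 1 l) (g : Fin 3 → ℝ → ℝ) (lam : ℝ)
    (h₁ : p₁.Parity q) (h₂ : p₂.Parity q) (h₃ : p₃.Parity q) (i l : Fin 2) (h : q i l) (t : ℝ) :
    algStep g lam p₁ p₂ p₃ t i l = 0 := by
  fin_cases i
  · have h0 : q 0 l := h
    have h' : ¬ q 1 l := (hq l).1 h
    simp [algStep, Matrix.mul_assoc, sigma3_mul_apply_zero, sigmaLam_mul_apply_zero,
      h₃.dt_alg h0, h₁.2 1 l h', h₂.1 0 l h, h₂.2 1 l h', h₃.2 1 l h']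
  · have h1 : q 1 l := h
    have h' : ¬ q 0 l := fun h0 => (hq l).1 h0 h
    simp [algStep, Matrix.mul_assoc, sigma3_mul_apply_one, sigmaLam_mul_apply_one,
      h₃.dt_alg h1, h₁.2 0 l h', h₂.1 1 l h, h₂.2 0 l h', h₃.2 0 l h']

theorem intRate_parity (hq : ∀ l, q 0 l ↔ ¬ q 1 l) (g : Fin 3 → ℝ → ℝ) (lam : ℝ)
    (h₁ : p₁.Parity q) (h₂ : p₂.Parity q) (h₃ : p₃.Parity q) (i l : Fin 2) (h : ¬ q i l) (t : ℝ) :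
    intRate g lam p₁ p₂ p₃ t i l = 0 := by
  fin_cases i
  · have h' : q 1 l := by by_contra h1; exact h ((hq l).2 h1)
    simp [intRate, Matrix.mul_assoc, sigma3_mul_apply_zero, sigmaLam_mul_apply_zero,
      h₁.dt_alg h', h₂.dt_alg h', h₃.dt_alg h', h₁.1 1 l h', h₁.2 0 l h, h₂.1 1 l h',
      h₂.2 0 l h, h₃.2 0 l h]
  · have h' : q 0 l := (hq l).2 h
    simp [intRate, Matrix.mul_assoc, sigma3_mul_apply_one, sigmaLam_mul_apply_one,
      h₁.dt_alg h', h₂.dt_alg h', h₃.dt_alg h', h₁.1 0 l h', h₁.2 1 l h, h₂.1 0 l h',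
      h₂.2 1 l h, h₃.2 1 l h]

theorem parity_zero : Coef.Parity q ⟨fun _ => 0, fun _ => 0⟩ := by simp [Coef.Parity]

theorem parity_diag : Coef.Parity (fun i l => i = l) ⟨fun _ => 0, fun _ => 1⟩ :=
  ⟨by simp, fun _ _ h _ => Matrix.one_apply_ne h⟩

theorem diag_compl (l : Fin 2) : (0 : Fin 2) = l ↔ ¬ (1 : Fin 2) = l := by fin_cases l <;> simp

theorem offDiag_compl (l : Fin 2) : (0 : Fin 2) ≠ l ↔ ¬ (1 : Fin 2) ≠ l := by
  fin_cases l <;> simp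

theorem tSeq_parity (g : Fin 3 → ℝ → ℝ) (lam : ℝ) :
    ∀ N, (tSeq g lam N).Parity (fun i l => i = l)
  | 0 => parity_zero
  | 1 => parity_zero
  | 2 => parity_diag
  | N + 3 => by
    have h₁ := tSeq_parity g lam (N + 2)
    have h₂ := tSeq_parity g lam (N + 1)
    have h₃ := tSeq_parity g lam N
    refine ⟨algStep_parity diag_compl g lam h₁ h₂ h₃, fun i l h t => ?_⟩
    simp [tSeq, intRate_parity diag_compl g lam h₁ h₂ h₃ i l h]

theorem vwSeq_parity (g : Fin 3 → ℝ → ℝ) (lam : ℝ) :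
    ∀ N, (vwSeq g lam N).1.Parity (fun i l => i = l) ∧ (vwSeq g lam N).2.Parity (fun i l => i ≠ l)
  | 0 => ⟨parity_zero, parity_zero⟩
  | 1 => ⟨parity_zero, parity_zero⟩
  | 2 => ⟨parity_diag, parity_zero⟩
  | N + 3 => by
    have h₁ := vwSeq_parity g lam (N + 2)
    have h₂ := vwSeq_parity g lam (N + 1)
    have h₃ := vwSeq_parity g lam N
    have av := algStep_parity diag_compl g lam h₁.1 h₂.1 h₃.1
    have aw := algStep_parity offDiag_compl g lam h₁.2 h₂.2 h₃.2
    refine ⟨⟨av, fun i l h t => ?_⟩, ⟨aw, fun i l h t => ?_⟩⟩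
    · simp [vwSeq, intRate_parity diag_compl g lam h₁.1 h₂.1 h₃.1 i l h, aw i l h]
    · simp [vwSeq, intRate_parity offDiag_compl g lam h₁.2 h₂.2 h₃.2 i l h,
        av i l (not_not.1 h)]

end Parity

section Formal
variable {lam : ℝ} {m n : ℕ} {g : Fin 3 → ℝ → ℝ} {q : Fin 2 → Fin 2 → Prop} {p : ℕ → Coef}

theorem tSeq_formal (lam : ℝ) (hg : BoundaryAssumption m n g) :
    Formal m n g lam (fun i l => i = l) (tSeq g lam) where
  reg := tSeq_regAt lam hg
  zero := rfl
  one := rfl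
  two := ⟨1, rfl⟩
  alg_succ _ := rfl
  int_succ _ hN := tSeq_hasDt lam hg hN
  parity := tSeq_parity g lam

theorem vSeq_formal (lam : ℝ) (hg : BoundaryAssumption m n g) :
    Formal m n g lam (fun i l => i = l) (fun N => (vwSeq g lam N).1) where
  reg N hN := (vwSeq_regAt lam hg N hN).1
  zero := rfl
  one := rfl
  two := ⟨1, rfl⟩
  alg_succ _ := rfl
  int_succ _ hN := (vwSeq_hasDt lam hg hN).1
  parity N := (vwSeq_parity g lam N).1

theorem wSeq_formal (lam : ℝ) (hg : BoundaryAssumption m n g) :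
    Formal m n g lam (fun i l => i ≠ l) (fun N => (vwSeq g lam N).2) where
  reg N hN := (vwSeq_regAt lam hg N hN).2
  zero := rfl
  one := rfl
  two := ⟨0, rfl⟩
  alg_succ _ := rfl
  int_succ _ hN := (vwSeq_hasDt lam hg hN).2
  parity N := (vwSeq_parity g lam N).2

/-- The truncated sum `∑_{j ≤ M} p (j+2) / k^j`. -/
def psum (p : ℕ → Coef) (M : ℕ) (t : ℝ) (k : ℂ) : Mat :=
  ∑ j ∈ Finset.range (M + 1), (1 / k ^ j) • (p (j + 2)).val t

/-- The remainder of the truncated sum in the differential equation. -/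
def pres (g : Fin 3 → ℝ → ℝ) (lam : ℝ) (p : ℕ → Coef) (M : ℕ) (t : ℝ) (k : ℂ) : Mat :=
  ∑ j ∈ Finset.range (M + 1), (1 / k ^ j) • ((p (j + 2)).dval t
    + (8 * Complex.I * k ^ 3) • (sigma3 * (p (j + 2)).alg t) - laxV g lam t k * (p (j + 2)).val t)

/-- Coefficient of `k^(2-M)` in the remainder `pres`. -/
def rem2 (g : Fin 3 → ℝ → ℝ) (lam : ℝ) (p : ℕ → Coef) (M : ℕ) (t : ℝ) : Mat :=
  dt (p M).alg t - lax2 g lam t * (p (M + 2)).int t - lax1d g lam t * (p (M + 1)).alg t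
    - lax1o g lam t * (p (M + 1)).int t - lax0 g lam t * (p M).int t

/-- Coefficient of `k^(1-M)` in the remainder `pres`. -/
def rem1 (g : Fin 3 → ℝ → ℝ) (lam : ℝ) (p : ℕ → Coef) (M : ℕ) (t : ℝ) : Mat :=
  (p (M + 1)).dval t - (lax1d g lam t + lax1o g lam t) * (p (M + 2)).val t
    - lax0 g lam t * (p (M + 1)).val t

/-- Coefficient of `k^(-M)` in the remainder `pres`. -/
def rem0 (g : Fin 3 → ℝ → ℝ) (lam : ℝ) (p : ℕ → Coef) (M : ℕ) (t : ℝ) : Mat :=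
  (p (M + 2)).dval t - lax0 g lam t * (p (M + 2)).val t

theorem HasDt.dt_eq {A B : ℝ → Mat} (h : HasDt A B) {t : ℝ} (ht : 0 ≤ t) : dt A t = B t := by
  ext i l
  exact (h t ht i l).derivWithin (uniqueDiffOn_Ici 0 t ht)

theorem dt_const (M : Mat) (t : ℝ) : dt (fun _ => M) t = 0 := by
  ext i l
  simp [dt]

theorem algStep_zero (g : Fin 3 → ℝ → ℝ) (lam t : ℝ) :
    algStep g lam ⟨fun _ => 0, fun _ => 0⟩ ⟨fun _ => 0, fun _ => 0⟩ ⟨fun _ => 0, fun _ => 0⟩ t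
      = 0 := by
  simp [algStep, dt_const]

theorem intRate_zero (g : Fin 3 → ℝ → ℝ) (lam t : ℝ) :
    intRate g lam ⟨fun _ => 0, fun _ => 0⟩ ⟨fun _ => 0, fun _ => 0⟩ ⟨fun _ => 0, fun _ => 0⟩ t
      = 0 := by
  simp [intRate, dt_const]

/-- The integrated half of the equation, order by order. -/
theorem Formal.dt_int (F : Formal m n g lam q p) (hlam : lam = 1 ∨ lam = -1) {M : ℕ}
    (hM : M + 1 ≤ m + 5) {t : ℝ} (ht : 0 ≤ t) :
    dt (p (M + 1)).int t = lax2 g lam t * (p (M + 3)).alg t + lax1d g lam t * (p (M + 2)).int t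
      + lax1o g lam t * (p (M + 2)).alg t + lax0 g lam t * (p (M + 1)).alg t := by
  obtain ⟨M₀, hM₀⟩ := F.two
  rcases M with _ | _ | N
  · -- Below order `0` the coefficients vanish, which is consistent with the recursion.
    have h := intRate_eq hlam g t (c₀ := p 3) (c₁ := p 2) (c₂ := p 1) (q₁ := p 0) (q₂ := p 0)
      (q₃ := p 0) (by rw [F.one, F.zero, algStep_zero]) (by rw [hM₀, F.one, F.zero, algStep_zero])
      (by rw [F.alg_succ])
    rw [← h, F.one, F.zero, intRate_zero, dt_const]
  · have h := intRate_eq hlam g t (c₀ := p 4) (c₁ := p 3) (c₂ := p 2) (q₁ := p 1) (q₂ := p 0)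
      (q₃ := p 0) (by rw [hM₀, F.one, F.zero, algStep_zero]) (by rw [F.alg_succ])
      (by rw [F.alg_succ])
    rw [← h, hM₀, F.one, F.zero, intRate_zero, dt_const]
  · rw [(F.int_succ N (by omega)).dt_eq ht]
    exact intRate_eq hlam g t (by rw [F.alg_succ]) (by rw [F.alg_succ]) (by rw [F.alg_succ])

/-- All orders of the remainder cancel except the last three. -/
theorem Formal.pres_eq (F : Formal m n g lam q p) (hlam : lam = 1 ∨ lam = -1) {t : ℝ}
    (ht : 0 ≤ t) {k : ℂ} (hk : k ≠ 0) : ∀ M, M ≤ m + 3 → pres g lam p M t k =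
      (1 / k ^ M) • (k ^ 2 • rem2 g lam p M t + k • rem1 g lam p M t + rem0 g lam p M t)
  | 0, _ => by
    obtain ⟨M₀, hM₀⟩ := F.two
    simp only [pres, rem2, rem1, rem0, zero_add, Finset.range_one, Finset.sum_singleton, hM₀,
      F.one, F.zero, Coef.dval, Coef.val, dt_const, laxV_eq hlam, add_mul, Matrix.smul_mul,
      mul_zero, add_zero, zero_add, smul_zero]
    module
  | M + 1, hM => by
    have a : (8 * Complex.I) • (sigma3 * (p (M + 3)).alg t) = -rem2 g lam p M t := by
      rw [F.alg_succ, sigma3_mul_algStep]; rfl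
    have b : rem1 g lam p M t - lax2 g lam t * (p (M + 3)).val t = rem2 g lam p (M + 1) t := by
      simp only [rem1, rem2, Coef.dval, Coef.val, F.dt_int hlam (by omega : M + 1 ≤ m + 5) ht,
        mul_add, add_mul, show M + 1 + 2 = M + 3 by ring, show M + 1 + 1 = M + 2 by ring]
      abel
    have ih := F.pres_eq hlam ht hk M (by omega)
    have hc : 1 / k ^ M = 1 / k ^ (M + 1) * k := by rw [pow_succ]; field_simp
    have a' : (8 * Complex.I * k ^ 3) • (sigma3 * (p (M + 3)).alg t)
        = -(k ^ 3 • rem2 g lam p M t) := by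
      rw [mul_comm, mul_smul, a, smul_neg]
    rw [pres, Finset.sum_range_succ, ← pres, ih, hc, ← b]
    simp only [show M + 1 + 2 = M + 3 by ring, a', laxV_eq hlam, add_mul, Matrix.smul_mul, rem1,
      rem0, show M + 1 + 1 = M + 2 by ring]
    module

/-- The diagonal entries of `sigma3`. -/
def eps (i : Fin 2) : ℂ := if i = 0 then 1 else -1

theorem sigma3_mul_apply (A : Mat) (i l : Fin 2) : (sigma3 * A) i l = eps i * A i l := by
  fin_cases i
  · simpa [eps] using sigma3_mul_apply_zero A l
  · simpa [eps] using sigma3_mul_apply_one A l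

theorem Formal.hasD_val (F : Formal m n g lam q p) {N : ℕ} (hN : N ≤ m + 5) (i l : Fin 2) :
    HasD (fun t => (p N).val t i l) fun t => (p N).dval t i l := by
  obtain ⟨_, a', ha, _⟩ := (F.reg N hN).1 i l
  obtain ⟨_, b', hb, _⟩ := (F.reg N hN).2 i l
  refine HasD.congr (fun t ht => (ha t ht).add (hb t ht)) (fun t _ => rfl) fun t ht => ?_
  simp only [Coef.dval, dt, Matrix.add_apply, Matrix.of_apply, ha.derivWithin ht,
    hb.derivWithin ht]

/-- The differential equation of a truncated formal solution. The sign `τ` is `-1` for the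
commutator with `sigma3` and `1` for the anticommutator. -/
theorem Formal.hasD_psum (F : Formal m n g lam q p) {τ : ℂ}
    (hτ : ∀ i l, (q i l → eps i + τ * eps l = 0) ∧ (¬ q i l → eps i = τ * eps l))
    (k : ℂ) {M : ℕ} (hM : M ≤ m + 3) (i l : Fin 2) :
    HasD (fun t => psum p M t k i l) fun t =>
      -(4 * Complex.I * k ^ 3 * (eps i + τ * eps l)) * psum p M t k i l
        + (laxV g lam t k * psum p M t k) i l + pres g lam p M t k i l := by
  have h : HasD (fun t => ∑ j ∈ Finset.range (M + 1), (1 / k ^ j) * (p (j + 2)).val t i l)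
      fun t => ∑ j ∈ Finset.range (M + 1), (1 / k ^ j) * (p (j + 2)).dval t i l := fun t ht =>
    HasDerivWithinAt.fun_sum fun j hj => (F.hasD_val (by
      have := Finset.mem_range.1 hj; omega) i l t ht).const_mul _
  refine h.congr (fun t _ => ?_) fun t _ => ?_
  · simp [psum, Matrix.sum_apply]
  · simp only [psum, pres, Matrix.sum_apply, Matrix.smul_apply, Finset.mul_sum,
      smul_eq_mul, Matrix.sub_apply, Matrix.add_apply, sigma3_mul_apply, Matrix.mul_smul,
      ← Finset.sum_add_distrib]
    refine Finset.sum_congr rfl fun j _ => ?_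
    have e : (2 * eps i) * (p (j + 2)).alg t i l
        = (eps i + τ * eps l) * (p (j + 2)).val t i l := by
      by_cases hq : q i l
      · rw [(hτ i l).1 hq, (F.parity _).1 i l hq t]; ring
      · rw [← (hτ i l).2 hq, Coef.val, Matrix.add_apply, (F.parity _).2 i l hq t]; ring
    linear_combination (4 * Complex.I * k ^ 3 / k ^ j) * e

theorem MReg.dt {n r : ℕ} {A : ℝ → Mat} (hA : MReg n r A) : MDec n r (dt A) := fun i l => by
  obtain ⟨_, f', h1, h2⟩ := hA i l
  exact h2.congr fun t ht => h1.derivWithin ht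

theorem RegAt.val {N : ℕ} {c : Coef} (h : RegAt m n N c) : MReg n 0 c.val := fun i l =>
  ((h.1 i l).toReg.mono (Nat.zero_le _)).add ((h.2 i l).mono (Nat.zero_le _))

theorem RegAt.dval {N : ℕ} {c : Coef} (h : RegAt m n N c) : MDec n 0 c.dval :=
  (h.1.dt.mono (Nat.zero_le _)).add (h.2.dt.mono (Nat.zero_le _))

section Rem
variable (hg : BoundaryAssumption m n g) {A : ℝ → Mat}
include hg

theorem lax2_mul (hA : MReg n 0 A) : MDec n 0 fun t => lax2 g lam t * A t := by
  simp only [lax2, Matrix.smul_mul]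
  exact MReg.smul (((hg.dec' 0).const_mul _).mono (Nat.zero_le _)) (hA.left_mul _) (by simp)

theorem lax1d_mul (hA : MReg n 0 A) : MDec n 0 fun t => lax1d g lam t * A t := by
  simp only [lax1d, Matrix.smul_mul]
  exact MReg.smul ((((hg.dec' 0).pow 1).const_mul _).mono (Nat.zero_le _)) (hA.left_mul _)
    (by simp)

theorem lax1o_mul (hA : MReg n 0 A) : MDec n 0 fun t => lax1o g lam t * A t := by
  simp only [lax1o, Matrix.smul_mul]
  exact MReg.smul (((hg.dec' 1).const_mul _).mono (Nat.zero_le _)) (hA.left_mul _) (by simp)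

theorem lax0_mul (hA : MReg n 0 A) : MDec n 0 fun t => lax0 g lam t * A t := by
  simp only [lax0, Matrix.smul_mul]
  exact MReg.smul (((hg.dec' 2).sub (((hg.dec' 0).pow 2).const_mul _)).mono (Nat.zero_le _))
    (hA.left_mul _) (by simp)

theorem Formal.rem_dec (F : Formal m n g lam q p) {M : ℕ} (hM : M ≤ m + 3) :
    MDec n 0 (rem2 g lam p M) ∧ MDec n 0 (rem1 g lam p M) ∧ MDec n 0 (rem0 g lam p M) := by
  have R2 := F.reg (M + 2) (by omega)
  have R1 := F.reg (M + 1) (by omega)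
  have R0 := F.reg M (by omega)
  have i2 : MReg n 0 (p (M + 2)).int := fun i l => (R2.2 i l).mono (Nat.zero_le _)
  have i1 : MReg n 0 (p (M + 1)).int := fun i l => (R1.2 i l).mono (Nat.zero_le _)
  have i0 : MReg n 0 (p M).int := fun i l => (R0.2 i l).mono (Nat.zero_le _)
  have a1 : MReg n 0 (p (M + 1)).alg := fun i l => ((R1.1 i l).toReg).mono (Nat.zero_le _)
  refine ⟨?_, ?_, R2.dval.sub (lax0_mul hg R2.val)⟩
  · exact ((((R0.1.dt.mono (Nat.zero_le _)).sub (lax2_mul hg i2)).sub (lax1d_mul hg a1)).sub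
      (lax1o_mul hg i1)).sub (lax0_mul hg i0)
  · exact fun i l => (((R1.dval.sub ((lax1d_mul (lam := lam) hg R2.val).add
      (lax1o_mul (lam := lam) hg R2.val))).sub
      (lax0_mul (lam := lam) hg R1.val)) i l).congr fun t _ => by simp only [rem1, add_mul]

/-- The remainder of order `m + 3` is `O(|k|^{-m-1})`, with an integrable majorant in `t`. -/
theorem Formal.exists_bound (F : Formal m n g lam q p) (hlam : lam = 1 ∨ lam = -1) :
    ∃ f : ℝ → ℝ, ContinuousOn f (Ici 0) ∧ IntegrableOn (fun t => (1 + t) ^ n * f t) (Ici 0) ∧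
      (∀ t, 0 ≤ f t) ∧ ∀ t, 0 ≤ t → ∀ k : ℂ, 1 ≤ ‖k‖ → ∀ i l,
        ‖pres g lam p (m + 3) t k i l‖ ≤ f t / ‖k‖ ^ (m + 1) := by
  obtain ⟨h2, h1, h0⟩ := F.rem_dec hg le_rfl
  set R2 := rem2 g lam p (m + 3)
  set R1 := rem1 g lam p (m + 3)
  set R0 := rem0 g lam p (m + 3)
  have hW : ∀ i l, WInt n (fun t => R2 t i l) ∧ WInt n (fun t => R1 t i l) ∧
      WInt n (fun t => R0 t i l) := fun i l => ⟨(h2 i l).wInt, (h1 i l).wInt, (h0 i l).wInt⟩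
  refine ⟨fun t => ∑ i, ∑ l, (‖R2 t i l‖ + ‖R1 t i l‖ + ‖R0 t i l‖), ?_, ?_, ?_, ?_⟩
  · exact continuousOn_finsetSum _ fun i _ => continuousOn_finsetSum _ fun l _ =>
      ((hW i l).1.1.norm.add (hW i l).2.1.1.norm).add (hW i l).2.2.1.norm
  · simp only [Finset.mul_sum, mul_add]
    exact integrable_finsetSum _ fun i _ => integrable_finsetSum _ fun l _ =>
      (Integrable.add (hW i l).1.2 (hW i l).2.1.2).add (hW i l).2.2.2
  · exact fun t => by positivity
  · intro t ht k hk i l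
    have hk0 : k ≠ 0 := norm_pos_iff.1 (by linarith)
    have hkp : 0 < ‖k‖ := by linarith
    rw [F.pres_eq hlam ht hk0 _ le_rfl]
    have e : ‖k‖ ^ (m + 3) = ‖k‖ ^ 2 * ‖k‖ ^ (m + 1) := by ring
    have b : ‖k ^ 2 * R2 t i l + k * R1 t i l + R0 t i l‖ ≤
        ‖k‖ ^ 2 * (‖R2 t i l‖ + ‖R1 t i l‖ + ‖R0 t i l‖) := by
      refine (norm_add₃_le).trans ?_
      rw [norm_mul, norm_mul, norm_pow, mul_add, mul_add]
      have : ‖k‖ ≤ ‖k‖ ^ 2 := by nlinarith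
      have : 1 ≤ ‖k‖ ^ 2 := by nlinarith
      gcongr
      exact le_mul_of_one_le_left (norm_nonneg _) this
    have s : ‖R2 t i l‖ + ‖R1 t i l‖ + ‖R0 t i l‖ ≤
        ∑ i, ∑ l, (‖R2 t i l‖ + ‖R1 t i l‖ + ‖R0 t i l‖) :=
      (Finset.single_le_sum (f := fun l => ‖R2 t i l‖ + ‖R1 t i l‖ + ‖R0 t i l‖)
        (fun _ _ => by positivity) (Finset.mem_univ l)).trans
      (Finset.single_le_sum (f := fun i => ∑ l, (‖R2 t i l‖ + ‖R1 t i l‖ + ‖R0 t i l‖))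
        (fun _ _ => by positivity) (Finset.mem_univ i))
    simp only [Matrix.smul_apply, Matrix.add_apply, smul_eq_mul, norm_mul, norm_div, norm_one,
      norm_pow]
    rw [e, le_div_iff₀ (by positivity)]
    calc 1 / (‖k‖ ^ 2 * ‖k‖ ^ (m + 1)) * ‖k ^ 2 * R2 t i l + k * R1 t i l + R0 t i l‖
          * ‖k‖ ^ (m + 1)
        = ‖k ^ 2 * R2 t i l + k * R1 t i l + R0 t i l‖ / ‖k‖ ^ 2 := by field_simp
      _ ≤ ‖R2 t i l‖ + ‖R1 t i l‖ + ‖R0 t i l‖ := by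
        rw [div_le_iff₀ (by positivity)]; exact b.trans_eq (mul_comm _ _)
      _ ≤ _ := s

theorem Formal.continuousOn_pres (F : Formal m n g lam q p) (hlam : lam = 1 ∨ lam = -1)
    {k : ℂ} (hk : k ≠ 0) (i l : Fin 2) :
    ContinuousOn (fun t => pres g lam p (m + 3) t k i l) (Ici 0) := by
  obtain ⟨h2, h1, h0⟩ := F.rem_dec hg le_rfl
  have h := ((((h2 i l).wInt.1.const_smul (k ^ 2)).add ((h1 i l).wInt.1.const_smul k)).add
    (h0 i l).wInt.1).const_smul (1 / k ^ (m + 3))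
  refine h.congr fun t ht => ?_
  rw [F.pres_eq hlam ht hk _ le_rfl]
  simp

end Rem

/-- The truncated sum differs from its leading term by `O(1/k)`, uniformly in `t`. -/
theorem Formal.exists_psum_bound (F : Formal m n g lam q p) {M : ℕ} (hM : M ≤ m + 3) :
    ∃ C : ℝ, 0 ≤ C ∧ ∀ t, 0 ≤ t → ∀ k : ℂ, 1 ≤ ‖k‖ → ∀ i l,
      ‖psum p M t k i l - (p 2).val t i l‖ ≤ C / ‖k‖ := by
  have hb : ∀ j i l, ∃ B, 0 ≤ B ∧ ∀ t, 0 ≤ t → j < M → ‖(p (j + 3)).val t i l‖ ≤ B := by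
    intro j i l
    by_cases hj : j < M
    · obtain ⟨B, hB⟩ := ((F.reg (j + 3) (by omega)).val i l).1
      exact ⟨B, (norm_nonneg _).trans (hB 0 le_rfl), fun t ht _ => hB t ht⟩
    · exact ⟨0, le_rfl, fun t _ h => absurd h hj⟩
  choose B hB0 hB using hb
  have hB1 : ∀ j, 0 ≤ ∑ i, ∑ l, B j i l := fun j =>
    Finset.sum_nonneg fun i _ => Finset.sum_nonneg fun l _ => hB0 j i l
  refine ⟨∑ j ∈ Finset.range M, ∑ i, ∑ l, B j i l, Finset.sum_nonneg fun j _ => hB1 j,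
    fun t ht k hk i l => ?_⟩
  have hkp : 0 < ‖k‖ := by linarith
  have e : psum p M t k i l - (p 2).val t i l
      = ∑ j ∈ Finset.range M, (1 / k ^ (j + 1)) * (p (j + 3)).val t i l := by
    simp [psum, Finset.sum_range_succ', Matrix.sum_apply]
  rw [e, Finset.sum_div]
  refine (norm_sum_le _ _).trans (Finset.sum_le_sum fun j hj => ?_)
  rw [norm_mul, norm_div, norm_one, norm_pow, div_mul_eq_mul_div, one_mul]
  have h1 : ‖(p (j + 3)).val t i l‖ ≤ ∑ i, ∑ l, B j i l :=
    (hB j i l t ht (Finset.mem_range.1 hj)).trans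
      ((Finset.single_le_sum (f := fun l => B j i l) (fun _ _ => hB0 j i _)
        (Finset.mem_univ l)).trans
      (Finset.single_le_sum (f := fun i => ∑ l, B j i l)
        (fun i _ => Finset.sum_nonneg fun l _ => hB0 j i l) (Finset.mem_univ i)))
  have h2 : ‖k‖ ≤ ‖k‖ ^ (j + 1) := le_self_pow₀ hk (by omega)
  exact div_le_div₀ (hB1 j) h1 hkp h2

end Formal

/-! ### Linear differential equations: growth estimates -/

theorem continuous_clamp {E : Type*} [TopologicalSpace E] {f : ℝ → E} {a b : ℝ} (hab : a ≤ b)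
    (hf : ContinuousOn f (Icc a b)) : Continuous fun t => f (max a (min b t)) :=
  hf.comp_continuous (by fun_prop) fun t => ⟨le_max_left _ _, max_le hab (min_le_left _ _)⟩

theorem clamp_eq {a b t : ℝ} (ht : t ∈ Icc a b) : max a (min b t) = t := by
  rw [min_eq_right ht.2, max_eq_right ht.1]

/-- Grönwall's inequality in integral form with a variable coefficient. -/
theorem gronwall_integral {u v : ℝ → ℝ} {a b c : ℝ} (hab : a ≤ b)
    (hu : ContinuousOn u (Icc a b)) (hv : ContinuousOn v (Icc a b))
    (hv0 : ∀ t ∈ Icc a b, 0 ≤ v t)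
    (h : ∀ t ∈ Icc a b, u t ≤ c + ∫ s in a..t, v s * u s) :
    u b ≤ c * Real.exp (∫ s in a..b, v s) := by
  set U : ℝ → ℝ := fun t => u (max a (min b t))
  set V : ℝ → ℝ := fun t => v (max a (min b t))
  have hU : Continuous U := continuous_clamp hab hu
  have hV : Continuous V := continuous_clamp hab hv
  have eU : ∀ t ∈ Icc a b, U t = u t := fun t ht => by simp only [U, clamp_eq ht]
  have eV : ∀ t ∈ Icc a b, V t = v t := fun t ht => by simp only [V, clamp_eq ht]
  set H : ℝ → ℝ := fun t => c + ∫ s in a..t, V s * U s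
  set W : ℝ → ℝ := fun t => ∫ s in a..t, V s
  have hH : ∀ t, HasDerivAt H (V t * U t) t := fun t =>
    (((hV.mul hU).integral_hasStrictDerivAt a t).hasDerivAt).const_add c
  have hW : ∀ t, HasDerivAt W (V t) t := fun t => (hV.integral_hasStrictDerivAt a t).hasDerivAt
  have hUH : ∀ t ∈ Icc a b, U t ≤ H t := by
    intro t ht
    have e : ∫ s in a..t, V s * U s = ∫ s in a..t, v s * u s :=
      intervalIntegral.integral_congr fun s hs => by
        rw [uIcc_of_le ht.1] at hs
        have hs' : s ∈ Icc a b := ⟨hs.1, hs.2.trans ht.2⟩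
        simp only [eU s hs', eV s hs']
    rw [eU t ht]
    simp only [H, e]
    exact h t ht
  have hG : ∀ t, HasDerivAt (fun t => H t * Real.exp (-W t))
      (V t * U t * Real.exp (-W t) + H t * (Real.exp (-W t) * -V t)) t := fun t =>
    (hH t).mul (hW t).neg.exp
  have hanti : AntitoneOn (fun t => H t * Real.exp (-W t)) (Icc a b) := by
    refine antitoneOn_of_deriv_nonpos (convex_Icc a b)
      (fun t _ => (hG t).continuousAt.continuousWithinAt)
      (fun t _ => (hG t).differentiableAt.differentiableWithinAt) fun t ht => ?_
    rw [interior_Icc] at ht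
    have ht' := Ioo_subset_Icc_self ht
    rw [(hG t).deriv]
    have h1 : 0 ≤ V t := by rw [eV t ht']; exact hv0 t ht'
    have h2 := hUH t ht'
    have h3 := Real.exp_pos (-W t)
    nlinarith [mul_nonneg (mul_nonneg h1 (sub_nonneg.2 h2)) h3.le]
  have hb := hanti (left_mem_Icc.2 hab) (right_mem_Icc.2 hab) hab
  simp only [H, W, intervalIntegral.integral_same, neg_zero, Real.exp_zero, mul_one,
    add_zero] at hb
  have eW : ∫ s in a..b, V s = ∫ s in a..b, v s :=
    intervalIntegral.integral_congr fun s hs => by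
      rw [uIcc_of_le hab] at hs
      exact eV s hs
  have h1 := hUH b (right_mem_Icc.2 hab)
  rw [eU b (right_mem_Icc.2 hab)] at h1
  refine h1.trans ?_
  rw [← eW]
  have h3 := mul_le_mul_of_nonneg_right hb (Real.exp_pos (∫ s in a..b, V s)).le
  rwa [mul_assoc, ← Real.exp_add, neg_add_cancel, Real.exp_zero, mul_one] at h3

/-- Variation of constants for a scalar equation. -/
theorem duhamel {μ : ℂ} {x q : ℝ → ℂ} {a b : ℝ} (hab : a ≤ b) (hx : ContinuousOn x (Icc a b))
    (hd : ∀ t ∈ Ioo a b, HasDerivAt x (-μ * x t + q t) t) (hq : ContinuousOn q (Icc a b)) :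
    x b = Complex.exp (-μ * (b - a)) * x a
      + ∫ s in a..b, Complex.exp (-μ * (b - s)) * q s := by
  have hE : ∀ t : ℝ, HasDerivAt (fun t : ℝ => Complex.exp (-μ * (b - t)))
      (Complex.exp (-μ * (b - t)) * μ) t := fun t => by
    have h1 : HasDerivAt (fun t : ℝ => -μ * ((b : ℂ) - t)) μ t := by
      have := ((Complex.ofRealCLM.hasDerivAt (x := t)).const_sub (b : ℂ)).const_mul (-μ)
      simpa using this
    exact h1.cexp
  have hEc : Continuous fun t : ℝ => Complex.exp (-μ * (b - t)) := by fun_prop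
  have key := intervalIntegral.integral_eq_sub_of_hasDerivAt_of_le
    (f := fun t : ℝ => Complex.exp (-μ * (b - t)) * x t)
    (f' := fun t : ℝ => Complex.exp (-μ * (b - t)) * q t) hab (hEc.continuousOn.mul hx)
    (fun t ht => ((hE t).mul (hd t ht)).congr_deriv (by ring))
    (ContinuousOn.intervalIntegrable (by
      rw [uIcc_of_le hab]; exact hEc.continuousOn.mul hq))
  rw [key]
  simp

/-- Growth of a solution of `x' = -μ x + q` with `‖q‖ ≤ v ‖x‖ + ψ`, forwards in time. -/
theorem norm_le_of_ode {μ : Fin 2 → ℂ} {x q : ℝ → Fin 2 → ℂ} {v ψ : ℝ → ℝ} {a b M : ℝ}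
    (hab : a ≤ b) (hx : ∀ i, ContinuousOn (fun t => x t i) (Icc a b))
    (hd : ∀ t ∈ Ioo a b, ∀ i, HasDerivAt (fun t => x t i) (-μ i * x t i + q t i) t)
    (hq : ∀ i, ContinuousOn (fun t => q t i) (Icc a b))
    (hv : ContinuousOn v (Icc a b)) (hψ : ContinuousOn ψ (Icc a b))
    (hv0 : ∀ t ∈ Icc a b, 0 ≤ v t) (hψ0 : ∀ t ∈ Icc a b, 0 ≤ ψ t)
    (hqb : ∀ t ∈ Icc a b, ∀ i, ‖q t i‖ ≤ v t * ‖x t‖ + ψ t)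
    (hM : ∀ i, ∀ t ∈ Icc 0 (b - a), ‖Complex.exp (-μ i * t)‖ ≤ M) :
    ‖x b‖ ≤ M * (‖x a‖ + ∫ s in a..b, ψ s) * Real.exp (M * ∫ s in a..b, v s) := by
  have hM0 : 0 ≤ M := (norm_nonneg _).trans (hM 0 0 ⟨le_rfl, by linarith⟩)
  have hxc : ContinuousOn x (Icc a b) := continuousOn_pi.2 hx
  have hint : ∀ {f : ℝ → ℝ}, ContinuousOn f (Icc a b) → ∀ {c d}, a ≤ c → c ≤ d → d ≤ b →
      IntervalIntegrable f volume c d := fun hf c d h1 h2 h3 =>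
    ContinuousOn.intervalIntegrable (by rw [uIcc_of_le h2]; exact hf.mono (Icc_subset_Icc h1 h3))
  have h : ∀ t ∈ Icc a b, ‖x t‖ ≤ M * (‖x a‖ + ∫ s in a..b, ψ s)
      + ∫ s in a..t, (M * v s) * ‖x s‖ := by
    intro t ht
    have hsub : Icc a t ⊆ Icc a b := Icc_subset_Icc le_rfl ht.2
    have hvx : ContinuousOn (fun s => v s * ‖x s‖) (Icc a b) := hv.mul hxc.norm
    have hψt : ∫ s in a..t, ψ s ≤ ∫ s in a..b, ψ s := by
      refine intervalIntegral.integral_mono_interval le_rfl ht.1 ht.2 ?_ (hint hψ le_rfl hab le_rfl)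
      filter_upwards [ae_restrict_mem measurableSet_Ioc] with s hs
      exact hψ0 s (Ioc_subset_Icc_self hs)
    have hRHS : M * (‖x a‖ + ∫ s in a..b, ψ s) + ∫ s in a..t, (M * v s) * ‖x s‖
        ≥ M * ‖x a‖ + ∫ s in a..t, M * (v s * ‖x s‖ + ψ s) := by
      have e : ∫ s in a..t, M * (v s * ‖x s‖ + ψ s)
          = (∫ s in a..t, (M * v s) * ‖x s‖) + M * ∫ s in a..t, ψ s := by
        rw [intervalIntegral.integral_const_mul, intervalIntegral.integral_add
          (hint hvx le_rfl ht.1 ht.2) (hint hψ le_rfl ht.1 ht.2), mul_add,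
          ← intervalIntegral.integral_const_mul]
        simp only [mul_assoc]
      rw [e]
      nlinarith [mul_le_mul_of_nonneg_left hψt hM0]
    have hnn : 0 ≤ M * (‖x a‖ + ∫ s in a..b, ψ s) + ∫ s in a..t, (M * v s) * ‖x s‖ := by
      have h1 : 0 ≤ ∫ s in a..b, ψ s := intervalIntegral.integral_nonneg hab hψ0
      have h2 : 0 ≤ ∫ s in a..t, (M * v s) * ‖x s‖ :=
        intervalIntegral.integral_nonneg ht.1 fun s hs =>
          mul_nonneg (mul_nonneg hM0 (hv0 s (hsub hs))) (norm_nonneg _)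
      positivity
    refine (pi_norm_le_iff_of_nonneg hnn).2 fun i => ?_
    refine le_trans ?_ hRHS
    rw [duhamel (x := fun t => x t i) (q := fun t => q t i) ht.1 ((hx i).mono hsub)
      (fun s hs => hd s (Ioo_subset_Ioo le_rfl ht.2 hs) i) ((hq i).mono hsub)]
    refine (norm_add_le _ _).trans (add_le_add ?_ ?_)
    · rw [norm_mul]
      have := hM i (t - a) ⟨by linarith [ht.1], by linarith [ht.2]⟩
      push_cast at this
      exact mul_le_mul this (norm_le_pi_norm (x a) i) (norm_nonneg _) hM0
    · refine intervalIntegral.norm_integral_le_of_norm_le ht.1 ?_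
        ((hint (hvx.add hψ) le_rfl ht.1 ht.2).const_mul M)
      filter_upwards with s hs
      have hs' := hsub (Ioc_subset_Icc_self hs)
      rw [norm_mul]
      have := hM i (t - s) ⟨by linarith [hs.2], by linarith [hs'.1, ht.2]⟩
      push_cast at this
      exact mul_le_mul this (hqb s hs' i) (norm_nonneg _) hM0
  have := gronwall_integral (u := fun t => ‖x t‖) (v := fun t => M * v t) hab hxc.norm
    (continuousOn_const.mul hv)
    (fun t ht => mul_nonneg hM0 (hv0 t ht)) h
  simpa only [intervalIntegral.integral_const_mul] using this

/-- The estimate `norm_le_of_ode` backwards in time. -/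
theorem norm_le_of_ode_backward {μ : Fin 2 → ℂ} {x q : ℝ → Fin 2 → ℂ} {v ψ : ℝ → ℝ} {a b M : ℝ}
    (hab : a ≤ b) (hx : ∀ i, ContinuousOn (fun t => x t i) (Icc a b))
    (hd : ∀ t ∈ Ioo a b, ∀ i, HasDerivAt (fun t => x t i) (-μ i * x t i + q t i) t)
    (hq : ∀ i, ContinuousOn (fun t => q t i) (Icc a b))
    (hv : ContinuousOn v (Icc a b)) (hψ : ContinuousOn ψ (Icc a b))
    (hv0 : ∀ t ∈ Icc a b, 0 ≤ v t) (hψ0 : ∀ t ∈ Icc a b, 0 ≤ ψ t)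
    (hqb : ∀ t ∈ Icc a b, ∀ i, ‖q t i‖ ≤ v t * ‖x t‖ + ψ t)
    (hM : ∀ i, ∀ t ∈ Icc 0 (b - a), ‖Complex.exp (μ i * t)‖ ≤ M) :
    ‖x a‖ ≤ M * (‖x b‖ + ∫ s in a..b, ψ s) * Real.exp (M * ∫ s in a..b, v s) := by
  have hmaps : MapsTo (fun t : ℝ => a + b - t) (Icc a b) (Icc a b) := fun t ht =>
    ⟨by linarith [ht.2], by linarith [ht.1]⟩
  have hr : ContinuousOn (fun t : ℝ => a + b - t) (Icc a b) := by fun_prop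
  have h := norm_le_of_ode (μ := fun i => -μ i) (x := fun t => x (a + b - t))
    (q := fun t i => -q (a + b - t) i) (v := fun t => v (a + b - t))
    (ψ := fun t => ψ (a + b - t)) (M := M) hab (fun i => (hx i).comp hr hmaps)
    (fun t ht i => ((hd (a + b - t) ⟨by linarith [ht.2], by linarith [ht.1]⟩ i).scomp t
      ((hasDerivAt_id t).const_sub (a + b))).congr_deriv (by simp))
    (fun i => ((hq i).comp hr hmaps).neg) (hv.comp hr hmaps) (hψ.comp hr hmaps)
    (fun t ht => hv0 _ (hmaps ht)) (fun t ht => hψ0 _ (hmaps ht))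
    (fun t ht i => by simpa using hqb _ (hmaps ht) i) (fun i t ht => by simpa using hM i t ht)
  simpa using h

/-! ### Linear differential equations: existence and analytic dependence on a parameter -/

open scoped BoundedContinuousFunction

/-- The Volterra operator of a bounded coefficient, with an exponential weight `exp (-L t)` that
makes its norm small. -/
theorem exists_volterra {A : ℝ → Mat} (hA : Continuous A) {B : ℝ}
    (hB : ∀ t x, ‖(A t).mulVec x‖ ≤ B * ‖x‖) (hB0 : 0 ≤ B) {L : ℝ} (hL : 0 < L) :
    ∃ J : (ℝ →ᵇ (Fin 2 → ℂ)) →L[ℂ] (ℝ →ᵇ (Fin 2 → ℂ)), ‖J‖ ≤ B / L ∧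
      ∀ φ t, 0 ≤ t → J φ t = Real.exp (-L * t) •
        ∫ s in (0 : ℝ)..t, Real.exp (L * s) • (A s).mulVec (φ s) := by
  have hc : ∀ φ : ℝ →ᵇ (Fin 2 → ℂ),
      Continuous fun s => Real.exp (L * s) • (A s).mulVec (φ s) := fun φ => by
    have : Continuous fun s => (A s).mulVec (φ s) := hA.matrix_mulVec φ.continuous
    fun_prop
  have hcont : ∀ φ : ℝ →ᵇ (Fin 2 → ℂ), Continuous fun t : ℝ => Real.exp (-L * max t 0) •
      ∫ s in (0 : ℝ)..max t 0, Real.exp (L * s) • (A s).mulVec (φ s) := fun φ => by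
    have h1 : Continuous fun t : ℝ => ∫ s in (0 : ℝ)..t, Real.exp (L * s) • (A s).mulVec (φ s) :=
      intervalIntegral.continuous_primitive (fun a b => (hc φ).intervalIntegrable a b) 0
    have h2 := h1.comp (by fun_prop : Continuous fun t : ℝ => max t 0)
    exact (by fun_prop : Continuous fun t : ℝ => Real.exp (-L * max t 0)).smul h2
  have hbd : ∀ (φ : ℝ →ᵇ (Fin 2 → ℂ)) (t : ℝ), ‖Real.exp (-L * max t 0) •
      ∫ s in (0 : ℝ)..max t 0, Real.exp (L * s) • (A s).mulVec (φ s)‖ ≤ B / L * ‖φ‖ := by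
    intro φ t
    have ht : 0 ≤ max t 0 := le_max_right _ _
    generalize max t 0 = τ at ht
    have h1 : ‖∫ s in (0 : ℝ)..τ, Real.exp (L * s) • (A s).mulVec (φ s)‖ ≤
        ∫ s in (0 : ℝ)..τ, Real.exp (L * s) * (B * ‖φ‖) := by
      refine intervalIntegral.norm_integral_le_of_norm_le ht ?_
        ((by fun_prop : Continuous fun s => Real.exp (L * s) * (B * ‖φ‖)).intervalIntegrable _ _)
      filter_upwards with s _
      rw [norm_smul, Real.norm_of_nonneg (Real.exp_pos _).le]
      gcongr
      exact (hB s _).trans (mul_le_mul_of_nonneg_left (φ.norm_coe_le_norm s) hB0)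
    have h2 : ∫ s in (0 : ℝ)..τ, Real.exp (L * s) = (Real.exp (L * τ) - 1) / L := by
      rw [intervalIntegral.integral_comp_mul_left (fun s => Real.exp s) hL.ne', integral_exp]
      simp [div_eq_inv_mul]
    rw [intervalIntegral.integral_mul_const, h2] at h1
    rw [norm_smul, Real.norm_of_nonneg (Real.exp_pos _).le]
    refine (mul_le_mul_of_nonneg_left h1 (Real.exp_pos _).le).trans ?_
    have h3 : Real.exp (-L * τ) * Real.exp (L * τ) = 1 := by
      rw [← Real.exp_add]; simp
    have h4 : Real.exp (-L * τ) * ((Real.exp (L * τ) - 1) / L * (B * ‖φ‖))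
        = (1 - Real.exp (-L * τ)) * (B / L * ‖φ‖) := by
      linear_combination (B / L * ‖φ‖) * h3
    rw [h4]
    exact mul_le_of_le_one_left (by positivity) (by linarith [Real.exp_pos (-L * τ)])
  let J₀ : (ℝ →ᵇ (Fin 2 → ℂ)) →ₗ[ℂ] (ℝ →ᵇ (Fin 2 → ℂ)) :=
    { toFun := fun φ => BoundedContinuousFunction.ofNormedAddCommGroup _ (hcont φ) _ (hbd φ)
      map_add' := fun φ ψ => by
        ext1 t
        simp only [BoundedContinuousFunction.coe_ofNormedAddCommGroup,
          BoundedContinuousFunction.coe_add, Pi.add_apply, Matrix.mulVec_add, smul_add]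
        rw [intervalIntegral.integral_add ((hc φ).intervalIntegrable _ _)
          ((hc ψ).intervalIntegrable _ _), smul_add]
      map_smul' := fun c φ => by
        ext1 t
        simp only [BoundedContinuousFunction.coe_ofNormedAddCommGroup,
          BoundedContinuousFunction.coe_smul, Matrix.mulVec_smul, RingHom.id_apply]
        simp only [smul_comm _ c]
        rw [intervalIntegral.integral_smul, smul_comm] }
  refine ⟨J₀.mkContinuous (B / L) fun φ => ?_, J₀.mkContinuous_norm_le (by positivity) _,
    fun φ t ht => ?_⟩
  · exact BoundedContinuousFunction.norm_ofNormedAddCommGroup_le _ (by positivity) (hbd φ)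
  · change Real.exp (-L * max t 0) •
      ∫ s in (0 : ℝ)..max t 0, Real.exp (L * s) • (A s).mulVec (φ s) = _
    rw [max_eq_left ht]

theorem norm_mulVec_le {A : Mat} {B : ℝ} (hA : ∀ i l, ‖A i l‖ ≤ B) (x : Fin 2 → ℂ) :
    ‖A.mulVec x‖ ≤ 2 * B * ‖x‖ := by
  have hB : 0 ≤ B := (norm_nonneg _).trans (hA 0 0)
  refine (pi_norm_le_iff_of_nonneg (by positivity)).2 fun i => ?_
  simp only [Matrix.mulVec, dotProduct, Fin.sum_univ_two]
  have h : ∀ l, ‖A i l * x l‖ ≤ B * ‖x‖ := fun l => by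
    rw [norm_mul]
    exact mul_le_mul (hA i l) (norm_le_pi_norm x l) (norm_nonneg _) hB
  linarith [norm_add_le (A i 0 * x 0) (A i 1 * x 1), h 0, h 1]

/-- The solution of `y = h + (∑ₚ k^p J p) y` for small operators `J p` is analytic in `k`. -/
theorem exists_resolvent {X F : Type*} [NormedAddCommGroup X] [NormedSpace ℂ X] [CompleteSpace X]
    [NormedAddCommGroup F] [NormedSpace ℂ F] (J : Fin 4 → X →L[ℂ] X) (h : X) {c ρ : ℝ}
    (hJ : ∀ p, ‖J p‖ ≤ c) (hc : c * ∑ p : Fin 4, |ρ| ^ (p : ℕ) < 1) :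
    ∃ y : ℂ → X, ∀ k, ‖k‖ < ρ → y k = h + ∑ p : Fin 4, k ^ (p : ℕ) • J p (y k) ∧
      ∀ ev : X →L[ℂ] F, DifferentiableAt ℂ (fun k => ev (y k)) k := by
  let Jk : ℂ → X →L[ℂ] X := fun k => ∑ p : Fin 4, k ^ (p : ℕ) • J p
  have hJk : ∀ k, ‖k‖ < ρ → ‖Jk k‖ < 1 := by
    intro k hk
    have hρ : 0 < ρ := (norm_nonneg k).trans_lt hk
    refine lt_of_le_of_lt ?_ hc
    rw [Finset.mul_sum]
    refine (norm_sum_le _ _).trans (Finset.sum_le_sum fun p _ => ?_)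
    rw [norm_smul, norm_pow, abs_of_pos hρ, mul_comm]
    exact mul_le_mul (hJ p) (pow_le_pow_left₀ (norm_nonneg _) hk.le _) (by positivity)
      ((norm_nonneg _).trans (hJ p))
  have hunit : ∀ k, ‖k‖ < ρ → IsUnit (1 - Jk k) := fun k hk =>
    (Units.oneSub (Jk k) (hJk k hk)).isUnit
  refine ⟨fun k => Ring.inverse (1 - Jk k) h, fun k hk => ⟨?_, fun ev => ?_⟩⟩
  · have e := congrArg (fun T : X →L[ℂ] X => T h)
      (Ring.mul_inverse_cancel (1 - Jk k) (hunit k hk))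
    have e' : Ring.inverse (1 - Jk k) h - Jk k (Ring.inverse (1 - Jk k) h) = h := e
    have e2 : ∑ p : Fin 4, k ^ (p : ℕ) • J p (Ring.inverse (1 - Jk k) h)
        = Jk k (Ring.inverse (1 - Jk k) h) := by simp [Jk]
    rw [e2]
    nth_rewrite 2 [← e']
    abel
  · have h1 : DifferentiableAt ℂ Jk k :=
      DifferentiableAt.fun_sum fun p _ => (by fun_prop :
        DifferentiableAt ℂ (fun k : ℂ => k ^ (p : ℕ)) k).smul_const (J p)
    have h2 : DifferentiableAt ℂ (fun k => Ring.inverse (1 - Jk k)) k :=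
      DifferentiableAt.comp (g := Ring.inverse) k (differentiableAt_inverse (hunit k hk))
        ((differentiableAt_const _).sub h1)
    exact ev.differentiableAt.comp k (h2.clm_apply (differentiableAt_const h))

/-- Solutions of `x' = (∑ₚ k^p A p) x` that depend analytically on `k` in a disk. -/
theorem exists_solution_of_lt {A : Fin 4 → ℝ → Mat} (hA : ∀ p, Continuous (A p)) {B : ℝ}
    (hB : ∀ p t i l, ‖A p t i l‖ ≤ B) (x₀ : Fin 2 → ℂ) (ρ : ℝ) :
    ∃ x : ℝ → ℂ → Fin 2 → ℂ, ∀ k, ‖k‖ < ρ → Continuous (fun t => x t k) ∧ x 0 k = x₀ ∧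
      (∀ t, 0 < t → HasDerivAt (fun t => x t k)
        ((∑ p : Fin 4, k ^ (p : ℕ) • A p t).mulVec (x t k)) t) ∧
      ∀ t, DifferentiableAt ℂ (x t) k := by
  have hB0 : 0 ≤ B := (norm_nonneg _).trans (hB 0 0 0 0)
  set L : ℝ := 2 * (2 * B) * ∑ p : Fin 4, |ρ| ^ (p : ℕ) + 1 with hLdef
  have hS : 0 ≤ ∑ p : Fin 4, |ρ| ^ (p : ℕ) := Finset.sum_nonneg fun p _ => by positivity
  have hL : 0 < L := by positivity
  choose J hJn hJ using fun p => exists_volterra (hA p) (fun t x => norm_mulVec_le (hB p t) x)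
    (by positivity) hL
  let h : ℝ →ᵇ (Fin 2 → ℂ) := BoundedContinuousFunction.ofNormedAddCommGroup
    (fun t => Real.exp (-L * max t 0) • x₀) (by fun_prop) ‖x₀‖ fun t => by
      rw [norm_smul, Real.norm_of_nonneg (Real.exp_pos _).le]
      refine mul_le_of_le_one_left (norm_nonneg _) (Real.exp_le_one_iff.2 ?_)
      nlinarith [le_max_right t 0]
  obtain ⟨y, hy⟩ := exists_resolvent (F := Fin 2 → ℂ) J h hJn (ρ := ρ) (by
    rw [div_mul_eq_mul_div, div_lt_one hL]
    nlinarith [mul_nonneg hS hB0])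
  refine ⟨fun t k => Real.exp (L * t) • y k t, fun k hk => ?_⟩
  have hcx : Continuous fun t => Real.exp (L * t) • y k t := by
    have := (y k).continuous
    fun_prop
  have hF : Continuous fun t =>
      (∑ p : Fin 4, k ^ (p : ℕ) • A p t).mulVec (Real.exp (L * t) • y k t) := by
    have : Continuous fun t => ∑ p : Fin 4, k ^ (p : ℕ) • A p t :=
      continuous_finsetSum _ fun p _ => (hA p).const_smul (k ^ (p : ℕ))
    exact this.matrix_mulVec hcx
  have hx : ∀ t, 0 ≤ t → Real.exp (L * t) • y k t = x₀ + ∫ s in (0 : ℝ)..t,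
      (∑ p : Fin 4, k ^ (p : ℕ) • A p s).mulVec (Real.exp (L * s) • y k s) := by
    intro t ht
    have e1 : y k t = Real.exp (-L * t) • x₀ + ∑ p : Fin 4, k ^ (p : ℕ) • J p (y k) t := by
      have e2 : h t = Real.exp (-L * t) • x₀ := by
        change Real.exp (-L * max t 0) • x₀ = _
        rw [max_eq_left ht]
      conv_lhs => rw [(hy k hk).1]
      simp [e2]
    have e3 : Real.exp (L * t) * Real.exp (-L * t) = 1 := by rw [← Real.exp_add]; simp
    have hci : ∀ p : Fin 4, Continuous fun s =>
        Real.exp (L * s) • k ^ (p : ℕ) • (A p s).mulVec (y k s) :=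
      fun p => by
        have : Continuous fun s => (A p s).mulVec (y k s) :=
          (hA p).matrix_mulVec (y k).continuous
        fun_prop
    conv_lhs => rw [e1]
    rw [smul_add, smul_smul, e3, one_smul, Finset.smul_sum]
    congr 1
    simp only [hJ _ _ t ht]
    simp only [smul_comm (Real.exp (L * t)) (_ : ℂ), smul_smul, e3, one_smul]
    simp only [Matrix.sum_mulVec, Matrix.smul_mulVec, Matrix.mulVec_smul, Finset.smul_sum]
    rw [intervalIntegral.integral_finsetSum fun p _ => (hci p).intervalIntegrable _ _]
    simp only [smul_comm (Real.exp _) (k ^ _), intervalIntegral.integral_smul]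
  refine ⟨hcx, by simpa using hx 0 le_rfl, fun t ht => ?_, fun t => ?_⟩
  · refine (((hF.integral_hasStrictDerivAt 0 t).hasDerivAt).const_add x₀).congr_of_eventuallyEq ?_
    filter_upwards [lt_mem_nhds ht] with s hs
    exact hx s hs.le
  · exact ((hy k hk).2 (BoundedContinuousFunction.evalCLM ℂ t)).const_smul (Real.exp (L * t))

/-- Uniqueness for the linear initial value problem on `[0,∞)`. -/
theorem ode_unique {A : ℝ → Mat} (hA : Continuous A) {x y : ℝ → Fin 2 → ℂ}
    (hx : ContinuousOn x (Ici 0)) (hy : ContinuousOn y (Ici 0)) (h0 : x 0 = y 0)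
    (hxd : ∀ t, 0 < t → HasDerivAt x ((A t).mulVec (x t)) t)
    (hyd : ∀ t, 0 < t → HasDerivAt y ((A t).mulVec (y t)) t) {t : ℝ} (ht : 0 ≤ t) :
    x t = y t := by
  have hsub : Icc 0 t ⊆ Ici (0 : ℝ) := Icc_subset_Ici_self
  have hz : ContinuousOn (fun s => x s - y s) (Icc 0 t) := (hx.sub hy).mono hsub
  obtain ⟨B, hB⟩ := isCompact_Icc.exists_bound_of_continuousOn (s := Icc 0 t)
    (f := fun s => fun i l => A s i l) (by
      refine continuousOn_pi.2 fun i => continuousOn_pi.2 fun l => ?_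
      exact ((continuous_apply l).comp ((continuous_apply i).comp hA)).continuousOn)
  have hB0 : 0 ≤ B := (norm_nonneg _).trans (hB 0 ⟨le_rfl, ht⟩)
  have h := norm_le_of_ode (μ := 0) (x := fun s => x s - y s)
    (q := fun s => (A s).mulVec (x s - y s)) (v := fun _ => 2 * B) (ψ := fun _ => 0) (M := 1)
    ht (fun i => (continuous_apply i).comp_continuousOn hz)
    (fun s hs i => by
      have h1 := hasDerivAt_pi.1 ((hxd s hs.1).sub (hyd s hs.1)) i
      rw [← Matrix.mulVec_sub] at h1
      simpa using h1)
    (fun i => (continuous_apply i).comp_continuousOn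
      ((Continuous.matrix_mulVec (A := fun p : Mat × (Fin 2 → ℂ) => p.1) continuous_fst
        continuous_snd).comp_continuousOn (hA.continuousOn.prodMk hz)))
    continuousOn_const continuousOn_const (fun _ _ => by positivity) (fun _ _ => le_rfl)
    (fun s hs i => by
      rw [add_zero]
      refine (norm_le_pi_norm _ i).trans (norm_mulVec_le (fun i l => ?_) _)
      exact ((norm_le_pi_norm _ l).trans (norm_le_pi_norm (fun i l => A s i l) i)).trans
        (hB s hs))
    (by simp)
  simp only [h0, sub_self, norm_zero, intervalIntegral.integral_zero, add_zero, mul_zero,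
    zero_mul] at h
  exact sub_eq_zero.1 (norm_le_zero_iff.1 h)

/-- Solutions of `x' = (∑ₚ k^p A p) x` on `[0,∞)` are entire in `k`. -/
theorem exists_entire_solution {A : Fin 4 → ℝ → Mat} (hA : ∀ p, Continuous (A p)) {B : ℝ}
    (hB : ∀ p t i l, ‖A p t i l‖ ≤ B) (x₀ : Fin 2 → ℂ) :
    ∃ x : ℝ → ℂ → Fin 2 → ℂ, (∀ k, ContinuousOn (fun t => x t k) (Ici 0) ∧ x 0 k = x₀ ∧
      ∀ t, 0 < t → HasDerivAt (fun t => x t k)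
        ((∑ p : Fin 4, k ^ (p : ℕ) • A p t).mulVec (x t k)) t) ∧
      ∀ t, 0 ≤ t → Differentiable ℂ (x t) := by
  choose X hX using fun N : ℕ => exists_solution_of_lt hA hB x₀ (N : ℝ)
  have hN : ∀ k : ℂ, ‖k‖ < ((⌊‖k‖⌋₊ + 1 : ℕ) : ℝ) := fun k => by
    push_cast; exact Nat.lt_floor_add_one _
  have hAk : ∀ k : ℂ, Continuous fun t => ∑ p : Fin 4, k ^ (p : ℕ) • A p t := fun k =>
    continuous_finsetSum _ fun p _ => (hA p).const_smul (k ^ (p : ℕ))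
  have huniq : ∀ k (N : ℕ), ‖k‖ < N → ∀ t, 0 ≤ t → X (⌊‖k‖⌋₊ + 1) t k = X N t k := by
    intro k N hk t ht
    obtain ⟨h1, h2, h3, _⟩ := hX N k hk
    obtain ⟨h4, h5, h6, _⟩ := hX _ k (hN k)
    exact ode_unique (hAk k) (x := fun t => X (⌊‖k‖⌋₊ + 1) t k) (y := fun t => X N t k)
      h4.continuousOn h1.continuousOn (h5.trans h2.symm) h6 h3 ht
  refine ⟨fun t k => X (⌊‖k‖⌋₊ + 1) t k, fun k => ?_, fun t ht k => ?_⟩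
  · obtain ⟨h4, h5, h6, _⟩ := hX _ k (hN k)
    exact ⟨h4.continuousOn, h5, h6⟩
  · refine ((hX _ k (hN k)).2.2.2 t).congr_of_eventuallyEq ?_
    filter_upwards [(continuous_norm.tendsto k).eventually (gt_mem_nhds (hN k))] with z hz
    exact huniq z _ hz t ht

/-! ### Columns of the eigenfunctions as solutions of a linear equation -/

/-- The exponents of the column equation. The column `c` of `T` and `U` corresponds to
`η = eps c`. -/
def expo (k η : ℂ) (i : Fin 2) : ℂ := 4 * Complex.I * k ^ 3 * (eps i - η)

/-- `x` solves `x' = -4ik³(σ₃ - η) x + V x - ρ` on `[a,b]`. -/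
structure IsSol (g : Fin 3 → ℝ → ℝ) (lam : ℝ) (k η : ℂ) (ρ : ℝ → Fin 2 → ℂ) (a b : ℝ)
    (x : ℝ → Fin 2 → ℂ) : Prop where
  cont : ∀ i, ContinuousOn (fun t => x t i) (Icc a b)
  deriv : ∀ t ∈ Ioo a b, ∀ i, HasDerivAt (fun t => x t i)
    (-expo k η i * x t i + (laxV g lam t k).mulVec (x t) i - ρ t i) t

theorem IsSol.mono {g : Fin 3 → ℝ → ℝ} {lam : ℝ} {k η : ℂ} {ρ : ℝ → Fin 2 → ℂ} {a b a' b' : ℝ}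
    {x : ℝ → Fin 2 → ℂ} (h : IsSol g lam k η ρ a b x) (ha : a ≤ a') (hb : b' ≤ b) :
    IsSol g lam k η ρ a' b' x :=
  ⟨fun i => (h.cont i).mono (Icc_subset_Icc ha hb),
    fun t ht => h.deriv t (Ioo_subset_Ioo ha hb ht)⟩

theorem IsSol.sub {g : Fin 3 → ℝ → ℝ} {lam : ℝ} {k η : ℂ} {ρ ρ' : ℝ → Fin 2 → ℂ} {a b : ℝ}
    {x y : ℝ → Fin 2 → ℂ} (h : IsSol g lam k η ρ a b x) (h' : IsSol g lam k η ρ' a b y) :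
    IsSol g lam k η (fun t i => ρ t i - ρ' t i) a b (fun t i => x t i - y t i) := by
  refine ⟨fun i => (h.cont i).sub (h'.cont i), fun t ht i => ?_⟩
  refine ((h.deriv t ht i).sub (h'.deriv t ht i)).congr_deriv ?_
  simp only [Matrix.mulVec, dotProduct, Fin.sum_univ_two]
  ring

theorem expHatSigma3_apply (s : ℂ) (A : Mat) (i c : Fin 2) :
    expHatSigma3 s A i c = Complex.exp (s * (eps i - eps c)) * A i c := by
  have h2 : Complex.exp (s * (1 + 1)) = Complex.exp s * Complex.exp s := by
    rw [← Complex.exp_add]; ring_nf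
  have h3 : Complex.exp (s * (-1 - 1)) = Complex.exp (-s) * Complex.exp (-s) := by
    rw [← Complex.exp_add]; ring_nf
  have h4 : Complex.exp (-s) * Complex.exp s = 1 := by rw [← Complex.exp_add]; simp
  fin_cases i <;> fin_cases c <;>
    simp [expHatSigma3, expSigma3, Matrix.mul_apply, Fin.sum_univ_two, eps, -Matrix.cons_mul,
      h2, h3]
  · linear_combination (A 0 0) * h4
  · ring
  · ring
  · linear_combination (A 1 1) * h4

theorem mul_col (A B : Mat) (i c : Fin 2) : (A * B) i c = A.mulVec (fun j => B j c) i := rfl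

section Data
variable {lam : ℝ} {m n : ℕ} {g : Fin 3 → ℝ → ℝ}

/-- The coefficient of the column equation. -/
def odeMat (g : Fin 3 → ℝ → ℝ) (lam : ℝ) (k η : ℂ) (t : ℝ) : Mat :=
  laxV g lam t k - (4 * Complex.I * k ^ 3) • (sigma3 - η • (1 : Mat))

theorem odeMat_mulVec (k η : ℂ) (t : ℝ) (x : Fin 2 → ℂ) (i : Fin 2) :
    (odeMat g lam k η t).mulVec x i = -expo k η i * x i + (laxV g lam t k).mulVec x i := by
  fin_cases i <;> simp [odeMat, Matrix.sub_mulVec, Matrix.smul_mulVec, sigma3, expo, eps,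
    Matrix.vecHead, Matrix.vecTail] <;> ring

/-- The coefficients of the powers of `k` in `odeMat`, extended to negative times by their values
at `0`. -/
def odeCoef (g : Fin 3 → ℝ → ℝ) (lam : ℝ) (η : ℂ) (p : Fin 4) (t : ℝ) : Mat :=
  ![lax0 g lam (max t 0), lax1d g lam (max t 0) + lax1o g lam (max t 0), lax2 g lam (max t 0),
    -(4 * Complex.I) • (sigma3 - η • (1 : Mat))] p

theorem sum_odeCoef (hlam : lam = 1 ∨ lam = -1) (k η : ℂ) (t : ℝ) :
    ∑ p : Fin 4, k ^ (p : ℕ) • odeCoef g lam η p t = odeMat g lam k η (max t 0) := by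
  rw [odeMat, laxV_eq hlam]
  simp only [Fin.sum_univ_four, odeCoef]
  simp
  module

theorem MReg.const_one (n r : ℕ) : MReg n r fun _ => (1 : Mat) := fun _ _ => Reg.const n r _

theorem mDec_lax (hg : BoundaryAssumption m n g) (lam : ℝ) :
    MDec n 0 (lax2 g lam) ∧ MDec n 0 (fun t => lax1d g lam t + lax1o g lam t) ∧
      MDec n 0 (lax0 g lam) := by
  have h2 := lax2_mul (lam := lam) hg (MReg.const_one n 0)
  have h1 := (lax1d_mul (lam := lam) hg (MReg.const_one n 0)).add
    (lax1o_mul (lam := lam) hg (MReg.const_one n 0))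
  have h0 := lax0_mul (lam := lam) hg (MReg.const_one n 0)
  simp only [mul_one] at h2 h1 h0
  exact ⟨h2, h1, h0⟩

theorem mDec_laxV (hg : BoundaryAssumption m n g) (hlam : lam = 1 ∨ lam = -1) (k : ℂ) :
    MDec n 0 fun t => laxV g lam t k := by
  obtain ⟨h2, h1, h0⟩ := mDec_lax hg lam
  have h := ((h2.const_smul (k ^ 2)).add (h1.const_smul k)).add h0
  exact fun i l => (h i l).congr fun t _ => congrFun (congrFun (laxV_eq hlam g t k) i) l

theorem bounded_lax (hg : BoundaryAssumption m n g) (lam : ℝ) :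
    ∃ B, ∀ t, 0 ≤ t → ∀ i l, ‖lax2 g lam t i l‖ ≤ B ∧ ‖(lax1d g lam t + lax1o g lam t) i l‖ ≤ B ∧
      ‖lax0 g lam t i l‖ ≤ B := by
  have hb : ∀ j : Fin 3, ∃ B, ∀ t, 0 ≤ t → ‖(g j t : ℂ)‖ ≤ B := fun j => (hg.dec' j).toReg.1
  have h3 : ∃ B, ∀ t, 0 ≤ t → ‖(g 0 t : ℂ) ^ 3‖ ≤ B := ((hg.dec' 0).pow 2).toReg.1
  have h2 : ∃ B, ∀ t, 0 ≤ t → ‖(g 0 t : ℂ) ^ 2‖ ≤ B := ((hg.dec' 0).pow 1).toReg.1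
  obtain ⟨B0, h0⟩ := hb 0
  obtain ⟨B1, h1⟩ := hb 1
  obtain ⟨B2, hh2⟩ := hb 2
  obtain ⟨B3, h3⟩ := h3
  obtain ⟨B4, h2⟩ := h2
  have p0 : 0 ≤ B0 := (norm_nonneg _).trans (h0 0 le_rfl)
  have p1 : 0 ≤ B1 := (norm_nonneg _).trans (h1 0 le_rfl)
  have p2 : 0 ≤ B2 := (norm_nonneg _).trans (hh2 0 le_rfl)
  have p3 : 0 ≤ B3 := (norm_nonneg _).trans (h3 0 le_rfl)
  have p4 : 0 ≤ B4 := (norm_nonneg _).trans (h2 0 le_rfl)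
  -- A crude common bound: every constant matrix entry is at most `S`.
  obtain ⟨S, hS0, hS⟩ : ∃ S : ℝ, 0 ≤ S ∧ ∀ i l, ‖(sigma3 * sigmaLam lam) i l‖ ≤ S ∧
      ‖sigma3 i l‖ ≤ S ∧ ‖sigmaLam lam i l‖ ≤ S := by
    refine ⟨∑ i, ∑ l, (‖(sigma3 * sigmaLam lam) i l‖ + ‖sigma3 i l‖ + ‖sigmaLam lam i l‖),
      by positivity, fun i l => ?_⟩
    have h := (Finset.single_le_sum (f := fun l => ‖(sigma3 * sigmaLam lam) i l‖ + ‖sigma3 i l‖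
        + ‖sigmaLam lam i l‖) (fun _ _ => by positivity) (Finset.mem_univ l)).trans
      (Finset.single_le_sum (f := fun i => ∑ l, (‖(sigma3 * sigmaLam lam) i l‖ + ‖sigma3 i l‖
        + ‖sigmaLam lam i l‖)) (fun _ _ => by positivity) (Finset.mem_univ i))
    have n1 := norm_nonneg ((sigma3 * sigmaLam lam) i l)
    have n2 := norm_nonneg (sigma3 i l)
    have n3 := norm_nonneg (sigmaLam lam i l)
    exact ⟨by linarith, by linarith, by linarith⟩
  refine ⟨4 * B0 * S + (2 * |lam| * B4 * S + 2 * B1 * S) + (B2 + 2 * |lam| * B3) * S,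
    fun t ht i l => ⟨?_, ?_, ?_⟩⟩
  · have : ‖lax2 g lam t i l‖ ≤ 4 * B0 * S := by
      simp only [lax2, Matrix.smul_apply, smul_eq_mul, norm_mul, norm_neg, RCLike.norm_ofNat]
      gcongr
      · exact h0 t ht
      · exact (hS i l).1
    have : 0 ≤ (2 * |lam| * B4 * S + 2 * B1 * S) + (B2 + 2 * |lam| * B3) * S := by positivity
    linarith
  · have : ‖(lax1d g lam t + lax1o g lam t) i l‖ ≤ 2 * |lam| * B4 * S + 2 * B1 * S := by
      rw [Matrix.add_apply]
      refine (norm_add_le _ _).trans (add_le_add ?_ ?_)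
      · simp only [lax1d, Matrix.smul_apply, smul_eq_mul, norm_mul, norm_neg, RCLike.norm_ofNat,
          Complex.norm_I, mul_one, Complex.norm_real, Real.norm_eq_abs]
        gcongr
        · exact h2 t ht
        · exact (hS i l).2.1
      · simp only [lax1o, Matrix.smul_apply, smul_eq_mul, norm_mul, RCLike.norm_ofNat,
          Complex.norm_I, mul_one]
        gcongr
        · exact h1 t ht
        · exact (hS i l).2.2
    have : 0 ≤ 4 * B0 * S + (B2 + 2 * |lam| * B3) * S := by positivity
    linarith
  · have : ‖lax0 g lam t i l‖ ≤ (B2 + 2 * |lam| * B3) * S := by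
      simp only [lax0, Matrix.smul_apply, smul_eq_mul]
      rw [norm_mul]
      gcongr
      · refine (norm_sub_le _ _).trans (add_le_add (hh2 t ht) ?_)
        rw [norm_mul, norm_mul, RCLike.norm_ofNat, Complex.norm_real, Real.norm_eq_abs]
        gcongr
        exact h3 t ht
      · exact (hS i l).1
    have : 0 ≤ 4 * B0 * S + (2 * |lam| * B4 * S + 2 * B1 * S) := by positivity
    linarith

theorem continuous_extend {A : ℝ → Mat} (hA : MDec n 0 A) : Continuous fun t => A (max t 0) := by
  refine continuous_pi fun i => continuous_pi fun l => ?_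
  exact (hA i l).1.comp_continuous (f := fun t : ℝ => max t 0) (by fun_prop)
    fun t => mem_Ici.2 (le_max_right t 0)

theorem continuous_odeCoef (hg : BoundaryAssumption m n g) (lam : ℝ) (η : ℂ) (p : Fin 4) :
    Continuous (odeCoef g lam η p) := by
  obtain ⟨h2, h1, h0⟩ := mDec_lax hg lam
  fin_cases p
  · exact continuous_extend h0
  · exact continuous_extend h1
  · exact continuous_extend h2
  · exact continuous_const

theorem bounded_odeCoef (hg : BoundaryAssumption m n g) (lam : ℝ) (η : ℂ) :
    ∃ B, ∀ p t i l, ‖odeCoef g lam η p t i l‖ ≤ B := by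
  obtain ⟨B, hB⟩ := bounded_lax hg lam
  have hS : ∀ i l, ‖(-(4 * Complex.I) • (sigma3 - η • (1 : Mat))) i l‖ ≤
      ∑ i, ∑ l, ‖(-(4 * Complex.I) • (sigma3 - η • (1 : Mat))) i l‖ := fun i l =>
    (Finset.single_le_sum (f := fun l => ‖(-(4 * Complex.I) • (sigma3 - η • (1 : Mat))) i l‖)
      (fun _ _ => by positivity) (Finset.mem_univ l)).trans
    (Finset.single_le_sum (f := fun i => ∑ l, ‖(-(4 * Complex.I) • (sigma3 - η • (1 : Mat))) i l‖)
      (fun _ _ => by positivity) (Finset.mem_univ i))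
  refine ⟨max B (∑ i, ∑ l, ‖(-(4 * Complex.I) • (sigma3 - η • (1 : Mat))) i l‖),
    fun p t i l => ?_⟩
  have h := hB (max t 0) (le_max_right _ _) i l
  fin_cases p
  · exact h.2.2.trans (le_max_left _ _)
  · exact h.2.1.trans (le_max_left _ _)
  · exact h.1.trans (le_max_left _ _)
  · exact (hS i l).trans (le_max_right _ _)

/-- Forward solutions of the column equation, entire in `k`. -/
theorem exists_forward (hg : BoundaryAssumption m n g) (hlam : lam = 1 ∨ lam = -1) (η : ℂ)
    (x₀ : Fin 2 → ℂ) : ∃ x : ℝ → ℂ → Fin 2 → ℂ,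
      (∀ k, ContinuousOn (fun t => x t k) (Ici 0) ∧ x 0 k = x₀ ∧
        ∀ b, IsSol g lam k η 0 0 b fun t => x t k) ∧
      ∀ t, 0 ≤ t → Differentiable ℂ (x t) := by
  obtain ⟨B, hB⟩ := bounded_odeCoef hg lam η
  obtain ⟨x, hx, hd⟩ := exists_entire_solution (continuous_odeCoef hg lam η) hB x₀
  refine ⟨x, fun k => ⟨(hx k).1, (hx k).2.1, fun b => ⟨fun i => ?_, fun t ht i => ?_⟩⟩, hd⟩
  · exact ((continuous_apply i).comp_continuousOn (hx k).1).mono Icc_subset_Ici_self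
  · have h := hasDerivAt_pi.1 ((hx k).2.2 t ht.1) i
    rw [sum_odeCoef hlam, max_eq_left ht.1.le, odeMat_mulVec] at h
    simpa using h

/-- Solutions of the column equation with prescribed value at `b`, entire in `k`. -/
theorem exists_backward (hg : BoundaryAssumption m n g) (hlam : lam = 1 ∨ lam = -1) (η : ℂ)
    (b : ℝ) (x₀ : Fin 2 → ℂ) : ∃ x : ℝ → ℂ → Fin 2 → ℂ,
      (∀ k, x b k = x₀ ∧ IsSol g lam k η 0 0 b fun t => x t k) ∧
      ∀ t, t ≤ b → Differentiable ℂ (x t) := by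
  obtain ⟨B, hB⟩ := bounded_odeCoef hg lam η
  -- Reverse the time about `b`.
  obtain ⟨x, hx, hd⟩ := exists_entire_solution (A := fun p t => -odeCoef g lam η p (b - t))
    (fun p => ((continuous_odeCoef hg lam η p).comp (by fun_prop)).neg)
    (fun p t i l => by simpa using hB p (b - t) i l) x₀
  refine ⟨fun t k => x (b - t) k, fun k => ⟨by simpa using (hx k).2.1, fun i => ?_,
    fun t ht i => ?_⟩, fun t ht => hd _ (by linarith)⟩
  · exact ((continuous_apply i).comp_continuousOn (hx k).1).comp (by fun_prop)
      fun t ht => mem_Ici.2 (by linarith [ht.2])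
  · have h := hasDerivAt_pi.1 ((hx k).2.2 (b - t) (by linarith [ht.2])) i
    have h2 := h.scomp t ((hasDerivAt_id t).const_sub b)
    refine h2.congr_deriv ?_
    simp only [smul_neg, Finset.sum_neg_distrib, sub_sub_cancel]
    rw [sum_odeCoef hlam, max_eq_left ht.1.le, Matrix.neg_mulVec, Pi.neg_apply, odeMat_mulVec]
    rw [Pi.zero_apply, Pi.zero_apply]
    module

/-- The unit vector of the column `c`. -/
def colVec (c : Fin 2) : Fin 2 → ℂ := fun i => (1 : Mat) i c

theorem norm_colVec (c : Fin 2) : ‖colVec c‖ ≤ 1 := by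
  refine (pi_norm_le_iff_of_nonneg zero_le_one).2 fun i => ?_
  change ‖(1 : Mat) i c‖ ≤ 1
  rw [Matrix.one_apply]
  split_ifs <;> simp

theorem expo_mul_colVec (k : ℂ) (c i : Fin 2) : expo k (eps c) i * colVec c i = 0 := by
  unfold colVec expo
  by_cases h : i = c
  · simp [h]
  · simp [Matrix.one_apply_ne h]

theorem exp_mul_colVec (k : ℂ) (c i : Fin 2) (s : ℂ) :
    Complex.exp (expo k (eps c) i * s) * colVec c i = colVec c i := by
  unfold colVec expo
  by_cases h : i = c
  · simp [h]
  · simp [Matrix.one_apply_ne h]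

theorem exp_neg_mul_colVec (k : ℂ) (c i : Fin 2) (s : ℂ) :
    Complex.exp (-expo k (eps c) i * s) * colVec c i = colVec c i := by
  have := exp_mul_colVec k c i (-s)
  rwa [mul_neg, ← neg_mul] at this

/-- The integral equation from the differential one, forwards. -/
theorem IsSol.integral_eq {k : ℂ} {c : Fin 2} {b : ℝ} {x : ℝ → Fin 2 → ℂ}
    (hg : BoundaryAssumption m n g) (hlam : lam = 1 ∨ lam = -1)
    (h : IsSol g lam k (eps c) 0 0 b x) (hb : 0 ≤ b) (h0 : x 0 = colVec c) (i : Fin 2) :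
    x b i = colVec c i + ∫ s in (0 : ℝ)..b,
      Complex.exp (expo k (eps c) i * (s - b)) * (laxV g lam s k).mulVec (x s) i := by
  have hV : ContinuousOn (fun s => (laxV g lam s k).mulVec (x s) i) (Icc 0 b) := by
    simp only [Matrix.mulVec, dotProduct]
    exact continuousOn_finsetSum _ fun l _ =>
      ((mDec_laxV hg hlam k i l).wInt.1.mono Icc_subset_Ici_self).mul (h.cont l)
  have := duhamel (μ := expo k (eps c) i) (x := fun t => x t i) hb (h.cont i)
    (fun t ht => (h.deriv t ht i).congr_deriv (by simp)) hV
  rw [this, h0, exp_neg_mul_colVec]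
  congr 1
  refine intervalIntegral.integral_congr fun s _ => ?_
  congr 2
  ring

/-- The derivative of a function given by the (forward) integral equation. -/
theorem hasD_of_integral_eq {μ δ : ℂ} {x q : ℝ → ℂ} (hq : ContinuousOn q (Ici 0))
    (hδ : μ * δ = 0) (h : ∀ t, 0 ≤ t → x t = δ + ∫ s in (0 : ℝ)..t,
      Complex.exp (μ * (s - t)) * q s) : HasD x fun t => -μ * x t + q t := by
  have hE : Continuous fun s : ℝ => Complex.exp (μ * s) := by fun_prop
  have hp := hasD_primitive (hE.continuousOn.mul hq) 0
  have hx : ∀ t, 0 ≤ t → x t = δ + Complex.exp (-μ * t) *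
      (0 + ∫ s in (0 : ℝ)..t, Complex.exp (μ * s) * q s) := fun t ht => by
    rw [h t ht, zero_add, ← intervalIntegral.integral_const_mul]
    congr 1
    refine intervalIntegral.integral_congr fun s _ => ?_
    rw [← mul_assoc, ← Complex.exp_add]
    ring_nf
  intro t ht
  have h1 : HasDerivAt (fun t : ℝ => Complex.exp (-μ * t)) (Complex.exp (-μ * t) * -μ) t := by
    have := ((Complex.ofRealCLM.hasDerivAt (x := t)).const_mul (-μ)).cexp
    simpa using this
  have h2 := (h1.hasDerivWithinAt (s := Ici 0)).mul (hp t ht) |>.const_add δ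
  refine (h2.congr (fun s hs => hx s hs) (hx t ht)).congr_deriv ?_
  have e : Complex.exp (-μ * t) * Complex.exp (μ * t) = 1 := by rw [← Complex.exp_add]; simp
  simp only [Pi.mul_apply]
  rw [hx t ht]
  linear_combination (q t) * e + hδ

/-- The derivative of a function given by the integral equation normalized at infinity. -/
theorem hasD_of_integral_Ioi_eq {μ δ : ℂ} {x q : ℝ → ℂ} (hq : ContinuousOn q (Ici 0))
    (hi : IntegrableOn q (Ici 0)) (hμ : ∀ s : ℝ, 0 ≤ s → ‖Complex.exp (μ * s)‖ ≤ 1)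
    (hδ : μ * δ = 0) (h : ∀ t, 0 ≤ t → x t = δ - ∫ s in Ioi t,
      Complex.exp (μ * (s - t)) * q s) : HasD x fun t => -μ * x t + q t := by
  have hE : Continuous fun s : ℝ => Complex.exp (μ * s) := by fun_prop
  have hEq : IntegrableOn (fun s : ℝ => Complex.exp (μ * s) * q s) (Ici 0) := by
    refine hi.norm.mono' ((hE.continuousOn.mul hq).aestronglyMeasurable measurableSet_Ici) ?_
    filter_upwards [ae_restrict_mem measurableSet_Ici] with s hs
    rw [norm_mul]
    exact mul_le_of_le_one_left (norm_nonneg _) (hμ s hs)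
  have hp := hasD_neg_integral_Ioi (hE.continuousOn.mul hq) hEq
  have hx : ∀ t, 0 ≤ t → x t = δ + Complex.exp (-μ * t) *
      (-∫ s in Ioi t, Complex.exp (μ * s) * q s) := fun t ht => by
    rw [h t ht, mul_neg, ← sub_eq_add_neg, ← integral_const_mul]
    congr 2
    funext s
    rw [← mul_assoc, ← Complex.exp_add]
    ring_nf
  intro t ht
  have h1 : HasDerivAt (fun t : ℝ => Complex.exp (-μ * t)) (Complex.exp (-μ * t) * -μ) t := by
    have := ((Complex.ofRealCLM.hasDerivAt (x := t)).const_mul (-μ)).cexp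
    simpa using this
  have h2 := (h1.hasDerivWithinAt (s := Ici 0)).mul (hp t ht) |>.const_add δ
  refine (h2.congr (fun s hs => hx s hs) (hx t ht)).congr_deriv ?_
  have e : Complex.exp (-μ * t) * Complex.exp (μ * t) = 1 := by rw [← Complex.exp_add]; simp
  simp only [Pi.mul_apply]
  rw [hx t ht]
  linear_combination (q t) * e + hδ

end Data

/-! ### Existence and uniqueness of the eigenfunctions -/

/-- The sum of the absolute values of the entries, a submultiplicative norm. -/
def mnorm (A : Mat) : ℝ := ∑ i, ∑ l, ‖A i l‖

theorem mnorm_nonneg (A : Mat) : 0 ≤ mnorm A := by unfold mnorm; positivity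

theorem norm_mulVec_apply_le (A : Mat) (x : Fin 2 → ℂ) (i : Fin 2) :
    ‖A.mulVec x i‖ ≤ mnorm A * ‖x‖ := by
  simp only [Matrix.mulVec, dotProduct]
  refine (norm_sum_le _ _).trans ?_
  rw [mnorm, Finset.sum_mul]
  refine le_trans ?_ (Finset.single_le_sum (f := fun i => (∑ l, ‖A i l‖) * ‖x‖)
    (fun _ _ => by positivity) (Finset.mem_univ i))
  rw [Finset.sum_mul]
  refine Finset.sum_le_sum fun l _ => ?_
  rw [norm_mul]
  exact mul_le_mul_of_nonneg_left (norm_le_pi_norm x l) (norm_nonneg _)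

theorem exp_integrand_eq (k : ℂ) (s t : ℝ) (A B : Mat) (i c : Fin 2) :
    expHatSigma3 (4 * Complex.I * k ^ 3 * ((s : ℂ) - t)) (A * B) i c =
      Complex.exp (expo k (eps c) i * (s - t)) * A.mulVec (fun j => B j c) i := by
  rw [expHatSigma3_apply, mul_col, expo]
  ring_nf

/-- The defining properties of a column of `T`, with the exponentials written out. -/
def IsColT (g : Fin 3 → ℝ → ℝ) (lam : ℝ) (c : Fin 2) (k : ℂ) (x : ℝ → Fin 2 → ℂ) : Prop :=
  (∀ i, ContinuousOn (fun t => x t i) (Ici 0)) ∧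
  (∃ B : ℝ, ∀ t : ℝ, 0 ≤ t → ∀ i, ‖x t i‖ ≤ B) ∧
  ∀ t : ℝ, 0 ≤ t → ∀ i, x t i = colVec c i -
    ∫ s in Ioi t, Complex.exp (expo k (eps c) i * (s - t)) * (laxV g lam s k).mulVec (x s) i

theorem isEigenT_iff {g : Fin 3 → ℝ → ℝ} {lam : ℝ} {T : ℝ → ℂ → Mat} :
    IsEigenT g lam T ↔ ∀ c, ∀ k ∈ domMP c, IsColT g lam c k fun t i => T t k i c := by
  simp only [IsEigenT, IsColT, exp_integrand_eq, colVec]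

theorem isEigenU_iff {g : Fin 3 → ℝ → ℝ} {lam : ℝ} {U : ℝ → ℂ → Mat} :
    IsEigenU g lam U ↔ ∀ k c, (∀ i, ContinuousOn (fun t => U t k i c) (Ici 0)) ∧
      ∀ t : ℝ, 0 ≤ t → ∀ i, U t k i c = colVec c i + ∫ s in (0 : ℝ)..t,
        Complex.exp (expo k (eps c) i * (s - t)) *
          (laxV g lam s k).mulVec (fun j => U s k j c) i := by
  simp only [IsEigenU, exp_integrand_eq, colVec]

theorem im_cube_nonpos_of_mem {k : ℂ} (hk : k ∈ closure Dminus) : (k ^ 3).im ≤ 0 := by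
  refine closure_minimal (t := {k : ℂ | (k ^ 3).im ≤ 0}) ?_
    (isClosed_le (by fun_prop) continuous_const) hk
  rintro k (h | h)
  · exact (show (k ^ 3).im < 0 from h.2).le
  · exact (show (k ^ 3).im < 0 from h.2).le

theorem im_cube_nonneg_of_mem {k : ℂ} (hk : k ∈ closure Dplus) : 0 ≤ (k ^ 3).im := by
  refine closure_minimal (t := {k : ℂ | 0 ≤ (k ^ 3).im}) ?_
    (isClosed_le continuous_const (by fun_prop)) hk
  rintro k (h | h)
  · exact (show 0 < (k ^ 3).im from h.2).le
  · exact (show 0 < (k ^ 3).im from h.2).le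

theorem norm_exp_expo (k : ℂ) (c i : Fin 2) (t : ℝ) :
    ‖Complex.exp (expo k (eps c) i * t)‖ =
      Real.exp (-(4 * (k ^ 3).im * ((eps i).re - (eps c).re) * t)) := by
  have : ∀ j, (eps j).im = 0 := fun j => by unfold eps; split_ifs <;> simp
  rw [Complex.norm_exp, expo]
  congr 1
  simp [this]

theorem norm_exp_expo_le_one {k : ℂ} {c : Fin 2} (hk : k ∈ domMP c) (i : Fin 2) {t : ℝ}
    (ht : 0 ≤ t) : ‖Complex.exp (expo k (eps c) i * t)‖ ≤ 1 := by
  rw [norm_exp_expo, Real.exp_le_one_iff, neg_nonpos]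
  fin_cases c
  · have h := im_cube_nonpos_of_mem (show k ∈ closure Dminus from hk)
    fin_cases i
    · simp
    · simp only [eps, Fin.mk_one, Fin.zero_eta, one_ne_zero, if_false, if_true, Complex.neg_re,
        Complex.one_re]
      nlinarith [mul_nonneg (neg_nonneg.2 h) ht]
  · have h := im_cube_nonneg_of_mem (show k ∈ closure Dplus from hk)
    fin_cases i
    · simp only [eps, Fin.mk_one, Fin.zero_eta, one_ne_zero, if_false, if_true, Complex.neg_re,
        Complex.one_re]
      nlinarith [mul_nonneg h ht]
    · simp

section Data
variable {lam : ℝ} {m n : ℕ} {g : Fin 3 → ℝ → ℝ}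

theorem exists_eigenU (hg : BoundaryAssumption m n g) (hlam : lam = 1 ∨ lam = -1) :
    ∃ U : ℝ → ℂ → Mat, IsEigenU g lam U ∧
      (∀ t : ℝ, 0 ≤ t → ∀ i c, Differentiable ℂ fun k => U t k i c) ∧
      ∀ k c, (fun i => U 0 k i c) = colVec c ∧
        ∀ b, IsSol g lam k (eps c) 0 0 b fun t i => U t k i c := by
  choose x hx hd using fun c => exists_forward hg hlam (eps c) (colVec c)
  refine ⟨fun t k => Matrix.of fun i c => x c t k i, isEigenU_iff.2 fun k c => ⟨fun i => ?_,
    fun t ht i => ?_⟩, fun t ht i c => differentiable_pi.1 (hd c t ht) i,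
    fun k c => ⟨(hx c k).2.1, fun b => (hx c k).2.2 b⟩⟩
  · exact (continuous_apply i).comp_continuousOn (hx c k).1
  · exact ((hx c k).2.2 t).integral_eq hg hlam ht (hx c k).2.1 i

theorem continuousOn_laxV_mulVec (hg : BoundaryAssumption m n g) (hlam : lam = 1 ∨ lam = -1)
    (k : ℂ) {S : Set ℝ} (hS : S ⊆ Ici 0) {x : ℝ → Fin 2 → ℂ}
    (hx : ∀ i, ContinuousOn (fun t => x t i) S) (i : Fin 2) :
    ContinuousOn (fun t => (laxV g lam t k).mulVec (x t) i) S := by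
  simp only [Matrix.mulVec, dotProduct]
  exact continuousOn_finsetSum _ fun l _ => ((mDec_laxV hg hlam k i l).wInt.1.mono hS).mul (hx l)

theorem eigenU_unique (hg : BoundaryAssumption m n g) (hlam : lam = 1 ∨ lam = -1)
    {U U' : ℝ → ℂ → Mat} (hU : IsEigenU g lam U) (hU' : IsEigenU g lam U') (k : ℂ) {t : ℝ}
    (ht : 0 ≤ t) : U' t k = U t k := by
  have key : ∀ U : ℝ → ℂ → Mat, IsEigenU g lam U → ∀ c,
      ContinuousOn (fun t i => U t k i c) (Ici 0) ∧ (fun i => U 0 k i c) = colVec c ∧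
      ∀ t, 0 < t → HasDerivAt (fun t i => U t k i c)
        ((odeMat g lam k (eps c) (max t 0)).mulVec fun i => U t k i c) t := by
    intro U hU c
    obtain ⟨h1, h2⟩ := isEigenU_iff.1 hU k c
    refine ⟨continuousOn_pi.2 h1, funext fun i => by simpa using h2 0 le_rfl i, fun t ht => ?_⟩
    refine hasDerivAt_pi.2 fun i => ?_
    rw [odeMat_mulVec, max_eq_left ht.le]
    exact (hasD_of_integral_eq (continuousOn_laxV_mulVec hg hlam k Subset.rfl h1 i)
      (expo_mul_colVec k c i) fun t ht => h2 t ht i).hasDerivAt ht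
  have hA : ∀ c, Continuous fun t => odeMat g lam k (eps c) (max t 0) := fun c => by
    simp only [← sum_odeCoef hlam]
    exact continuous_finsetSum _ fun p _ =>
      (continuous_odeCoef hg lam (eps c) p).const_smul (k ^ (p : ℕ))
  ext i c
  obtain ⟨h1, h2, h3⟩ := key U hU c
  obtain ⟨h1', h2', h3'⟩ := key U' hU' c
  exact congrFun (ode_unique (hA c) h1' h1 (h2'.trans h2.symm) h3' h3 ht) i

theorem mnorm_laxV (hg : BoundaryAssumption m n g) (hlam : lam = 1 ∨ lam = -1) (k : ℂ) :
    ContinuousOn (fun t => mnorm (laxV g lam t k)) (Ici 0) ∧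
      IntegrableOn (fun t => mnorm (laxV g lam t k)) (Ici 0) := by
  have h := fun i l => (mDec_laxV hg hlam k i l).wInt
  exact ⟨continuousOn_finsetSum _ fun i _ => continuousOn_finsetSum _ fun l _ => (h i l).1.norm,
    integrable_finsetSum _ fun i _ => integrable_finsetSum _ fun l _ =>
      (h i l).integrableOn.norm⟩

theorem integral_le_of_subset {f : ℝ → ℝ} (hf : IntegrableOn f (Ici 0)) (h0 : ∀ t, 0 ≤ f t)
    {a b : ℝ} (ha : 0 ≤ a) (hab : a ≤ b) : ∫ s in a..b, f s ≤ ∫ s in Ioi a, f s := by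
  rw [intervalIntegral.integral_of_le hab]
  exact setIntegral_mono_set (hf.mono_set fun s hs => ha.trans (le_of_lt hs))
    (Eventually.of_forall h0) Ioc_subset_Ioi_self.eventuallyLE

/-- A growth bound valid for every `k` in the domain of the column. -/
theorem IsSol.norm_le {k : ℂ} {c : Fin 2} (hg : BoundaryAssumption m n g)
    (hlam : lam = 1 ∨ lam = -1) (hk : k ∈ domMP c) {ρ : ℝ → Fin 2 → ℂ} (hρ : ∀ t i, ρ t i = 0)
    {a b : ℝ} (ha : 0 ≤ a) (hab : a ≤ b)
    {x : ℝ → Fin 2 → ℂ} (h : IsSol g lam k (eps c) ρ a b x) :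
    ‖x a‖ ≤ Real.exp (∫ s in Ioi (0 : ℝ), mnorm (laxV g lam s k)) * ‖x b‖ := by
  obtain ⟨hc, hi⟩ := mnorm_laxV hg hlam k
  have hsub : Icc a b ⊆ Ici 0 := fun s hs => ha.trans hs.1
  have h1 := norm_le_of_ode_backward (μ := expo k (eps c)) (x := x)
    (q := fun t => (laxV g lam t k).mulVec (x t)) (ψ := fun _ => 0) (M := 1) hab h.cont
    (fun t ht i => (h.deriv t ht i).congr_deriv (by simp [hρ]))
    (continuousOn_laxV_mulVec hg hlam k hsub h.cont) (hc.mono hsub) continuousOn_const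
    (fun t _ => mnorm_nonneg _) (fun _ _ => le_rfl)
    (fun t _ i => by rw [add_zero]; exact norm_mulVec_apply_le _ _ i)
    (fun i t ht => norm_exp_expo_le_one hk i ht.1)
  rw [one_mul, one_mul, intervalIntegral.integral_zero, add_zero, mul_comm] at h1
  refine h1.trans (mul_le_mul_of_nonneg_right (Real.exp_le_exp.2 ?_) (norm_nonneg _))
  have h2 : ∫ s in a..b, mnorm (laxV g lam s k) ≤ ∫ s in (0 : ℝ)..b, mnorm (laxV g lam s k) := by
    refine intervalIntegral.integral_mono_interval ha hab le_rfl
      (Eventually.of_forall fun s => mnorm_nonneg _) ?_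
    exact ContinuousOn.intervalIntegrable (by
      rw [uIcc_of_le (ha.trans hab)]; exact hc.mono Icc_subset_Ici_self)
  exact h2.trans (integral_le_of_subset hi (fun _ => mnorm_nonneg _) le_rfl (ha.trans hab))

section ColT
variable {k : ℂ} {c : Fin 2} (hg : BoundaryAssumption m n g) (hlam : lam = 1 ∨ lam = -1)
  (hk : k ∈ domMP c)
include hg hlam

theorem wInt_laxV_mulVec {x : ℝ → Fin 2 → ℂ} (hx : ∀ i, ContinuousOn (fun t => x t i) (Ici 0))
    {B : ℝ} (hB : ∀ t, 0 ≤ t → ∀ i, ‖x t i‖ ≤ B) (i : Fin 2) :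
    WInt n fun t => (laxV g lam t k).mulVec (x t) i := by
  simp only [Matrix.mulVec, dotProduct, Fin.sum_univ_two]
  exact ((mDec_laxV hg hlam k i 0).wInt.mul_bounded (hx 0) fun t ht => hB t ht 0).add
    ((mDec_laxV hg hlam k i 1).wInt.mul_bounded (hx 1) fun t ht => hB t ht 1)

/-- The integral equation from the differential one, backwards. -/
theorem IsSol.integral_eq_backward {a b : ℝ} {x : ℝ → Fin 2 → ℂ} (ha : 0 ≤ a) (hab : a ≤ b)
    (h : IsSol g lam k (eps c) 0 a b x) (hb : x b = colVec c) (i : Fin 2) :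
    x a i + ∫ s in a..b, Complex.exp (expo k (eps c) i * (s - a)) *
      (laxV g lam s k).mulVec (x s) i = colVec c i := by
  have := duhamel (μ := expo k (eps c) i) (x := fun t => x t i) hab (h.cont i)
    (fun t ht => (h.deriv t ht i).congr_deriv (by simp))
    (continuousOn_laxV_mulVec hg hlam k (fun s hs => ha.trans hs.1) h.cont i)
  have h2 := exp_mul_colVec k c i (b - a)
  rw [← hb, this, mul_add, ← mul_assoc, ← Complex.exp_add, ← intervalIntegral.integral_const_mul]
    at h2
  simp only [neg_mul, add_neg_cancel, Complex.exp_zero, one_mul] at h2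
  rw [← hb, this]
  simp only [neg_mul]
  rw [← h2]
  congr 1
  refine intervalIntegral.integral_congr fun s _ => ?_
  rw [← mul_assoc, ← Complex.exp_add]
  ring_nf

include hk

theorem IsColT.isSol {x : ℝ → Fin 2 → ℂ} (h : IsColT g lam c k x) {a b : ℝ} (ha : 0 ≤ a) :
    IsSol g lam k (eps c) 0 a b x := by
  obtain ⟨h1, ⟨B, hB⟩, h2⟩ := h
  refine ⟨fun i => (h1 i).mono fun s hs => ha.trans hs.1, fun t ht i => ?_⟩
  have hW := wInt_laxV_mulVec (k := k) hg hlam h1 hB i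
  have := (hasD_of_integral_Ioi_eq hW.1 hW.integrableOn
    (fun s hs => norm_exp_expo_le_one hk i hs) (expo_mul_colVec k c i)
    fun t ht => h2 t ht i).hasDerivAt (ha.trans_lt ht.1)
  simpa using this

theorem IsColT.tendsto {x : ℝ → Fin 2 → ℂ} (h : IsColT g lam c k x) :
    Tendsto x atTop (𝓝 (colVec c)) := by
  obtain ⟨h1, ⟨B, hB⟩, h2⟩ := h
  refine tendsto_pi_nhds.2 fun i => ?_
  have hW := wInt_laxV_mulVec (k := k) hg hlam h1 hB i
  have hlim := (tendsto_neg_integral_Ioi hW.integrableOn.norm).neg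
  rw [neg_zero] at hlim
  refine tendsto_iff_norm_sub_tendsto_zero.2 (squeeze_zero' (Eventually.of_forall fun _ =>
    norm_nonneg _) ?_ hlim)
  filter_upwards [eventually_ge_atTop 0] with t ht
  rw [h2 t ht i, sub_sub_cancel_left, norm_neg, neg_neg]
  refine norm_integral_le_of_norm_le (IntegrableOn.mono_set (Integrable.norm hW.integrableOn)
    fun s hs => ht.trans (le_of_lt hs)) ?_
  filter_upwards [ae_restrict_mem measurableSet_Ioi] with s hs
  rw [norm_mul]
  refine mul_le_of_le_one_left (norm_nonneg _) ?_
  have := norm_exp_expo_le_one hk i (sub_nonneg.2 (le_of_lt hs))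
  simpa using this

theorem IsColT.unique {x y : ℝ → Fin 2 → ℂ} (hx : IsColT g lam c k x)
    (hy : IsColT g lam c k y) {t : ℝ} (ht : 0 ≤ t) : x t = y t := by
  have h0 : Tendsto (fun b => Real.exp (∫ s in Ioi (0 : ℝ), mnorm (laxV g lam s k))
      * ‖x b - y b‖) atTop (𝓝 0) := by
    have := (((hx.tendsto hg hlam hk).sub (hy.tendsto hg hlam hk)).norm).const_mul
      (Real.exp (∫ s in Ioi (0 : ℝ), mnorm (laxV g lam s k)))
    simpa using this
  have : ‖x t - y t‖ ≤ 0 := by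
    refine ge_of_tendsto h0 ?_
    filter_upwards [eventually_ge_atTop t] with b hb
    exact ((hx.isSol hg hlam hk ht).sub (hy.isSol hg hlam hk ht)).norm_le hg hlam hk
      (by simp) ht hb
  exact sub_eq_zero.1 (norm_le_zero_iff.1 this)

/-- The column of `T` is the limit of the solutions with value `colVec c` at `b → ∞`. -/
theorem exists_colT : ∃ x, IsColT g lam c k x := by
  obtain ⟨hMc, hMi⟩ := mnorm_laxV hg hlam k
  set M : ℝ → ℝ := fun s => mnorm (laxV g lam s k) with hM
  have hM0 : ∀ s, 0 ≤ M s := fun s => mnorm_nonneg _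
  set G : ℝ := Real.exp (∫ s in Ioi (0 : ℝ), M s) with hG
  have hG0 : 0 < G := Real.exp_pos _
  set ε : ℝ → ℝ := fun b => ∫ s in Ioi b, M s with hε
  have hε0 : ∀ b, 0 ≤ ε b := fun b => integral_nonneg hM0
  have hεlim : Tendsto ε atTop (𝓝 0) := by simpa using (tendsto_neg_integral_Ioi hMi).neg
  have hMint : ∀ {a b : ℝ}, 0 ≤ a → a ≤ b → IntervalIntegrable M volume a b := fun ha hab =>
    ContinuousOn.intervalIntegrable (by
      rw [uIcc_of_le hab]; exact hMc.mono fun s hs => ha.trans hs.1)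
  choose W hW _ using fun N : ℕ => exists_backward hg hlam (eps c) N (colVec c)
  set w : ℕ → ℝ → Fin 2 → ℂ := fun N t => W N t k with hw
  have hwN : ∀ N, w N N = colVec c := fun N => (hW N k).1
  have hws : ∀ (N : ℕ) {a : ℝ}, 0 ≤ a → IsSol g lam k (eps c) 0 a N (w N) := fun N a ha =>
    (hW N k).2.mono ha le_rfl
  have hbd : ∀ (N : ℕ) {t : ℝ}, 0 ≤ t → t ≤ N → ‖w N t‖ ≤ G := fun N t ht htN => by
    refine ((hws N ht).norm_le hg hlam hk (by simp) ht htN).trans ?_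
    rw [hwN]
    exact mul_le_of_le_one_right hG0.le (norm_colVec c)
  have hE1 : ∀ (i : Fin 2) {s t : ℝ}, t ≤ s →
      ‖Complex.exp (expo k (eps c) i * (s - t))‖ ≤ 1 := fun i s t h => by
    simpa using norm_exp_expo_le_one hk i (sub_nonneg.2 h)
  -- a bound for the integral term of the equation
  have hint : ∀ {a b : ℝ} {y : ℝ → Fin 2 → ℂ} {B : ℝ} (i : Fin 2), 0 ≤ a → a ≤ b →
      (∀ s ∈ Icc a b, ‖y s‖ ≤ B) → 0 ≤ B →
      ‖∫ s in a..b, Complex.exp (expo k (eps c) i * (s - a)) *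
        (laxV g lam s k).mulVec (y s) i‖ ≤ B * ε a := by
    intro a b y B i ha hab hy hB
    have h1 : ‖∫ s in a..b, Complex.exp (expo k (eps c) i * (s - a)) *
        (laxV g lam s k).mulVec (y s) i‖ ≤ ∫ s in a..b, B * M s := by
      refine intervalIntegral.norm_integral_le_of_norm_le hab ?_ ((hMint ha hab).const_mul B)
      refine Eventually.of_forall fun s hs => ?_
      rw [norm_mul]
      refine (mul_le_of_le_one_left (norm_nonneg _) (hE1 i hs.1.le)).trans
        ((norm_mulVec_apply_le _ _ i).trans ?_)
      rw [mul_comm]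
      exact mul_le_mul_of_nonneg_right (hy s ⟨hs.1.le, hs.2⟩) (hM0 s)
    refine h1.trans ?_
    rw [intervalIntegral.integral_const_mul]
    exact mul_le_mul_of_nonneg_left (integral_le_of_subset hMi hM0 ha hab) hB
  have hdiff : ∀ {N N' : ℕ} {t : ℝ}, 0 ≤ t → t ≤ N → N ≤ N' →
      ‖w N' t - w N t‖ ≤ G * (G * ε N) := by
    intro N N' t ht htN hNN
    have hN : (N : ℝ) ≤ N' := Nat.cast_le.2 hNN
    refine ((((hws N' ht).mono le_rfl hN).sub (hws N ht)).norm_le hg hlam hk (by simp) ht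
      htN).trans (mul_le_mul_of_nonneg_left ?_ hG0.le)
    refine (pi_norm_le_iff_of_nonneg (mul_nonneg hG0.le (hε0 _))).2 fun i => ?_
    have h0 : (0 : ℝ) ≤ N := Nat.cast_nonneg N
    have h1 := (hws N' h0).integral_eq_backward hg hlam h0 hN (hwN N') i
    have h2 : w N' N i - w N N i = -∫ s in (N : ℝ)..N', Complex.exp (expo k (eps c) i * (s - N)) *
        (laxV g lam s k).mulVec (w N' s) i := by
      rw [hwN, ← h1]; push_cast; ring
    rw [h2, norm_neg]
    exact hint i h0 hN (fun s hs => hbd N' (h0.trans hs.1) hs.2) hG0.le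
  have hsmall : Tendsto (fun N : ℕ => G * (G * ε N)) atTop (𝓝 0) := by
    simpa using ((hεlim.comp tendsto_natCast_atTop_atTop).const_mul G).const_mul G
  have hlim : ∀ t : ℝ, 0 ≤ t → ∃ X, Tendsto (fun N => w N t) atTop (𝓝 X) := by
    intro t ht
    refine cauchySeq_tendsto_of_complete (Metric.cauchySeq_iff'.2 fun δ hδ => ?_)
    obtain ⟨N, hN1, hN2⟩ := ((hsmall.eventually (gt_mem_nhds hδ)).and
      (tendsto_natCast_atTop_atTop.eventually (eventually_ge_atTop t))).exists
    exact ⟨N, fun N' hN' => by rw [dist_eq_norm]; exact (hdiff ht hN2 hN').trans_lt hN1⟩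
  choose! X hX using hlim
  have hXd : ∀ {N : ℕ} {t : ℝ}, 0 ≤ t → t ≤ N → ‖X t - w N t‖ ≤ G * (G * ε N) := by
    intro N t ht htN
    refine le_of_tendsto ((hX t ht).sub_const _).norm ?_
    filter_upwards [eventually_ge_atTop N] with N' hN' using hdiff ht htN hN'
  have hXb : ∀ t : ℝ, 0 ≤ t → ‖X t‖ ≤ G := fun t ht => by
    refine le_of_tendsto (hX t ht).norm ?_
    filter_upwards [tendsto_natCast_atTop_atTop.eventually (eventually_ge_atTop t)] with N hN
      using hbd N ht hN
  have hXc : ContinuousOn X (Ici 0) := by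
    intro t ht
    have hU : TendstoUniformlyOn w X atTop (Icc 0 (t + 1)) := by
      refine Metric.tendstoUniformlyOn_iff.2 fun δ hδ => ?_
      filter_upwards [hsmall.eventually (gt_mem_nhds hδ),
        tendsto_natCast_atTop_atTop.eventually (eventually_ge_atTop (t + 1))] with N hN1 hN2 s hs
      rw [dist_eq_norm]
      exact (hXd hs.1 (hs.2.trans hN2)).trans_lt hN1
    have hc := hU.continuousOn (Eventually.frequently (by
      filter_upwards [tendsto_natCast_atTop_atTop.eventually (eventually_ge_atTop (t + 1))]
        with N hN
      exact (continuousOn_pi.2 (hws N le_rfl).cont).mono (Icc_subset_Icc le_rfl hN)))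
    refine (hc t ⟨ht, by linarith⟩).mono_of_mem_nhdsWithin ?_
    exact mem_nhdsWithin.2 ⟨Iio (t + 1), isOpen_Iio, by simp, fun s hs => ⟨hs.2, hs.1.le⟩⟩
  have hXci : ∀ i, ContinuousOn (fun t => X t i) (Ici 0) := continuousOn_pi.1 hXc
  refine ⟨X, hXci, ⟨G, fun t ht i => (norm_le_pi_norm _ i).trans (hXb t ht)⟩, fun t ht i => ?_⟩
  have hWI := wInt_laxV_mulVec (k := k) hg hlam hXci
    (fun t ht i => (norm_le_pi_norm _ i).trans (hXb t ht)) i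
  have hE : Continuous fun s : ℝ => Complex.exp (expo k (eps c) i * (s - t)) := by fun_prop
  have hhc : ContinuousOn (fun s : ℝ => Complex.exp (expo k (eps c) i * (s - t)) *
      (laxV g lam s k).mulVec (X s) i) (Ici 0) := hE.continuousOn.mul hWI.1
  have hhi : IntegrableOn (fun s : ℝ => Complex.exp (expo k (eps c) i * (s - t)) *
      (laxV g lam s k).mulVec (X s) i) (Ioi t) := by
    refine (IntegrableOn.mono_set (Integrable.norm hWI.integrableOn)
      fun s hs => ht.trans (le_of_lt hs)).mono'
      ((hhc.mono fun s hs => ht.trans (le_of_lt hs)).aestronglyMeasurable measurableSet_Ioi) ?_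
    filter_upwards [ae_restrict_mem measurableSet_Ioi] with s hs
    rw [norm_mul]
    exact mul_le_of_le_one_left (norm_nonneg _) (hE1 i (le_of_lt hs))
  have hI := intervalIntegral_tendsto_integral_Ioi t hhi
    (tendsto_natCast_atTop_atTop (R := ℝ))
  have hsum := ((tendsto_pi_nhds.1 (hX t ht) i).add hI)
  have hsum' : Tendsto (fun N : ℕ => w N t i + ∫ s in t..(N : ℝ),
      Complex.exp (expo k (eps c) i * (s - t)) * (laxV g lam s k).mulVec (X s) i) atTop
      (𝓝 (colVec c i)) := by
    refine tendsto_iff_norm_sub_tendsto_zero.2 (squeeze_zero'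
      (g := fun N : ℕ => G * (G * ε N) * ε t) (Eventually.of_forall fun _ =>
        norm_nonneg _) ?_ (by simpa using hsmall.mul_const (ε t)))
    filter_upwards [tendsto_natCast_atTop_atTop.eventually (eventually_ge_atTop t)] with N hN
    have h1 := (hws N ht).integral_eq_backward hg hlam ht hN (hwN N) i
    have hci : ∀ {y : ℝ → Fin 2 → ℂ}, (∀ i, ContinuousOn (fun t => y t i) (Icc t N)) →
        IntervalIntegrable (fun s : ℝ => Complex.exp (expo k (eps c) i * (s - t)) *
          (laxV g lam s k).mulVec (y s) i) volume t N := fun hy =>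
      ContinuousOn.intervalIntegrable (by
        rw [uIcc_of_le hN]
        exact hE.continuousOn.mul
          (continuousOn_laxV_mulVec hg hlam k (fun s hs => ht.trans hs.1) hy i))
    rw [← h1, add_sub_add_left_eq_sub, ← intervalIntegral.integral_sub
      (hci fun i => (hXci i).mono fun s hs => ht.trans hs.1) (hci (hws N ht).cont)]
    have := hint (b := N) (y := fun s => X s - w N s) i ht hN
      (fun s hs => hXd (ht.trans hs.1) hs.2) (mul_nonneg hG0.le (mul_nonneg hG0.le (hε0 _)))
    simpa only [Matrix.mulVec_sub, Pi.sub_apply, mul_sub] using this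
  exact eq_sub_of_add_eq (tendsto_nhds_unique hsum hsum')

end ColT
end Data

/-! ### Solutions for large `k` -/

/-- The inverse of a `2 × 2` matrix with non-zero determinant, applied to a vector, written out by
Cramer's rule so that it can be differentiated entrywise. -/
def adjVec (P : Mat) (x : Fin 2 → ℂ) : Fin 2 → ℂ :=
  ![(P 1 1 * x 0 - P 0 1 * x 1) / (P 0 0 * P 1 1 - P 0 1 * P 1 0),
    (P 0 0 * x 1 - P 1 0 * x 0) / (P 0 0 * P 1 1 - P 0 1 * P 1 0)]

theorem mulVec_adjVec {P : Mat} (hd : P 0 0 * P 1 1 - P 0 1 * P 1 0 ≠ 0) (x : Fin 2 → ℂ) :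
    P.mulVec (adjVec P x) = x := by
  ext i
  fin_cases i <;>
    simp only [Matrix.mulVec, dotProduct, Fin.sum_univ_two, adjVec, Matrix.cons_val_zero,
      Matrix.cons_val_one, Fin.mk_one, Fin.zero_eta] <;>
    generalize hD : P 0 0 * P 1 1 - P 0 1 * P 1 0 = D at * <;>
    field_simp <;> subst hD <;> ring

/-- If `P` is an approximate fundamental solution with remainder `R`, the substitution `x = P y`
turns the column equation into one whose coefficient is small with `R`. -/
theorem hasDerivAt_adjVec {P P' V R : ℝ → Mat} {x x' ρ : ℝ → Fin 2 → ℂ} {κ η : ℂ} {t : ℝ}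
    (hP : ∀ i l, HasDerivAt (fun t => P t i l) (P' t i l) t)
    (hP' : ∀ i l, P' t i l = -(κ * (eps i - eps l)) * P t i l + (V t * P t) i l + R t i l)
    (hx : ∀ i, HasDerivAt (fun t => x t i) (x' t i) t)
    (hx' : ∀ i, x' t i = -(κ * (eps i - η)) * x t i + (V t).mulVec (x t) i - ρ t i)
    (hd : P t 0 0 * P t 1 1 - P t 0 1 * P t 1 0 ≠ 0) (i : Fin 2) :
    HasDerivAt (fun t => adjVec (P t) (x t) i)
      (-(κ * (eps i - η)) * adjVec (P t) (x t) i
        + -adjVec (P t) ((R t).mulVec (adjVec (P t) (x t)) + ρ t) i) t := by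
  have hdet := ((hP 0 0).mul (hP 1 1)).sub ((hP 0 1).mul (hP 1 0))
  have e0 : eps 0 = 1 := rfl
  have e1 : eps 1 = -1 := rfl
  fin_cases i
  · refine ((((hP 1 1).mul (hx 0)).sub ((hP 0 1).mul (hx 1))).div hdet hd).congr_deriv ?_
    simp only [hP', hx', adjVec, Matrix.mulVec, dotProduct, Matrix.mul_apply, Fin.sum_univ_two,
      Matrix.cons_val_zero, Matrix.cons_val_one, Fin.zero_eta, e0, e1, Pi.add_apply,
      Pi.mul_apply, Pi.sub_apply]
    clear hdet
    generalize hD : P t 0 0 * P t 1 1 - P t 0 1 * P t 1 0 = D at *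
    field_simp
    subst hD
    ring
  · refine ((((hP 0 0).mul (hx 1)).sub ((hP 1 0).mul (hx 0))).div hdet hd).congr_deriv ?_
    simp only [hP', hx', adjVec, Matrix.mulVec, dotProduct, Matrix.mul_apply, Fin.sum_univ_two,
      Matrix.cons_val_zero, Matrix.cons_val_one, Fin.mk_one, e0, e1, Pi.add_apply,
      Pi.mul_apply, Pi.sub_apply]
    clear hdet
    generalize hD : P t 0 0 * P t 1 1 - P t 0 1 * P t 1 0 = D at *
    field_simp
    subst hD
    ring

section NearOne
variable {P : Mat} (hP : ∀ i l, ‖P i l - (1 : Mat) i l‖ ≤ 1 / 4)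
include hP

theorem norm_entries_of_near_one : ‖P 0 0‖ ≤ 5 / 4 ∧ ‖P 1 1‖ ≤ 5 / 4 ∧ ‖P 0 1‖ ≤ 1 / 4 ∧
    ‖P 1 0‖ ≤ 1 / 4 ∧ 1 / 2 ≤ ‖P 0 0 * P 1 1 - P 0 1 * P 1 0‖ := by
  have h00 : ‖P 0 0 - 1‖ ≤ 1 / 4 := by simpa using hP 0 0
  have h11 : ‖P 1 1 - 1‖ ≤ 1 / 4 := by simpa using hP 1 1
  have h01 : ‖P 0 1‖ ≤ 1 / 4 := by simpa using hP 0 1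
  have h10 : ‖P 1 0‖ ≤ 1 / 4 := by simpa using hP 1 0
  have l0 := norm_sub_norm_le (1 : ℂ) (1 - P 0 0)
  have l1 := norm_sub_norm_le (1 : ℂ) (1 - P 1 1)
  have u0 := norm_add_le (P 0 0 - 1) 1
  have u1 := norm_add_le (P 1 1 - 1) 1
  rw [norm_sub_rev 1, sub_sub_cancel, norm_one] at l0 l1
  rw [sub_add_cancel, norm_one] at u0 u1
  refine ⟨by linarith, by linarith, h01, h10, ?_⟩
  have h := norm_sub_norm_le (P 0 0 * P 1 1) (P 0 1 * P 1 0)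
  rw [norm_mul, norm_mul] at h
  have a : 9 / 16 ≤ ‖P 0 0‖ * ‖P 1 1‖ := by nlinarith
  have b : ‖P 0 1‖ * ‖P 1 0‖ ≤ 1 / 16 := by nlinarith [norm_nonneg (P 0 1), norm_nonneg (P 1 0)]
  linarith

theorem det_ne_zero_of_near_one : P 0 0 * P 1 1 - P 0 1 * P 1 0 ≠ 0 :=
  norm_pos_iff.1 (by linarith [(norm_entries_of_near_one hP).2.2.2.2])

theorem norm_adjVec_le (x : Fin 2 → ℂ) : ‖adjVec P x‖ ≤ 3 * ‖x‖ := by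
  obtain ⟨h00, h11, h01, h10, hd⟩ := norm_entries_of_near_one hP
  have key : ∀ a b u v d : ℂ, ‖a‖ ≤ 5 / 4 → ‖b‖ ≤ 1 / 4 → ‖u‖ ≤ ‖x‖ → ‖v‖ ≤ ‖x‖ → 1 / 2 ≤ ‖d‖ →
      ‖(a * u - b * v) / d‖ ≤ 3 * ‖x‖ := by
    intro a b u v d ha hb hu hv hd
    rw [norm_div, div_le_iff₀ (by linarith)]
    refine (norm_sub_le _ _).trans ?_
    rw [norm_mul, norm_mul]
    have h1 : ‖a‖ * ‖u‖ ≤ 5 / 4 * ‖x‖ := by gcongr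
    have h2 : ‖b‖ * ‖v‖ ≤ 1 / 4 * ‖x‖ := by gcongr
    nlinarith [norm_nonneg x]
  refine (pi_norm_le_iff_of_nonneg (by positivity)).2 fun i => ?_
  have x0 := norm_le_pi_norm x 0
  have x1 := norm_le_pi_norm x 1
  fin_cases i
  · exact key _ _ _ _ _ h11 h01 x0 x1 hd
  · exact key _ _ _ _ _ h00 h10 x1 x0 hd

theorem norm_mulVec_le_of_near_one (x : Fin 2 → ℂ) : ‖P.mulVec x‖ ≤ 2 * ‖x‖ := by
  obtain ⟨h00, h11, h01, h10, _⟩ := norm_entries_of_near_one hP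
  have x0 := norm_le_pi_norm x 0
  have x1 := norm_le_pi_norm x 1
  have key : ∀ a b u v : ℂ, ‖a‖ ≤ 5 / 4 → ‖b‖ ≤ 5 / 4 → ‖a‖ + ‖b‖ ≤ 2 → ‖u‖ ≤ ‖x‖ → ‖v‖ ≤ ‖x‖ →
      ‖a * u + b * v‖ ≤ 2 * ‖x‖ := by
    intro a b u v ha hb hab hu hv
    refine (norm_add_le _ _).trans ?_
    rw [norm_mul, norm_mul]
    have h1 : ‖a‖ * ‖u‖ ≤ ‖a‖ * ‖x‖ := by gcongr
    have h2 : ‖b‖ * ‖v‖ ≤ ‖b‖ * ‖x‖ := by gcongr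
    nlinarith [norm_nonneg x]
  refine (pi_norm_le_iff_of_nonneg (by positivity)).2 fun i => ?_
  simp only [Matrix.mulVec, dotProduct, Fin.sum_univ_two]
  fin_cases i
  · exact key _ _ _ _ h00 (h01.trans (by norm_num)) (by simp only [Fin.zero_eta]; linarith) x0 x1
  · exact key _ _ _ _ (h10.trans (by norm_num)) h11 (by simp only [Fin.mk_one]; linarith) x0 x1

end NearOne

section Data
variable {lam : ℝ} {m n : ℕ} {g : Fin 3 → ℝ → ℝ}

theorem hasD_psum_tSeq (hg : BoundaryAssumption m n g) (lam : ℝ) (k : ℂ) (i l : Fin 2) :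
    HasD (fun t => psum (tSeq g lam) (m + 3) t k i l) fun t =>
      -(4 * Complex.I * k ^ 3 * (eps i - eps l)) * psum (tSeq g lam) (m + 3) t k i l
        + (laxV g lam t k * psum (tSeq g lam) (m + 3) t k) i l
        + pres g lam (tSeq g lam) (m + 3) t k i l := by
  have h := (tSeq_formal (n := n) lam hg).hasD_psum (τ := -1) (fun i l => by
    fin_cases i <;> fin_cases l <;> simp [eps]) k le_rfl i l
  simpa [sub_eq_add_neg] using h

theorem tSeq_two_val (g : Fin 3 → ℝ → ℝ) (lam t : ℝ) : (tSeq g lam 2).val t = 1 := by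
  simp [tSeq, Coef.val]

/-- The radius from which on the truncated expansion of `T` is invertible, uniformly in `t`. -/
theorem exists_psum_near_one (hg : BoundaryAssumption m n g) (lam : ℝ) : ∃ K : ℝ, 1 ≤ K ∧
    ∀ k : ℂ, K ≤ ‖k‖ → ∀ t, 0 ≤ t → ∀ i l,
      ‖psum (tSeq g lam) (m + 3) t k i l - (1 : Mat) i l‖ ≤ 1 / 4 := by
  obtain ⟨C, hC0, hC⟩ := (tSeq_formal (n := n) lam hg).exists_psum_bound (M := m + 3) le_rfl
  refine ⟨max 1 (4 * C), le_max_left _ _, fun k hk t ht i l => ?_⟩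
  have h1 : 1 ≤ ‖k‖ := (le_max_left _ _).trans hk
  have h := hC t ht k h1 i l
  rw [tSeq_two_val] at h
  refine h.trans ?_
  rw [div_le_iff₀ (by linarith)]
  linarith [(le_max_right 1 (4 * C)).trans hk]

theorem integrableOn_of_weight {f : ℝ → ℝ} (hfc : ContinuousOn f (Ici 0))
    (hfi : IntegrableOn (fun t => (1 + t) ^ n * f t) (Ici 0)) (hf0 : ∀ t, 0 ≤ f t) :
    IntegrableOn f (Ici 0) := by
  refine hfi.mono' (hfc.aestronglyMeasurable measurableSet_Ici) ?_
  filter_upwards [ae_restrict_mem measurableSet_Ici] with t ht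
  have ht' : (0 : ℝ) ≤ t := ht
  rw [Real.norm_of_nonneg (hf0 t)]
  exact le_mul_of_one_le_left (hf0 t) (one_le_pow₀ (by linarith))

/-- For large `k`, solutions of the inhomogeneous column equation are controlled uniformly in `k`
on any interval on which the exponentials are bounded. -/
theorem exists_large_bound (hg : BoundaryAssumption m n g) (hlam : lam = 1 ∨ lam = -1) :
    ∃ K : ℝ, 1 ≤ K ∧ ∀ M : ℝ, 0 ≤ M → ∃ C : ℝ, 0 ≤ C ∧ ∀ k : ℂ, K ≤ ‖k‖ → ∀ (η : ℂ)
      (ρ : ℝ → Fin 2 → ℂ) (ψ : ℝ → ℝ) (a b : ℝ) (x : ℝ → Fin 2 → ℂ), 0 ≤ a → a ≤ b →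
      IsSol g lam k η ρ a b x → (∀ i, ContinuousOn (fun t => ρ t i) (Icc a b)) →
      ContinuousOn ψ (Icc a b) → (∀ t ∈ Icc a b, ∀ i, ‖ρ t i‖ ≤ ψ t) →
      ((∀ i, ∀ t ∈ Icc 0 (b - a), ‖Complex.exp (-expo k η i * t)‖ ≤ M) →
        ‖x b‖ ≤ C * (‖x a‖ + ∫ s in a..b, ψ s)) ∧
      ((∀ i, ∀ t ∈ Icc 0 (b - a), ‖Complex.exp (expo k η i * t)‖ ≤ M) →
        ‖x a‖ ≤ C * (‖x b‖ + ∫ s in a..b, ψ s)) := by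
  obtain ⟨K, hK1, hK⟩ := exists_psum_near_one (m := m) hg lam
  have F := tSeq_formal (n := n) lam hg
  obtain ⟨f, hfc, hfi, hf0, hf⟩ := F.exists_bound hg hlam
  have hfi' := integrableOn_of_weight hfc hfi hf0
  set L : ℝ := ∫ s in Ioi (0 : ℝ), f s with hL
  refine ⟨K, hK1, fun M hM => ⟨6 * M * Real.exp (M * (6 * L)), by positivity,
    fun k hk η ρ ψ a b x ha hab hx hρ hψ hρψ => ?_⟩⟩
  have hk1 : 1 ≤ ‖k‖ := hK1.trans hk
  have hk0 : k ≠ 0 := norm_pos_iff.1 (by linarith)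
  set P : ℝ → Mat := fun t => psum (tSeq g lam) (m + 3) t k with hPdef
  set R : ℝ → Mat := fun t => pres g lam (tSeq g lam) (m + 3) t k with hRdef
  have hsub : Icc a b ⊆ Ici 0 := fun s hs => ha.trans hs.1
  have hnear : ∀ t ∈ Icc a b, ∀ i l, ‖P t i l - (1 : Mat) i l‖ ≤ 1 / 4 := fun t ht =>
    hK k hk t (hsub ht)
  have hPc : ∀ i l, ContinuousOn (fun t => P t i l) (Icc a b) := fun i l =>
    (hasD_psum_tSeq hg lam k i l).continuousOn.mono hsub
  have hRc : ∀ i l, ContinuousOn (fun t => R t i l) (Icc a b) := fun i l =>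
    (F.continuousOn_pres hg hlam hk0 i l).mono hsub
  have hRb : ∀ t ∈ Icc a b, ∀ i l, ‖R t i l‖ ≤ f t := fun t ht i l =>
    (hf t (hsub ht) k hk1 i l).trans (div_le_self (hf0 t) (one_le_pow₀ hk1))
  have hadj : ∀ {z : ℝ → Fin 2 → ℂ}, (∀ i, ContinuousOn (fun t => z t i) (Icc a b)) → ∀ i,
      ContinuousOn (fun t => adjVec (P t) (z t) i) (Icc a b) := by
    intro z hz i
    have hd : ContinuousOn (fun t => P t 0 0 * P t 1 1 - P t 0 1 * P t 1 0) (Icc a b) :=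
      ((hPc 0 0).mul (hPc 1 1)).sub ((hPc 0 1).mul (hPc 1 0))
    have hd0 : ∀ t ∈ Icc a b, P t 0 0 * P t 1 1 - P t 0 1 * P t 1 0 ≠ 0 := fun t ht =>
      det_ne_zero_of_near_one (hnear t ht)
    fin_cases i
    · exact (((hPc 1 1).mul (hz 0)).sub ((hPc 0 1).mul (hz 1))).div hd hd0
    · exact (((hPc 0 0).mul (hz 1)).sub ((hPc 1 0).mul (hz 0))).div hd hd0
  set y : ℝ → Fin 2 → ℂ := fun t => adjVec (P t) (x t) with hy
  have hyc : ∀ i, ContinuousOn (fun t => y t i) (Icc a b) := hadj hx.cont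
  have hRy : ∀ i, ContinuousOn (fun t => ((R t).mulVec (y t) + ρ t) i) (Icc a b) := fun i => by
    simp only [Pi.add_apply, Matrix.mulVec, dotProduct]
    exact (continuousOn_finsetSum _ fun l _ => (hRc i l).mul (hyc l)).add (hρ i)
  have hyd : ∀ t ∈ Ioo a b, ∀ i, HasDerivAt (fun t => y t i)
      (-expo k η i * y t i + -adjVec (P t) ((R t).mulVec (y t) + ρ t) i) t := fun t ht i =>
    hasDerivAt_adjVec (V := fun t => laxV g lam t k)
      (P' := fun t i l => -(4 * Complex.I * k ^ 3 * (eps i - eps l)) * P t i l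
        + (laxV g lam t k * P t) i l + R t i l)
      (x' := fun t i => -expo k η i * x t i + (laxV g lam t k).mulVec (x t) i - ρ t i)
      (fun i l => (hasD_psum_tSeq hg lam k i l).hasDerivAt (ha.trans_lt ht.1))
      (fun i l => rfl) (fun i => hx.deriv t ht i) (fun i => rfl)
      (det_ne_zero_of_near_one (hnear t ⟨ht.1.le, ht.2.le⟩)) i
  have hψ0 : ∀ t ∈ Icc a b, 0 ≤ ψ t := fun t ht => (norm_nonneg _).trans (hρψ t ht 0)
  have hqb : ∀ t ∈ Icc a b, ∀ i, ‖-adjVec (P t) ((R t).mulVec (y t) + ρ t) i‖ ≤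
      6 * f t * ‖y t‖ + 3 * ψ t := by
    intro t ht i
    rw [norm_neg]
    refine (norm_le_pi_norm _ i).trans ((norm_adjVec_le (hnear t ht) _).trans ?_)
    have h1 : ‖(R t).mulVec (y t) + ρ t‖ ≤ 2 * f t * ‖y t‖ + ψ t := by
      refine (norm_add_le _ _).trans (add_le_add ?_
        ((pi_norm_le_iff_of_nonneg (hψ0 t ht)).2 fun i => hρψ t ht i))
      refine (pi_norm_le_iff_of_nonneg (by have := hf0 t; positivity)).2 fun i => ?_
      simp only [Matrix.mulVec, dotProduct, Fin.sum_univ_two]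
      refine (norm_add_le _ _).trans ?_
      rw [norm_mul, norm_mul]
      have e0 := mul_le_mul (hRb t ht i 0) (norm_le_pi_norm (y t) 0) (norm_nonneg _) (hf0 t)
      have e1 := mul_le_mul (hRb t ht i 1) (norm_le_pi_norm (y t) 1) (norm_nonneg _) (hf0 t)
      linarith
    linarith
  have hxy : ∀ t ∈ Icc a b, ‖x t‖ ≤ 2 * ‖y t‖ ∧ ‖y t‖ ≤ 3 * ‖x t‖ := fun t ht => by
    refine ⟨?_, norm_adjVec_le (hnear t ht) _⟩
    have := norm_mulVec_le_of_near_one (hnear t ht) (y t)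
    rwa [hy, mulVec_adjVec (det_ne_zero_of_near_one (hnear t ht))] at this
  have hint : ∫ s in a..b, 6 * f s ≤ 6 * L := by
    rw [intervalIntegral.integral_const_mul]
    have h2 : ∫ s in a..b, f s ≤ ∫ s in (0 : ℝ)..b, f s :=
      intervalIntegral.integral_mono_interval ha hab le_rfl
        (Eventually.of_forall hf0) (ContinuousOn.intervalIntegrable (by
          rw [uIcc_of_le (ha.trans hab)]; exact hfc.mono Icc_subset_Ici_self))
    have h3 := integral_le_of_subset hfi' hf0 le_rfl (ha.trans hab)
    linarith
  have hψi : 0 ≤ ∫ s in a..b, ψ s := intervalIntegral.integral_nonneg hab hψ0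
  have fin : ∀ {A B E : ℝ}, 0 ≤ A → 0 ≤ B → E ≤ 6 * L →
      M * (3 * A + 3 * B) * Real.exp (M * E) * 2 ≤ 6 * M * Real.exp (M * (6 * L)) * (A + B) := by
    intro A B E hA hB hE
    have h := Real.exp_le_exp.2 (mul_le_mul_of_nonneg_left hE hM)
    calc M * (3 * A + 3 * B) * Real.exp (M * E) * 2
        = 6 * M * (A + B) * Real.exp (M * E) := by ring
      _ ≤ 6 * M * (A + B) * Real.exp (M * (6 * L)) := by gcongr
      _ = _ := by ring
  have hae : a ∈ Icc a b := ⟨le_rfl, hab⟩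
  have hbe : b ∈ Icc a b := ⟨hab, le_rfl⟩
  refine ⟨fun hE => ?_, fun hE => ?_⟩
  · have h := norm_le_of_ode hab hyc hyd (fun i => (hadj hRy i).neg)
      ((hfc.mono hsub).const_mul 6 : ContinuousOn (fun t => 6 * f t) (Icc a b))
      (hψ.const_mul 3 : ContinuousOn (fun t => 3 * ψ t) (Icc a b))
      (fun t _ => by have := hf0 t; positivity) (fun t ht => by have := hψ0 t ht; positivity)
      hqb hE
    rw [intervalIntegral.integral_const_mul 3] at h
    refine le_trans ?_ (fin (norm_nonneg (x a)) hψi hint)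
    have h2 : M * (‖y a‖ + 3 * ∫ s in a..b, ψ s) ≤ M * (3 * ‖x a‖ + 3 * ∫ s in a..b, ψ s) := by
      gcongr; exact (hxy a hae).2
    have := h.trans (mul_le_mul_of_nonneg_right h2 (Real.exp_pos _).le)
    linarith [(hxy b hbe).1]
  · have h := norm_le_of_ode_backward hab hyc hyd (fun i => (hadj hRy i).neg)
      ((hfc.mono hsub).const_mul 6 : ContinuousOn (fun t => 6 * f t) (Icc a b))
      (hψ.const_mul 3 : ContinuousOn (fun t => 3 * ψ t) (Icc a b))
      (fun t _ => by have := hf0 t; positivity) (fun t ht => by have := hψ0 t ht; positivity)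
      hqb hE
    rw [intervalIntegral.integral_const_mul 3] at h
    refine le_trans ?_ (fin (norm_nonneg (x b)) hψi hint)
    have h2 : M * (‖y b‖ + 3 * ∫ s in a..b, ψ s) ≤ M * (3 * ‖x b‖ + 3 * ∫ s in a..b, ψ s) := by
      gcongr; exact (hxy b hbe).2
    have := h.trans (mul_le_mul_of_nonneg_right h2 (Real.exp_pos _).le)
    linarith [(hxy a hae).1]

end Data

/-! ### The error of the expansion of `U` -/

theorem colNorm_le {v : Fin 2 → ℂ} {B : ℝ} (h : ∀ i, ‖v i‖ ≤ B) : colNorm v ≤ 2 * B := by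
  have hB : 0 ≤ B := (norm_nonneg _).trans (h 0)
  refine Real.sqrt_le_iff.2 ⟨by positivity, ?_⟩
  rw [Fin.sum_univ_two]
  have h0 := pow_le_pow_left₀ (norm_nonneg _) (h 0) 2
  have h1 := pow_le_pow_left₀ (norm_nonneg _) (h 1) 2
  nlinarith

theorem psum_eq (p : ℕ → Coef) (M : ℕ) (t : ℝ) (k : ℂ) :
    psum p M t k = (p 2).val t + ∑ j ∈ Finset.Icc 1 M, (1 / k ^ j) • (p (j + 2)).val t := by
  induction M with
  | zero => simp [psum]
  | succ M ih =>
    rw [psum, Finset.sum_range_succ, ← psum, ih, Finset.sum_Icc_succ_top (by omega), add_assoc]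

theorem that_eq (g : Fin 3 → ℝ → ℝ) (lam : ℝ) (m : ℕ) (t : ℝ) (k : ℂ) :
    That g lam m t k = psum (tSeq g lam) (m + 3) t k := by
  rw [psum_eq, tSeq_two_val]; rfl

theorem vSeq_two_val (g : Fin 3 → ℝ → ℝ) (lam t : ℝ) : (vwSeq g lam 2).1.val t = 1 := by
  simp [vwSeq, Coef.val]

theorem wSeq_two_val (g : Fin 3 → ℝ → ℝ) (lam t : ℝ) : (vwSeq g lam 2).2.val t = 0 := by
  simp [vwSeq, Coef.val]

theorem mul_expSigma3_apply (A : Mat) (s : ℂ) (i c : Fin 2) :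
    (A * expSigma3 s) i c = A i c * Complex.exp (eps c * s) := by
  fin_cases c <;> simp [expSigma3, Matrix.mul_apply, eps]

theorem uhat_apply (g : Fin 3 → ℝ → ℝ) (lam : ℝ) (m : ℕ) (t : ℝ) (k : ℂ) (i c : Fin 2) :
    Uhat g lam m t k i c = psum (fun N => (vwSeq g lam N).1) (m + 3) t k i c
      + psum (fun N => (vwSeq g lam N).2) (m + 3) t k i c
        * Complex.exp (8 * Complex.I * k ^ 3 * eps c * t) := by
  rw [psum_eq, psum_eq, vSeq_two_val, wSeq_two_val, zero_add, Uhat, Matrix.add_apply,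
    mul_expSigma3_apply]
  congr 3
  ring

theorem psum_differentiableOn (p : ℕ → Coef) (M : ℕ) (t : ℝ) (i c : Fin 2) :
    DifferentiableOn ℂ (fun z => psum p M t z i c) {0}ᶜ := by
  have h : DifferentiableOn ℂ (fun z : ℂ => ∑ j ∈ Finset.range (M + 1),
      1 / z ^ j * (p (j + 2)).val t i c) {0}ᶜ :=
    DifferentiableOn.fun_sum fun j _ => ((differentiableOn_const _).div
      (differentiableOn_pow j) fun z hz => pow_ne_zero j hz).mul_const _
  simpa [psum, Matrix.sum_apply] using h

/-- Multiplication by an exponential changes the exponent `η` of the equation. -/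
theorem IsSol.exp_mul {g : Fin 3 → ℝ → ℝ} {lam : ℝ} {k η : ℂ} {ρ : ℝ → Fin 2 → ℂ} {a b : ℝ}
    {x : ℝ → Fin 2 → ℂ} (h : IsSol g lam k η ρ a b x) (η' : ℂ) :
    IsSol g lam k η'
      (fun t i => Complex.exp (4 * Complex.I * k ^ 3 * (η' - η) * t) * ρ t i) a b
      (fun t i => Complex.exp (4 * Complex.I * k ^ 3 * (η' - η) * t) * x t i) := by
  set ω : ℂ := 4 * Complex.I * k ^ 3 * (η' - η) with hω
  refine ⟨fun i => (by fun_prop : Continuous fun t : ℝ =>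
    Complex.exp (ω * t)).continuousOn.mul (h.cont i), fun t ht i => ?_⟩
  have h1 : HasDerivAt (fun t : ℝ => Complex.exp (ω * t)) (Complex.exp (ω * t) * ω) t := by
    have := ((Complex.ofRealCLM.hasDerivAt (x := t)).const_mul ω).cexp
    simpa using this
  refine (h1.mul (h.deriv t ht i)).congr_deriv ?_
  simp only [Matrix.mulVec, dotProduct, Fin.sum_univ_two, expo, hω]
  ring

/-- On a disc of radius comparable to `|k|⁻²(1+τ)⁻¹` the cube varies by at most `(1+τ)⁻¹`, so that
the exponentials are comparable to those at the centre up to time `τ`. -/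
theorem norm_exp_expo_nearby {k z : ℂ} {τ : ℝ} (hk : 1 ≤ ‖k‖) (hτ : 0 ≤ τ)
    (hz : ‖z - k‖ ≤ 1 / (12 * ‖k‖ ^ 2 * (1 + τ))) :
    ‖k‖ / 2 ≤ ‖z‖ ∧ ∀ (i c : Fin 2) (s : ℝ), s ∈ Icc (-τ) τ →
      ‖Complex.exp (expo z (eps c) i * s)‖ ≤
        Real.exp 8 * ‖Complex.exp (expo k (eps c) i * s)‖ := by
  have hk2 : 1 ≤ ‖k‖ ^ 2 := one_le_pow₀ hk
  have hpos : 0 < 12 * ‖k‖ ^ 2 * (1 + τ) := by positivity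
  have h1 : ‖z - k‖ * (12 * ‖k‖ ^ 2 * (1 + τ)) ≤ 1 := by
    rwa [le_div_iff₀ hpos] at hz
  have hr : ‖z - k‖ * (12 * ‖k‖ ^ 2) ≤ 1 := by
    have : 0 ≤ ‖z - k‖ * (12 * ‖k‖ ^ 2) * τ := by positivity
    nlinarith
  have hr' : ‖z - k‖ ≤ ‖k‖ / 2 := by nlinarith [norm_nonneg (z - k)]
  have hzl : ‖k‖ / 2 ≤ ‖z‖ := by
    have := norm_sub_norm_le k (k - z)
    rw [sub_sub_cancel, norm_sub_rev] at this
    linarith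
  have hzu : ‖z‖ ≤ 3 / 2 * ‖k‖ := by
    have := norm_add_le (z - k) k
    rw [sub_add_cancel] at this
    linarith
  have hcube : ‖z ^ 3 - k ^ 3‖ * (1 + τ) ≤ 1 := by
    have e : z ^ 3 - k ^ 3 = (z - k) * (z ^ 2 + z * k + k ^ 2) := by ring
    have h2 : ‖z ^ 2 + z * k + k ^ 2‖ ≤ 12 * ‖k‖ ^ 2 := by
      refine norm_add₃_le.trans ?_
      rw [norm_pow, norm_mul, norm_pow]
      nlinarith [norm_nonneg z]
    rw [e, norm_mul]
    calc ‖z - k‖ * ‖z ^ 2 + z * k + k ^ 2‖ * (1 + τ)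
        ≤ ‖z - k‖ * (12 * ‖k‖ ^ 2) * (1 + τ) := by gcongr
      _ ≤ 1 := by linarith
  refine ⟨hzl, fun i c s hs => ?_⟩
  have heps : ∀ j, (eps j).re ∈ Icc (-1 : ℝ) 1 := fun j => by
    fin_cases j <;> simp [eps]
  rw [norm_exp_expo, norm_exp_expo, ← Real.exp_add]
  refine Real.exp_le_exp.2 ?_
  have him := (Complex.abs_im_le_norm (z ^ 3 - k ^ 3))
  rw [Complex.sub_im] at him
  have hs' : |s| ≤ τ := abs_le.2 hs
  have hd : |(eps i).re - (eps c).re| ≤ 2 := by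
    have a := heps i; have b := heps c
    exact abs_le.2 ⟨by linarith [a.1, b.2], by linarith [a.2, b.1]⟩
  have hprod : |((z ^ 3).im - (k ^ 3).im) * ((eps i).re - (eps c).re) * s| ≤ 2 := by
    rw [abs_mul, abs_mul]
    have h3 : |(z ^ 3).im - (k ^ 3).im| * |s| ≤ 1 := by
      calc _ ≤ ‖z ^ 3 - k ^ 3‖ * (1 + τ) := by gcongr; linarith
        _ ≤ 1 := hcube
    have h0 : 0 ≤ |(z ^ 3).im - (k ^ 3).im| * |s| := by positivity
    nlinarith [abs_nonneg ((eps i).re - (eps c).re)]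
  have := (abs_le.1 hprod).1
  nlinarith

/-- The Cauchy estimate on such a disc. -/
theorem norm_iteratedDeriv_le_of_nearby {h : ℂ → ℂ} {k : ℂ} {τ B : ℝ} (hk : 1 ≤ ‖k‖)
    (hτ : 0 ≤ τ) (hd : DifferentiableOn ℂ h {0}ᶜ)
    (hB : ∀ z, ‖z - k‖ ≤ 1 / (12 * ‖k‖ ^ 2 * (1 + τ)) → ‖h z‖ ≤ B) (j : ℕ) :
    ‖iteratedDeriv j h k‖ ≤ j.factorial * B * (12 * ‖k‖ ^ 2 * (1 + τ)) ^ j := by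
  have hpos : 0 < 12 * ‖k‖ ^ 2 * (1 + τ) := by positivity
  have hb : ∀ z ∈ Metric.closedBall k (1 / (12 * ‖k‖ ^ 2 * (1 + τ))), z ≠ 0 := by
    intro z hz
    rw [Metric.mem_closedBall, dist_eq_norm] at hz
    have := (norm_exp_expo_nearby hk hτ hz).1
    exact norm_pos_iff.1 (by linarith)
  have hc : DiffContOnCl ℂ h (Metric.ball k (1 / (12 * ‖k‖ ^ 2 * (1 + τ)))) :=
    (hd.mono fun z hz => hb z hz).diffContOnCl_ball le_rfl
  refine (Complex.norm_iteratedDeriv_le_of_forall_mem_sphere_norm_le j (by positivity) hc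
    fun z hz => hB z (by rw [← dist_eq_norm]; exact (Metric.mem_sphere.1 hz).le)).trans_eq ?_
  rw [div_pow, one_pow, div_div_eq_mul_div, div_one]

theorem norm_exp_neg_expo_le_one {k : ℂ} {c : Fin 2} (hk : k ∈ domPM c) (i : Fin 2) {t : ℝ}
    (ht : 0 ≤ t) : ‖Complex.exp (expo k (eps c) i * (-t : ℝ))‖ ≤ 1 := by
  rw [norm_exp_expo, Real.exp_le_one_iff, neg_nonpos]
  fin_cases c
  · have h := im_cube_nonneg_of_mem (show k ∈ closure Dplus from hk)
    fin_cases i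
    · simp
    · simp only [eps, Fin.mk_one, Fin.zero_eta, one_ne_zero, if_false, if_true, Complex.neg_re,
        Complex.one_re]
      nlinarith [mul_nonneg h ht]
  · have h := im_cube_nonpos_of_mem (show k ∈ closure Dminus from hk)
    fin_cases i
    · simp only [eps, Fin.mk_one, Fin.zero_eta, one_ne_zero, if_false, if_true, Complex.neg_re,
        Complex.one_re]
      nlinarith [mul_nonneg (neg_nonneg.2 h) ht]
    · simp

section Data
variable {lam : ℝ} {m n : ℕ} {g : Fin 3 → ℝ → ℝ}

/-- The error of the expansion of the column `c` of `U`, normalized by the exponential for which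
it is governed by the exponents of the column `c'`. -/
def uErr (g : Fin 3 → ℝ → ℝ) (lam : ℝ) (m : ℕ) (U : ℝ → ℂ → Mat) (c c' : Fin 2) (t : ℝ) (k : ℂ)
    (i : Fin 2) : ℂ :=
  Complex.exp (4 * Complex.I * k ^ 3 * (eps c' - eps c) * t) * (U t k i c - Uhat g lam m t k i c)

/-- The remainder in the equation for `uErr`. -/
def uRem (g : Fin 3 → ℝ → ℝ) (lam : ℝ) (m : ℕ) (c c' : Fin 2) (k : ℂ) (t : ℝ) (i : Fin 2) : ℂ :=
  Complex.exp (4 * Complex.I * k ^ 3 * (eps c' - eps c) * t) *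
      pres g lam (fun N => (vwSeq g lam N).1) (m + 3) t k i c
    + Complex.exp (4 * Complex.I * k ^ 3 * (eps c' + eps c) * t) *
      pres g lam (fun N => (vwSeq g lam N).2) (m + 3) t k i c

theorem isSol_uErr (hg : BoundaryAssumption m n g) {U : ℝ → ℂ → Mat}
    {k : ℂ} {c : Fin 2} {b : ℝ} (hU : IsSol g lam k (eps c) 0 0 b fun t i => U t k i c)
    (c' : Fin 2) : IsSol g lam k (eps c') (uRem g lam m c c' k) 0 b
      fun t => uErr g lam m U c c' t k := by
  have hv : IsSol g lam k (eps c)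
      (fun t i => -pres g lam (fun N => (vwSeq g lam N).1) (m + 3) t k i c) 0 b
      fun t i => psum (fun N => (vwSeq g lam N).1) (m + 3) t k i c := by
    have h := fun i => (vSeq_formal (n := n) lam hg).hasD_psum (τ := -1) (fun i l => by
      fin_cases i <;> fin_cases l <;> simp [eps]) k le_rfl i c
    refine ⟨fun i => (h i).continuousOn.mono Icc_subset_Ici_self, fun t ht i =>
      ((h i).hasDerivAt ht.1).congr_deriv ?_⟩
    rw [expo, mul_col]
    ring
  have hw : IsSol g lam k (-eps c)
      (fun t i => -pres g lam (fun N => (vwSeq g lam N).2) (m + 3) t k i c) 0 b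
      fun t i => psum (fun N => (vwSeq g lam N).2) (m + 3) t k i c := by
    have h := fun i => (wSeq_formal (n := n) lam hg).hasD_psum (τ := 1) (fun i l => by
      fin_cases i <;> fin_cases l <;> simp [eps]) k le_rfl i c
    refine ⟨fun i => (h i).continuousOn.mono Icc_subset_Ici_self, fun t ht i =>
      ((h i).hasDerivAt ht.1).congr_deriv ?_⟩
    rw [expo, mul_col]
    ring
  have h := ((hU.exp_mul (eps c')).sub (hv.exp_mul (eps c'))).sub (hw.exp_mul (eps c'))
  have e : ∀ t : ℝ, Complex.exp (4 * Complex.I * k ^ 3 * (eps c' - -eps c) * t)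
      = Complex.exp (4 * Complex.I * k ^ 3 * (eps c' - eps c) * t) *
        Complex.exp (8 * Complex.I * k ^ 3 * eps c * t) := fun t => by
    rw [← Complex.exp_add]; ring_nf
  convert h using 1
  · funext t i
    simp only [uRem, Pi.zero_apply, sub_neg_eq_add]
    ring
  · funext t i
    simp only [uErr, uhat_apply, e]
    ring

/-- The normalization `V_j(0) + W_j(0) = 0` makes the expansion of `U` exact at `t = 0`. -/
theorem uErr_zero {U : ℝ → ℂ → Mat} {k : ℂ} {c : Fin 2} (hU : (fun i => U 0 k i c) = colVec c)
    (c' : Fin 2) : uErr g lam m U c c' 0 k = 0 := by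
  funext i
  have h1 : U 0 k i c = (1 : Mat) i c := congrFun hU i
  have h2 : psum (fun N => (vwSeq g lam N).1) (m + 3) 0 k
      + psum (fun N => (vwSeq g lam N).2) (m + 3) 0 k = 1 := by
    rw [psum_eq, psum_eq, vSeq_two_val, wSeq_two_val, zero_add, add_assoc,
      ← Finset.sum_add_distrib, Finset.sum_eq_zero, add_zero]
    intro j hj
    obtain ⟨N, rfl⟩ : ∃ N, j = N + 1 := ⟨j - 1, by have := (Finset.mem_Icc.1 hj).1; omega⟩
    have := vCoef_add_wCoef g lam N
    rw [← smul_add]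
    exact (congrArg _ this).trans (smul_zero _)
  have h3 := congrFun (congrFun h2 i) c
  rw [Matrix.add_apply] at h3
  simp only [uErr, uhat_apply, Complex.ofReal_zero, mul_zero, Complex.exp_zero, mul_one, h1, h3,
    sub_self, Pi.zero_apply]

theorem uErr_differentiableOn {U : ℝ → ℂ → Mat} {t : ℝ}
    (hU : ∀ i c, Differentiable ℂ fun k => U t k i c) (c c' i : Fin 2) :
    DifferentiableOn ℂ (fun z => uErr g lam m U c c' t z i) {0}ᶜ := by
  simp only [uErr, uhat_apply]
  have h1 : Differentiable ℂ fun z : ℂ =>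
      Complex.exp (4 * Complex.I * z ^ 3 * (eps c' - eps c) * t) := by fun_prop
  have h2 : Differentiable ℂ fun z : ℂ =>
      Complex.exp (8 * Complex.I * z ^ 3 * eps c * t) := by fun_prop
  exact h1.differentiableOn.mul ((hU i c).differentiableOn.sub
    ((psum_differentiableOn _ _ t i c).add
      ((psum_differentiableOn _ _ t i c).mul h2.differentiableOn)))

/-- The error of the expansion of `U` wherever the exponentials are bounded. -/
theorem exists_uErr_bound (hg : BoundaryAssumption m n g) (hlam : lam = 1 ∨ lam = -1)
    {U : ℝ → ℂ → Mat} (hU0 : ∀ k c, (fun i => U 0 k i c) = colVec c)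
    (hU : ∀ k c b, IsSol g lam k (eps c) 0 0 b fun t i => U t k i c) :
    ∃ K : ℝ, 1 ≤ K ∧ ∀ M : ℝ, 0 ≤ M → ∃ C : ℝ, 0 ≤ C ∧ ∀ k : ℂ, K ≤ ‖k‖ → ∀ (c c' : Fin 2) (t : ℝ),
      0 ≤ t → (∀ i, ∀ s ∈ Icc 0 t, ‖Complex.exp (-expo k (eps c') i * s)‖ ≤ M) →
        ‖uErr g lam m U c c' t k‖ ≤ C / ‖k‖ ^ (m + 1) := by
  obtain ⟨K, hK1, hK⟩ := exists_large_bound hg hlam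
  obtain ⟨f, hfc, hfi, hf0, hf⟩ := (vSeq_formal (n := n) lam hg).exists_bound hg hlam
  obtain ⟨f', hfc', hfi', hf0', hf'⟩ := (wSeq_formal (n := n) lam hg).exists_bound hg hlam
  have If := integrableOn_of_weight hfc hfi hf0
  have If' := integrableOn_of_weight hfc' hfi' hf0'
  refine ⟨K, hK1, fun M hM => ?_⟩
  obtain ⟨C, hC0, hC⟩ := hK M hM
  have hF0 : ∀ s, 0 ≤ M * (f s + f' s) := fun s => mul_nonneg hM (add_nonneg (hf0 s) (hf0' s))
  have hFi : IntegrableOn (fun s => M * (f s + f' s)) (Ici 0) := (If.add If').const_mul M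
  have hFc : ContinuousOn (fun s => M * (f s + f' s)) (Ici 0) :=
    (hfc.add hfc').const_smul M
  refine ⟨C * ∫ s in Ioi (0 : ℝ), M * (f s + f' s), mul_nonneg hC0 (integral_nonneg hF0),
    fun k hk c c' t ht hE => ?_⟩
  have hk1 : 1 ≤ ‖k‖ := hK1.trans hk
  have hk0 : k ≠ 0 := norm_pos_iff.1 (by linarith)
  have hkp : 0 < ‖k‖ ^ (m + 1) := by positivity
  -- both exponentials in the remainder occur among those of the equation
  have hE1 : ∀ s ∈ Icc 0 t,
      ‖Complex.exp (4 * Complex.I * k ^ 3 * (eps c' - eps c) * s)‖ ≤ M := fun s hs => by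
    have := hE c s hs
    rwa [expo, show -(4 * Complex.I * k ^ 3 * (eps c - eps c')) * (s : ℂ)
      = 4 * Complex.I * k ^ 3 * (eps c' - eps c) * s by ring] at this
  have hE2 : ∀ s ∈ Icc 0 t,
      ‖Complex.exp (4 * Complex.I * k ^ 3 * (eps c' + eps c) * s)‖ ≤ M := fun s hs => by
    have := hE (1 - c) s hs
    have e : eps (1 - c) = -eps c := by fin_cases c <;> simp [eps]
    rwa [expo, e, show -(4 * Complex.I * k ^ 3 * (-eps c - eps c')) * (s : ℂ)
      = 4 * Complex.I * k ^ 3 * (eps c' + eps c) * s by ring] at this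
  have hsub : Icc 0 t ⊆ Ici 0 := Icc_subset_Ici_self
  have hcont : ∀ ω : ℂ, Continuous fun s : ℝ => Complex.exp (ω * s) := fun ω => by fun_prop
  have h := (hC k hk (eps c') (uRem g lam m c c' k) (fun s => M * (f s + f' s) / ‖k‖ ^ (m + 1)) 0 t
    (fun t => uErr g lam m U c c' t k) le_rfl ht (isSol_uErr hg (hU k c t) c')
    (fun i => ((hcont _).continuousOn.mul
        (((vSeq_formal (n := n) lam hg).continuousOn_pres hg hlam hk0 i c).mono hsub)).add
      ((hcont _).continuousOn.mul
        (((wSeq_formal (n := n) lam hg).continuousOn_pres hg hlam hk0 i c).mono hsub)))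
    ((hFc.mono hsub).div_const _) fun s hs i => ?_).1 (by simpa using hE)
  · rw [uErr_zero (hU0 k c), norm_zero, zero_add, intervalIntegral.integral_div] at h
    refine h.trans ?_
    rw [← mul_div_assoc]
    gcongr
    exact integral_le_of_subset hFi hF0 le_rfl ht
  · refine (norm_add_le _ _).trans ?_
    rw [norm_mul, norm_mul]
    have h1 := mul_le_mul (hE1 s hs) (hf s hs.1 k hk1 i c) (norm_nonneg _) hM
    have h2 := mul_le_mul (hE2 s hs) (hf' s hs.1 k hk1 i c) (norm_nonneg _) hM
    refine (add_le_add h1 h2).trans_eq ?_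
    ring

/-- Cauchy's estimate turns the bound for the error of `U` into bounds for its derivatives. -/
theorem exists_iteratedDeriv_uErr_bound (hg : BoundaryAssumption m n g)
    (hlam : lam = 1 ∨ lam = -1) {U : ℝ → ℂ → Mat}
    (hU0 : ∀ k c, (fun i => U 0 k i c) = colVec c)
    (hU : ∀ k c b, IsSol g lam k (eps c) 0 0 b fun t i => U t k i c)
    (hUd : ∀ t : ℝ, 0 ≤ t → ∀ i c, Differentiable ℂ fun k => U t k i c) (N : ℕ) :
    ∃ K : ℝ, 1 ≤ K ∧ ∃ C : ℝ, 0 ≤ C ∧ ∀ (c c' : Fin 2), ∀ k ∈ domPM c', K ≤ ‖k‖ → ∀ t : ℝ, 0 ≤ t →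
      ∀ j ≤ N, ∀ i, ‖iteratedDeriv j (fun z => uErr g lam m U c c' t z i) k‖ ≤
        C * (1 + t) ^ j * (‖k‖ ^ (2 * j) / ‖k‖ ^ (m + 1)) := by
  obtain ⟨K, hK1, hK⟩ := exists_uErr_bound hg hlam hU0 hU
  obtain ⟨C, hC0, hC⟩ := hK (Real.exp 8) (Real.exp_pos 8).le
  refine ⟨2 * K, by linarith, N.factorial * C * 2 ^ (m + 1) * 12 ^ N, by positivity,
    fun c c' k hkd hk t ht j hj i => ?_⟩
  have hk1 : 1 ≤ ‖k‖ := by linarith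
  have hkp : 0 < ‖k‖ := by linarith
  have h := norm_iteratedDeriv_le_of_nearby hk1 ht
    (uErr_differentiableOn (g := g) (lam := lam) (m := m) (hUd t ht) c c' i)
    (B := C * 2 ^ (m + 1) / ‖k‖ ^ (m + 1)) (fun z hz => ?_) j
  · refine h.trans ?_
    have h1 : (j.factorial : ℝ) ≤ N.factorial := Nat.cast_le.2 (Nat.factorial_le hj)
    have h2 : (12 : ℝ) ^ j ≤ 12 ^ N := pow_le_pow_right₀ (by norm_num) hj
    calc j.factorial * (C * 2 ^ (m + 1) / ‖k‖ ^ (m + 1)) * (12 * ‖k‖ ^ 2 * (1 + t)) ^ j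
        = j.factorial * C * 2 ^ (m + 1) * 12 ^ j * (1 + t) ^ j
          * (‖k‖ ^ (2 * j) / ‖k‖ ^ (m + 1)) := by
          rw [mul_pow, mul_pow, ← pow_mul]; ring
      _ ≤ _ := by gcongr
  · obtain ⟨hz1, hz2⟩ := norm_exp_expo_nearby hk1 ht hz
    refine (norm_le_pi_norm _ i).trans ((hC z (by linarith) c c' t ht fun i s hs => ?_).trans ?_)
    · have h1 := hz2 i c' (-s) ⟨by linarith [hs.2], by linarith [hs.1, hs.2]⟩
      have h2 := norm_exp_neg_expo_le_one hkd i hs.1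
      rw [show -expo z (eps c') i * (s : ℂ) = expo z (eps c') i * (-s : ℝ) by push_cast; ring]
      exact h1.trans (mul_le_of_le_one_right (Real.exp_pos 8).le h2)
    · have hzp : 0 < ‖z‖ := by linarith
      rw [div_le_div_iff₀ (by positivity) (by positivity)]
      have : ‖k‖ ^ (m + 1) ≤ (2 * ‖z‖) ^ (m + 1) := by gcongr; linarith
      rw [mul_pow] at this
      calc C * ‖k‖ ^ (m + 1) ≤ C * (2 ^ (m + 1) * ‖z‖ ^ (m + 1)) := by gcongr
        _ = _ := by ring

end Data

/-! ### Series of analytic functions on sets with boundary -/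

/-- Termwise differentiation within a set that is convex near the point. -/
theorem hasDerivWithinAt_tsum {S W : Set ℂ} {x : ℂ} (hW : W ∈ 𝓝 x) (hc : Convex ℝ (W ∩ S))
    (hx : x ∈ S) {h h' : ℕ → ℂ → ℂ} {u : ℕ → ℝ} (hu : Summable u)
    (hd : ∀ l, ∀ z ∈ W ∩ S, HasDerivAt (h l) (h' l z) z)
    (hb : ∀ l, ∀ z ∈ W ∩ S, ‖h l z‖ ≤ u l ∧ ‖h' l z‖ ≤ u l) :
    HasDerivWithinAt (fun z => ∑' l, h l z) (∑' l, h' l x) S x := by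
  have hxW : x ∈ W ∩ S := ⟨mem_of_mem_nhds hW, hx⟩
  have hsum : ∀ z ∈ W ∩ S, Summable fun l => h l z := fun z hz =>
    Summable.of_norm_bounded hu fun l => (hb l z hz).1
  rw [hasDerivWithinAt_iff_tendsto_slope]
  have hev : ∀ᶠ z in 𝓝[S \ {x}] x, z ∈ W ∩ S := by
    filter_upwards [self_mem_nhdsWithin, mem_nhdsWithin_of_mem_nhds hW] with z hz hz'
      using ⟨hz', hz.1⟩
  have hlim : Tendsto (fun z => ∑' l, slope (h l) x z) (𝓝[S \ {x}] x) (𝓝 (∑' l, h' l x)) := by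
    refine tendsto_tsum_of_dominated_convergence (bound := u) hu (fun l => ?_) ?_
    · exact hasDerivWithinAt_iff_tendsto_slope.1 (hd l x hxW).hasDerivWithinAt
    · filter_upwards [hev, self_mem_nhdsWithin] with z hz hzx l
      have h1 := hc.norm_image_sub_le_of_norm_hasDerivWithin_le
        (fun z hz => (hd l z hz).hasDerivWithinAt) (fun z hz => (hb l z hz).2) hxW hz
      have h2 : 0 < ‖z - x‖ := norm_pos_iff.2 (sub_ne_zero.2 hzx.2)
      rw [slope_def_field, norm_div, div_le_iff₀ h2]
      exact h1
  refine hlim.congr' ?_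
  filter_upwards [hev] with z hz
  simp only [slope_def_field]
  rw [tsum_div_const, (hsum z hz).tsum_sub (hsum x hxW)]

/-- A series of analytic functions with locally summable bounds on the derivatives up to order `N`
is of class `C^N` up to the boundary, and can be differentiated termwise. -/
theorem contDiffOn_tsum_within {S O : Set ℂ} (hS : UniqueDiffOn ℂ S) (hO : IsOpen O) (hSO : S ⊆ O)
    {H : ℕ → ℂ → ℂ} (hH : ∀ l, DifferentiableOn ℂ (H l) O) {N : ℕ}
    (hloc : ∀ x ∈ S, ∃ W ∈ 𝓝 x, Convex ℝ (W ∩ S) ∧ ∃ u : ℕ → ℝ, Summable u ∧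
      ∀ j ≤ N, ∀ l, ∀ z ∈ W ∩ S, ‖iteratedDeriv j (H l) z‖ ≤ u l) :
    ContDiffOn ℂ N (fun z => ∑' l, H l z) S ∧
      ∀ j ≤ N, ∀ x ∈ S, iteratedDerivWithin j (fun z => ∑' l, H l z) S x =
        ∑' l, iteratedDeriv j (H l) x := by
  have hder : ∀ j l, ∀ z ∈ O, HasDerivAt (iteratedDeriv j (H l)) (iteratedDeriv (j + 1) (H l) z) z
      := fun j l z hz => by
    have hA : AnalyticAt ℂ (iteratedDeriv j (H l)) z := by
      rw [iteratedDeriv_eq_iterate]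
      exact AnalyticAt.iterated_deriv ((hH l).analyticAt (hO.mem_nhds hz)) j
    rw [iteratedDeriv_succ]
    exact hA.differentiableAt.hasDerivAt
  have hstep : ∀ j < N, ∀ x ∈ S, HasDerivWithinAt (fun z => ∑' l, iteratedDeriv j (H l) z)
      (∑' l, iteratedDeriv (j + 1) (H l) x) S x := by
    intro j hj x hx
    obtain ⟨W, hW, hc, u, hu, hb⟩ := hloc x hx
    exact hasDerivWithinAt_tsum hW hc hx hu (fun l z hz => hder j l z (hSO hz.2))
      fun l z hz => ⟨hb j hj.le l z hz, hb (j + 1) hj l z hz⟩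
  have hcont : ∀ j ≤ N, ContinuousOn (fun z => ∑' l, iteratedDeriv j (H l) z) S := by
    intro j hj x hx
    obtain ⟨W, hW, hc, u, hu, hb⟩ := hloc x hx
    refine tendsto_tsum_of_dominated_convergence (bound := u) hu
      (fun l => (hder j l x (hSO hx)).continuousAt.continuousWithinAt) ?_
    filter_upwards [self_mem_nhdsWithin, mem_nhdsWithin_of_mem_nhds hW] with z hz hz' l
      using hb j hj l z ⟨hz', hz⟩
  have hiter : ∀ j ≤ N, ∀ x ∈ S, iteratedDerivWithin j (fun z => ∑' l, H l z) S x =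
      ∑' l, iteratedDeriv j (H l) x := by
    intro j
    induction j with
    | zero => intro _ x _; simp
    | succ j ih =>
      intro hj x hx
      rw [iteratedDerivWithin_succ, derivWithin_congr (fun z hz => ih (by omega) z hz)
        (ih (by omega) x hx)]
      exact (hstep j hj x hx).derivWithin (hS x hx)
  refine ⟨contDiffOn_of_continuousOn_differentiableOn_deriv (fun j hj => ?_) fun j hj => ?_, hiter⟩
  · have hj' : j ≤ N := by exact_mod_cast hj
    exact (hcont j hj').congr fun x hx => hiter j hj' x hx
  · have hj' : j < N := by exact_mod_cast hj
    exact fun x hx => ((hstep j hj' x hx).differentiableWithinAt).congr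
      (fun z hz => hiter j hj'.le z hz) (hiter j hj'.le x hx)

/-! ### The domains of the columns -/

/-- The open set whose closure is `domMP c`. -/
def openMP (c : Fin 2) : Set ℂ := if c = 0 then Dminus else Dplus

theorem domMP_eq_closure (c : Fin 2) : domMP c = closure (openMP c) := by
  unfold domMP openMP; split_ifs <;> rfl

theorem im_cube_eq_zero {k : ℂ} (h : k.im = 0) : (k ^ 3).im = 0 := by
  simp [pow_succ, Complex.mul_im, h]

theorem mem_openMP {c : Fin 2} {k : ℂ} : k ∈ openMP c ↔ (eps c).re * (k ^ 3).im < 0 := by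
  fin_cases c
  · simp only [openMP, Dminus, D2, D4, eps, Fin.zero_eta, if_true, Complex.one_re, one_mul,
      mem_union, mem_inter_iff, mem_ofPred_eq]
    refine ⟨by rintro (h | h) <;> exact h.2, fun h => ?_⟩
    rcases lt_trichotomy k.im 0 with h0 | h0 | h0
    · exact Or.inl ⟨h0, h⟩
    · exact absurd (im_cube_eq_zero h0) h.ne
    · exact Or.inr ⟨h0, h⟩
  · simp only [openMP, Dplus, D1, D3, eps, Fin.mk_one, one_ne_zero, if_false, Complex.neg_re,
      Complex.one_re, neg_mul, one_mul, neg_lt_zero, mem_union, mem_inter_iff, mem_ofPred_eq]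
    refine ⟨by rintro (h | h) <;> exact h.2, fun h => ?_⟩
    rcases lt_trichotomy k.im 0 with h0 | h0 | h0
    · exact Or.inl ⟨h0, h⟩
    · exact absurd (im_cube_eq_zero h0) h.ne'
    · exact Or.inr ⟨h0, h⟩

theorem isOpen_openMP (c : Fin 2) : IsOpen (openMP c) := by
  have : openMP c = {k | (eps c).re * (k ^ 3).im < 0} := Set.ext fun k => mem_openMP
  rw [this]
  exact isOpen_lt (by fun_prop) continuous_const

/-- Away from the origin, `domMP c` is given by the non-strict inequality. -/
theorem mem_domMP {c : Fin 2} {k : ℂ} (hk : k ≠ 0) :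
    k ∈ domMP c ↔ (eps c).re * (k ^ 3).im ≤ 0 := by
  rw [domMP_eq_closure]
  refine ⟨fun h => ?_, fun h => ?_⟩
  · refine closure_minimal (t := {k : ℂ | (eps c).re * (k ^ 3).im ≤ 0})
      (fun k hk => (mem_openMP.1 hk).le) (isClosed_le (by fun_prop) continuous_const) h
  rcases h.lt_or_eq with h | h
  · exact subset_closure (mem_openMP.2 h)
  -- a boundary point is approached by rotating it slightly in the right direction
  have he : (eps c).re * (eps c).re = 1 := by fin_cases c <;> simp [eps]
  have him : (k ^ 3).im = 0 := by
    have := congrArg (fun y => (eps c).re * y) h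
    simp only [mul_zero, ← mul_assoc, he, one_mul] at this
    exact this
  have hre : (k ^ 3).re ≠ 0 := fun h0 => pow_ne_zero 3 hk (Complex.ext h0 him)
  set σ : ℝ := -((eps c).re * (k ^ 3).re) with hσ
  have hσ0 : σ ≠ 0 := neg_ne_zero.2 (mul_ne_zero (fun h0 => by simp [h0] at he) hre)
  have hlim : Tendsto (fun δ : ℝ => k * (1 + (δ * σ : ℝ) * Complex.I)) (𝓝[>] 0) (𝓝 k) := by
    have : Continuous fun δ : ℝ => k * (1 + (δ * σ : ℝ) * Complex.I) := by fun_prop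
    have := this.tendsto 0
    simp only [zero_mul, Complex.ofReal_zero, add_zero, mul_one] at this
    exact this.mono_left nhdsWithin_le_nhds
  refine mem_closure_of_tendsto hlim ?_
  have hsmall : ∀ᶠ δ : ℝ in 𝓝[>] 0, (δ * σ) ^ 2 < 3 := by
    have : Continuous fun δ : ℝ => (δ * σ) ^ 2 := by fun_prop
    have := this.tendsto 0
    refine (this.mono_left nhdsWithin_le_nhds).eventually (gt_mem_nhds ?_)
    norm_num
  filter_upwards [hsmall, self_mem_nhdsWithin] with δ hδ hδ0
  rw [mem_openMP]
  have e : ((k * (1 + (δ * σ : ℝ) * Complex.I)) ^ 3).im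
      = (k ^ 3).re * (3 * (δ * σ) - (δ * σ) ^ 3) := by
    have hc3 : (1 + ((δ * σ : ℝ) : ℂ) * Complex.I) ^ 3
        = ((1 - 3 * (δ * σ) ^ 2 : ℝ) : ℂ) + ((3 * (δ * σ) - (δ * σ) ^ 3 : ℝ) : ℂ) * Complex.I := by
      have hI : Complex.I ^ 2 = -1 := Complex.I_sq
      have hI3 : Complex.I ^ 3 = -Complex.I := by rw [pow_succ, hI]; ring
      push_cast
      ring_nf
      rw [hI, hI3]
      ring
    rw [mul_pow, hc3, Complex.mul_im, him, Complex.add_im, Complex.ofReal_im, Complex.im_ofReal_mul,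
      Complex.I_im, zero_mul, add_zero, zero_add, mul_one]
  rw [e]
  have hδ' : 0 < δ := hδ0
  have h3 : 0 < 3 - (δ * σ) ^ 2 := by linarith
  have hσσ : 0 < σ * σ := mul_self_pos.2 hσ0
  have : (eps c).re * ((k ^ 3).re * (3 * (δ * σ) - (δ * σ) ^ 3))
      = -(δ * (σ * σ) * (3 - (δ * σ) ^ 2)) := by rw [hσ]; ring
  rw [this]
  exact neg_neg_of_pos (by positivity)

/-- Derivatives within `domMPLarge K c` are unique, as it lies in the closure of an open subset. -/
theorem uniqueDiffOn_domMPLarge (K : ℝ) (c : Fin 2) : UniqueDiffOn ℂ (domMPLarge K c) := by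
  intro x hx
  have hKo : IsOpen {k : ℂ | K < ‖k‖} := isOpen_lt continuous_const continuous_norm
  rw [domMPLarge, domMP_eq_closure] at hx
  have hcl : x ∈ closure ({k : ℂ | K < ‖k‖} ∩ openMP c) := hKo.inter_closure ⟨hx.2, hx.1⟩
  have hsub : {k : ℂ | K < ‖k‖} ∩ openMP c ⊆ domMPLarge K c := fun k hk =>
    ⟨by rw [domMP_eq_closure]; exact subset_closure hk.2, hk.1⟩
  rw [uniqueDiffWithinAt_iff_accPt]
  refine AccPt.mono ?_ (principal_mono.2 hsub)
  rcases clusterPt_principal.1 (mem_closure_iff_clusterPt.1 hcl) with h | h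
  · exact accPt_iff_nhds.2 fun U hU => by
      have hm : U ∩ ({k : ℂ | K < ‖k‖} ∩ openMP c) ∈ 𝓝 x :=
        inter_mem hU ((hKo.inter (isOpen_openMP c)).mem_nhds h)
      obtain ⟨y, hy, hne⟩ := (infinite_of_mem_nhds x hm).exists_notMem_finset {x}
      exact ⟨y, hy, by simpa using hne⟩
  · exact h

/-- Near each of its points away from the origin, `domMP c` is a disc or a half-disc. -/
theorem exists_convex_nhds {K : ℝ} (hK : 0 ≤ K) {c : Fin 2} {x : ℂ} (hx : x ∈ domMPLarge K c) :
    ∃ r > 0, Convex ℝ (Metric.ball x r ∩ domMPLarge K c) := by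
  have hxK : K < ‖x‖ := hx.2
  have hx0 : x ≠ 0 := norm_pos_iff.1 (hK.trans_lt hxK)
  have hball : ∀ z ∈ Metric.ball x (‖x‖ - K), K < ‖z‖ := fun z hz => by
    rw [Metric.mem_ball, dist_eq_norm] at hz
    have := norm_sub_norm_le x (x - z)
    rw [sub_sub_cancel, norm_sub_rev] at this
    linarith
  rcases ((mem_domMP hx0).1 hx.1).lt_or_eq with h | h
  · obtain ⟨r, hr, hrs⟩ := Metric.isOpen_iff.1 (isOpen_openMP c) x (mem_openMP.2 h)
    refine ⟨min r (‖x‖ - K), lt_min hr (sub_pos.2 hxK), ?_⟩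
    rw [inter_eq_left.2 fun z hz => ?_]
    · exact convex_ball _ _
    · exact ⟨by
        rw [domMP_eq_closure]
        exact subset_closure (hrs (Metric.ball_subset_ball (min_le_left _ _) hz)),
        hball z (Metric.ball_subset_ball (min_le_right _ _) hz)⟩
  · have he : (eps c).re ≠ 0 := by fin_cases c <;> simp [eps]
    have him : (x ^ 3).im = 0 := (mul_eq_zero.1 h).resolve_left he
    refine ⟨min (‖x‖ / 2) (‖x‖ - K), lt_min (by linarith [hK.trans_lt hxK])
      (sub_pos.2 hxK), ?_⟩
    have hlin : IsLinearMap ℝ fun z : ℂ => (eps c).re * ((x ^ 3).re * (z / x).im) :=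
      ⟨fun a b => by rw [add_div, Complex.add_im]; ring, fun a b => by
        rw [Complex.real_smul, mul_div_assoc, Complex.im_ofReal_mul, smul_eq_mul]; ring⟩
    have heq : Metric.ball x (min (‖x‖ / 2) (‖x‖ - K)) ∩ domMPLarge K c =
        Metric.ball x (min (‖x‖ / 2) (‖x‖ - K)) ∩
          {z | (eps c).re * ((x ^ 3).re * (z / x).im) ≤ 0} := by
      ext z
      refine and_congr_right fun hz => ?_
      have hzK := hball z (Metric.ball_subset_ball (min_le_right _ _) hz)
      have hz0 : z ≠ 0 := norm_pos_iff.1 (hK.trans_lt hzK)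
      have hz2 := Metric.ball_subset_ball (min_le_left _ _) hz
      rw [Metric.mem_ball, dist_eq_norm] at hz2
      have hmem : z ∈ domMPLarge K c ↔ z ∈ domMP c := and_iff_left hzK
      rw [hmem, mem_domMP hz0, mem_ofPred_eq]
      set ζ := z / x with hζ
      have hzζ : z = x * ζ := by rw [hζ]; field_simp
      have hζ1 : ‖ζ - 1‖ < 1 / 2 := by
        have : z - x = x * (ζ - 1) := by rw [hzζ]; ring
        rw [this, norm_mul] at hz2
        have hxp : 0 < ‖x‖ := norm_pos_iff.2 hx0
        by_contra hcon
        push Not at hcon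
        nlinarith
      have hre := (abs_le.1 ((Complex.abs_re_le_norm (ζ - 1)).trans hζ1.le)).1
      have him' := abs_le.1 ((Complex.abs_im_le_norm (ζ - 1)).trans hζ1.le)
      rw [Complex.sub_re, Complex.one_re] at hre
      rw [Complex.sub_im, Complex.one_im, sub_zero] at him'
      have hpos : 0 < 3 * ζ.re ^ 2 - ζ.im ^ 2 := by nlinarith [him'.1, him'.2]
      have e : (z ^ 3).im = (x ^ 3).re * ζ.im * (3 * ζ.re ^ 2 - ζ.im ^ 2) := by
        rw [hzζ, mul_pow, Complex.mul_im, him]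
        simp only [pow_succ, pow_zero, one_mul, Complex.mul_im, Complex.mul_re]
        ring
      rw [e, ← mul_assoc]
      exact ⟨fun h => by
        by_contra hcon
        push Not at hcon
        exact absurd h (not_le.2 (mul_pos hcon hpos)),
        fun h => mul_nonpos_of_nonpos_of_nonneg h hpos.le⟩
    rw [heq]
    exact (convex_ball _ _).inter (convex_halfSpace_le hlin 0)

/-! ### The error of the expansion of `T` -/

section Data
variable {lam : ℝ} {m n : ℕ} {g : Fin 3 → ℝ → ℝ}

/-- Solutions which agree at `b` with the column `c` of the expansion of `T`. -/
theorem exists_backward_psum (hg : BoundaryAssumption m n g) (hlam : lam = 1 ∨ lam = -1)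
    (c : Fin 2) (b : ℝ) : ∃ w : ℝ → ℂ → Fin 2 → ℂ,
      (∀ z, (∀ i, w b z i = psum (tSeq g lam) (m + 3) b z i c) ∧
        IsSol g lam z (eps c) 0 0 b fun t => w t z) ∧
      ∀ t, t ≤ b → ∀ i, DifferentiableOn ℂ (fun z => w t z i) {0}ᶜ := by
  choose X hX hXd using fun l => exists_backward hg hlam (eps c) b (colVec l)
  refine ⟨fun t z i => psum (tSeq g lam) (m + 3) b z 0 c * X 0 t z i
    + psum (tSeq g lam) (m + 3) b z 1 c * X 1 t z i, fun z => ⟨fun i => ?_, fun i => ?_,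
    fun t ht i => ?_⟩, fun t ht i => ?_⟩
  · change _ * X 0 b z i + _ * X 1 b z i = _
    rw [(hX 0 z).1, (hX 1 z).1]
    have h00 : colVec 0 0 = 1 := Matrix.one_apply_eq 0
    have h01 : colVec 0 1 = 0 := Matrix.one_apply_ne (by simp)
    have h10 : colVec 1 0 = 0 := Matrix.one_apply_ne (by simp)
    have h11 : colVec 1 1 = 1 := Matrix.one_apply_eq 1
    fin_cases i <;> simp only [Fin.zero_eta, Fin.mk_one, h00, h01, h10, h11] <;> ring
  · exact (continuousOn_const.mul ((hX 0 z).2.cont i)).add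
      (continuousOn_const.mul ((hX 1 z).2.cont i))
  · refine ((((hX 0 z).2.deriv t ht i).const_mul _).add
      (((hX 1 z).2.deriv t ht i).const_mul _)).congr_deriv ?_
    simp only [Matrix.mulVec, dotProduct, Fin.sum_univ_two, Pi.zero_apply]
    ring
  · exact ((psum_differentiableOn _ _ b 0 c).mul
        (differentiable_pi.1 (hXd 0 t ht) i).differentiableOn).add
      ((psum_differentiableOn _ _ b 1 c).mul
        (differentiable_pi.1 (hXd 1 t ht) i).differentiableOn)

theorem isSol_psum (hg : BoundaryAssumption m n g) (k : ℂ) (c : Fin 2) {a b : ℝ} (ha : 0 ≤ a) :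
    IsSol g lam k (eps c) (fun t i => -pres g lam (tSeq g lam) (m + 3) t k i c) a b
      fun t i => psum (tSeq g lam) (m + 3) t k i c := by
  refine ⟨fun i => (hasD_psum_tSeq hg lam k i c).continuousOn.mono fun s hs => ha.trans hs.1,
    fun t ht i => ((hasD_psum_tSeq hg lam k i c).hasDerivAt (ha.trans_lt ht.1)).congr_deriv ?_⟩
  rw [expo, mul_col]
  ring

/-- Two solutions with the values of the expansion of `T` at the times `b ≤ b'` differ by little. -/
theorem exists_backward_diff_bound (hg : BoundaryAssumption m n g) (hlam : lam = 1 ∨ lam = -1) :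
    ∃ K : ℝ, 1 ≤ K ∧ ∃ f : ℝ → ℝ, ContinuousOn f (Ici 0) ∧
      IntegrableOn (fun t => (1 + t) ^ n * f t) (Ici 0) ∧ (∀ t, 0 ≤ f t) ∧
      ∀ M : ℝ, 0 ≤ M → ∃ C : ℝ, 0 ≤ C ∧ ∀ k : ℂ, K ≤ ‖k‖ → ∀ (c : Fin 2) (t b b' : ℝ)
        (w w' : ℝ → Fin 2 → ℂ), 0 ≤ t → t ≤ b → b ≤ b' →
        (∀ i, ∀ s ∈ Icc 0 b', ‖Complex.exp (expo k (eps c) i * s)‖ ≤ M) →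
        (∀ i, w b i = psum (tSeq g lam) (m + 3) b k i c) → IsSol g lam k (eps c) 0 0 b w →
        (∀ i, w' b' i = psum (tSeq g lam) (m + 3) b' k i c) → IsSol g lam k (eps c) 0 0 b' w' →
        ‖w' t - w t‖ ≤ C / ‖k‖ ^ (m + 1) * ∫ s in b..b', f s := by
  obtain ⟨K, hK1, hK⟩ := exists_large_bound hg hlam
  have F := tSeq_formal (n := n) lam hg
  obtain ⟨f, hfc, hfi, hf0, hf⟩ := F.exists_bound hg hlam
  refine ⟨K, hK1, f, hfc, hfi, hf0, fun M hM => ?_⟩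
  obtain ⟨C, hC0, hC⟩ := hK M hM
  refine ⟨C * C, by positivity, fun k hk c t b b' w w' ht htb hbb hE hwb hw hwb' hw' => ?_⟩
  have hk1 : 1 ≤ ‖k‖ := hK1.trans hk
  have hk0 : k ≠ 0 := norm_pos_iff.1 (by linarith)
  have hb0 : 0 ≤ b := ht.trans htb
  have hsub : Icc b b' ⊆ Ici 0 := fun s hs => hb0.trans hs.1
  -- the difference at time `b`
  have h1 := (hC k hk (eps c) _ (fun s => f s / ‖k‖ ^ (m + 1)) b b' _ hb0 hbb
    ((hw'.mono hb0 le_rfl).sub (isSol_psum hg k c hb0))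
    (fun i => by
      simpa using (F.continuousOn_pres hg hlam hk0 i c).mono hsub)
    ((hfc.mono hsub).div_const _)
    fun s hs i => by simpa using hf s (hsub hs) k hk1 i c).2
    fun i s hs => hE i s ⟨hs.1, by linarith [hs.2]⟩
  have z1 : (fun i => w' b' i - psum (tSeq g lam) (m + 3) b' k i c) = 0 :=
    funext fun i => by rw [hwb', sub_self]; rfl
  rw [z1, norm_zero, zero_add, intervalIntegral.integral_div] at h1
  have h2 := (hC k hk (eps c) _ (fun _ => 0) t b _ ht htb
    ((hw'.mono ht hbb).sub (hw.mono ht le_rfl))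
    (fun i => by simpa using continuousOn_const) continuousOn_const
    fun s hs i => by simp).2 fun i s hs => hE i s ⟨hs.1, by linarith [hs.2]⟩
  have z2 : (fun i => w' b i - w b i) = fun i => w' b i - psum (tSeq g lam) (m + 3) b k i c :=
    funext fun i => by rw [hwb]
  rw [z2, intervalIntegral.integral_zero, add_zero] at h2
  refine h2.trans ((mul_le_mul_of_nonneg_left h1 hC0).trans_eq ?_)
  ring

/-- `T̂ → I` as `t → ∞`. -/
theorem psum_tSeq_tendsto (hg : BoundaryAssumption m n g) (lam : ℝ) (k : ℂ) (i c : Fin 2) :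
    Tendsto (fun t => psum (tSeq g lam) (m + 3) t k i c) atTop (𝓝 ((1 : Mat) i c)) := by
  have h : Tendsto (fun t => (1 : Mat) i c + ∑ j ∈ Finset.Icc 1 (m + 3),
      1 / k ^ j * tCoef g lam j t i c) atTop (𝓝 ((1 : Mat) i c + ∑ j ∈ Finset.Icc 1 (m + 3),
        1 / k ^ j * 0)) :=
    tendsto_const_nhds.add (tendsto_finsetSum _ fun j hj => (tCoef_tendsto lam hg
      (Finset.mem_Icc.1 hj).1 (Finset.mem_Icc.1 hj).2 i c).const_mul _)
  simp only [mul_zero, Finset.sum_const_zero, add_zero] at h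
  refine h.congr fun t => ?_
  rw [psum_eq, tSeq_two_val]
  simp [Matrix.sum_apply, tCoef]

/-- A column of `T` is the limit of the solutions with the values of its expansion at `b → ∞`. -/
theorem IsColT.tendsto_backward (hg : BoundaryAssumption m n g) (hlam : lam = 1 ∨ lam = -1)
    {k : ℂ} {c : Fin 2} (hk : k ∈ domMP c) {x : ℝ → Fin 2 → ℂ} (hx : IsColT g lam c k x)
    {b : ℕ → ℝ} (hb : Tendsto b atTop atTop) {t : ℝ} (ht : 0 ≤ t) (htb : ∀ l, t ≤ b l)
    {w : ℕ → ℝ → Fin 2 → ℂ} (hw : ∀ l, IsSol g lam k (eps c) 0 0 (b l) (w l))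
    (hwb : ∀ l i, w l (b l) i = psum (tSeq g lam) (m + 3) (b l) k i c) :
    Tendsto (fun l => w l t) atTop (𝓝 (x t)) := by
  have h1 : Tendsto (fun s => x s - fun i => psum (tSeq g lam) (m + 3) s k i c) atTop (𝓝 0) := by
    have := (hx.tendsto hg hlam hk).sub (tendsto_pi_nhds.2 fun i => psum_tSeq_tendsto hg lam k i c)
    rwa [show colVec c - (fun i => (1 : Mat) i c) = 0 from sub_self _] at this
  have h2 := ((h1.comp hb).norm).const_mul
    (Real.exp (∫ s in Ioi (0 : ℝ), mnorm (laxV g lam s k)))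
  rw [norm_zero, mul_zero] at h2
  refine tendsto_iff_norm_sub_tendsto_zero.2 (squeeze_zero (fun _ => norm_nonneg _)
    (fun l => ?_) h2)
  rw [norm_sub_rev]
  have h3 := ((hx.isSol hg hlam hk ht).sub ((hw l).mono ht le_rfl)).norm_le hg hlam hk
    (by simp) ht (htb l)
  have e : (fun i => x (b l) i - w l (b l) i)
      = x (b l) - fun i => psum (tSeq g lam) (m + 3) (b l) k i c := by
    funext i; rw [hwb]; rfl
  rw [e] at h3
  exact h3

/-- The times at which successive approximations of `T` are anchored. They start at `t`, and `1 + t`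
doubles at each step: then the radius of the discs for the Cauchy estimate, proportional to the
inverse of the later time, is compensated by the weight at the earlier one. -/
def anchor (t : ℝ) (l : ℕ) : ℝ := 2 ^ l * (1 + t) - 1

theorem anchor_zero (t : ℝ) : anchor t 0 = t := by simp [anchor]

theorem one_add_anchor (t : ℝ) (l : ℕ) : 1 + anchor t l = 2 ^ l * (1 + t) := by simp [anchor]

theorem anchor_mono {t : ℝ} (ht : 0 ≤ t) : Monotone (anchor t) := fun a b hab => by
  have : (2 : ℝ) ^ a ≤ 2 ^ b := pow_le_pow_right₀ (by norm_num) hab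
  have h1 : 0 ≤ 1 + t := by linarith
  unfold anchor
  nlinarith

theorem le_anchor {t : ℝ} (ht : 0 ≤ t) (l : ℕ) : t ≤ anchor t l := by
  simpa [anchor_zero] using anchor_mono ht (Nat.zero_le l)

theorem tendsto_anchor {t : ℝ} (ht : 0 ≤ t) : Tendsto (anchor t) atTop atTop :=
  tendsto_atTop_add_const_right _ _
    ((tendsto_pow_atTop_atTop_of_one_lt (by norm_num)).atTop_mul_const (by linarith))

/-- The integrals over the dyadic intervals add up. -/
theorem summable_anchor_integral {F : ℝ → ℝ} (hF : ContinuousOn F (Ici 0))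
    (hFi : IntegrableOn F (Ici 0)) (hF0 : ∀ t, 0 ≤ t → 0 ≤ F t) {t : ℝ} (ht : 0 ≤ t) :
    Summable (fun l => ∫ s in anchor t l..anchor t (l + 1), F s) ∧
      ∑' l, ∫ s in anchor t l..anchor t (l + 1), F s ≤ ∫ s in Ioi (0 : ℝ), F s := by
  have ha : ∀ l, 0 ≤ anchor t l := fun l => ht.trans (le_anchor ht l)
  have h0 : ∀ l, 0 ≤ ∫ s in anchor t l..anchor t (l + 1), F s := fun l =>
    intervalIntegral.integral_nonneg (anchor_mono ht (Nat.le_succ l)) fun s hs =>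
      hF0 s ((ha l).trans hs.1)
  have hint : ∀ {a b : ℝ}, 0 ≤ a → a ≤ b → IntervalIntegrable F volume a b := fun ha hab =>
    ContinuousOn.intervalIntegrable (by
      rw [uIcc_of_le hab]; exact hF.mono fun s hs => ha.trans hs.1)
  have hpart : ∀ L, ∑ l ∈ Finset.range L, ∫ s in anchor t l..anchor t (l + 1), F s ≤
      ∫ s in Ioi (0 : ℝ), F s := by
    intro L
    rw [intervalIntegral.sum_integral_adjacent_intervals fun l _ =>
      hint (ha l) (anchor_mono ht (Nat.le_succ l)),
      intervalIntegral.integral_of_le (anchor_mono ht (Nat.zero_le L))]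
    refine setIntegral_mono_set (hFi.mono_set Ioi_subset_Ici_self) ?_ ?_
    · filter_upwards [ae_restrict_mem measurableSet_Ioi] with s hs using hF0 s (le_of_lt hs)
    · exact Eventually.of_forall fun s hs => (ha 0).trans_lt hs.1
  exact ⟨summable_of_sum_range_le h0 hpart, Real.tsum_le_of_sum_range_le h0 hpart⟩

/-- The error of the expansion of `T` is a series of functions which are analytic across the
boundary of the domain. Its terms are the differences of the solutions anchored at consecutive
times, and the sum over `l` telescopes to `T - T̂`. -/
theorem exists_tErr_series (hg : BoundaryAssumption m n g) (hlam : lam = 1 ∨ lam = -1)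
    {T : ℝ → ℂ → Mat} (hT : IsEigenT g lam T) :
    ∃ K : ℝ, 1 ≤ K ∧ ∃ C : ℝ, 0 ≤ C ∧ ∀ t : ℝ, 0 ≤ t → ∀ i c : Fin 2,
      ∃ (H : ℕ → ℂ → ℂ) (J : ℕ → ℝ), (∀ l, DifferentiableOn ℂ (H l) {0}ᶜ) ∧
        (∀ l, 0 ≤ J l) ∧ Summable J ∧ ∑' l, J l ≤ C ∧
        (∀ k ∈ domMPLarge K c, ∀ j ≤ n, ∀ l, ‖iteratedDeriv j (H l) k‖ ≤
          ‖k‖ ^ (2 * j) / (‖k‖ ^ (m + 1) * (1 + t) ^ (n - j)) * J l) ∧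
        ∀ k ∈ domMPLarge K c, (T t k - That g lam m t k) i c = ∑' l, H l k := by
  obtain ⟨K, hK1, f, hfc, hfi, hf0, hK⟩ := exists_backward_diff_bound (m := m) hg hlam
  obtain ⟨C, hC0, hC⟩ := hK (Real.exp 8) (Real.exp_pos 8).le
  set A : ℝ := n.factorial * C * 2 ^ (m + 1) * 24 ^ n with hA
  have hA0 : 0 ≤ A := by positivity
  refine ⟨2 * K, by linarith, A * ∫ s in Ioi (0 : ℝ), (1 + s) ^ n * f s,
    mul_nonneg hA0 (setIntegral_nonneg measurableSet_Ioi fun s hs =>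
      mul_nonneg (pow_nonneg (by linarith [mem_Ioi.1 hs]) n) (hf0 s)), fun t ht i c => ?_⟩
  choose w hw hwd using fun l => exists_backward_psum hg hlam c (anchor t l)
  have ha : ∀ l, 0 ≤ anchor t l := fun l => ht.trans (le_anchor ht l)
  have hFc : ContinuousOn (fun s => (1 + s) ^ n * f s) (Ici 0) :=
    (by fun_prop : Continuous fun s : ℝ => (1 + s) ^ n).continuousOn.mul hfc
  have hF0 : ∀ s, 0 ≤ s → 0 ≤ (1 + s) ^ n * f s := fun s hs =>
    mul_nonneg (pow_nonneg (by linarith) n) (hf0 s)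
  obtain ⟨hJs, hJt⟩ := summable_anchor_integral hFc hfi hF0 ht
  have hJ0 : ∀ l, 0 ≤ A * ∫ s in anchor t l..anchor t (l + 1), (1 + s) ^ n * f s := fun l =>
    mul_nonneg hA0 (intervalIntegral.integral_nonneg (anchor_mono ht (Nat.le_succ l)) fun s hs =>
      hF0 s ((ha l).trans hs.1))
  have hbound : ∀ k ∈ domMPLarge (2 * K) c, ∀ j ≤ n, ∀ l,
      ‖iteratedDeriv j (fun z => w (l + 1) t z i - w l t z i) k‖ ≤
        ‖k‖ ^ (2 * j) / (‖k‖ ^ (m + 1) * (1 + t) ^ (n - j)) *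
          (A * ∫ s in anchor t l..anchor t (l + 1), (1 + s) ^ n * f s) := by
    intro k hk j hj l
    have hk2 : 2 * K < ‖k‖ := hk.2
    have hk1 : 1 ≤ ‖k‖ := by linarith
    have hkp : 0 < ‖k‖ := by linarith
    have hle := anchor_mono ht (Nat.le_succ l)
    have hI0 : 0 ≤ ∫ s in anchor t l..anchor t (l + 1), f s :=
      intervalIntegral.integral_nonneg hle fun s _ => hf0 s
    have h := norm_iteratedDeriv_le_of_nearby hk1 (ha (l + 1))
      ((hwd (l + 1) t (le_anchor ht _) i).sub (hwd l t (le_anchor ht _) i))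
      (B := C * 2 ^ (m + 1) / ‖k‖ ^ (m + 1) * ∫ s in anchor t l..anchor t (l + 1), f s)
      (fun z hz => ?_) j
    · refine h.trans ?_
      have h1 : (j.factorial : ℝ) ≤ n.factorial := Nat.cast_le.2 (Nat.factorial_le hj)
      have h2 : (24 : ℝ) ^ j ≤ 24 ^ n := pow_le_pow_right₀ (by norm_num) hj
      -- the weight is at least its value at the left end of the dyadic interval
      have h3 : (1 + anchor t l) ^ j * (1 + t) ^ (n - j) *
          (∫ s in anchor t l..anchor t (l + 1), f s) ≤
            ∫ s in anchor t l..anchor t (l + 1), (1 + s) ^ n * f s := by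
        rw [← intervalIntegral.integral_const_mul]
        have hsub : Icc (anchor t l) (anchor t (l + 1)) ⊆ Ici 0 := fun s hs => (ha l).trans hs.1
        refine intervalIntegral.integral_mono_on hle
          (ContinuousOn.intervalIntegrable (by
            rw [uIcc_of_le hle]; exact continuousOn_const.mul (hfc.mono hsub)))
          (ContinuousOn.intervalIntegrable (by
            rw [uIcc_of_le hle]; exact hFc.mono hsub)) fun s hs => ?_
        refine mul_le_mul_of_nonneg_right ?_ (hf0 s)
        have e : (1 + s) ^ n = (1 + s) ^ j * (1 + s) ^ (n - j) := by
          rw [← pow_add, Nat.add_sub_cancel' hj]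
        have hal := ha l
        have hlt := le_anchor ht l
        have hs1 := hs.1
        rw [e]
        exact mul_le_mul (pow_le_pow_left₀ (by linarith) (by linarith) _)
          (pow_le_pow_left₀ (by linarith) (by linarith) _) (pow_nonneg (by linarith) _)
          (pow_nonneg (by linarith) _)
      have h4 : 1 + anchor t (l + 1) = 2 * (1 + anchor t l) := by
        rw [one_add_anchor, one_add_anchor, pow_succ]; ring
      have ht1 : 0 < 1 + t := by linarith
      have hal := ha l
      have h5 : j.factorial * C * 2 ^ (m + 1) * 24 ^ j ≤ A := by rw [hA]; gcongr
      rw [h4]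
      calc j.factorial * (C * 2 ^ (m + 1) / ‖k‖ ^ (m + 1) *
            ∫ s in anchor t l..anchor t (l + 1), f s) *
            (12 * ‖k‖ ^ 2 * (2 * (1 + anchor t l))) ^ j
          = ‖k‖ ^ (2 * j) / (‖k‖ ^ (m + 1) * (1 + t) ^ (n - j)) *
            ((j.factorial * C * 2 ^ (m + 1) * 24 ^ j) * ((1 + anchor t l) ^ j * (1 + t) ^ (n - j) *
              ∫ s in anchor t l..anchor t (l + 1), f s)) := by
            rw [show 12 * ‖k‖ ^ 2 * (2 * (1 + anchor t l)) = 24 * ‖k‖ ^ 2 * (1 + anchor t l) by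
              ring, mul_pow, mul_pow, ← pow_mul]
            field_simp
        _ ≤ _ := mul_le_mul_of_nonneg_left (mul_le_mul h5 h3 (by positivity) hA0) (by positivity)
    · obtain ⟨hz1, hz2⟩ := norm_exp_expo_nearby hk1 (ha (l + 1)) hz
      have hd := hC z (by linarith) c t (anchor t l) (anchor t (l + 1)) (fun s => w l s z)
        (fun s => w (l + 1) s z) ht (le_anchor ht l) hle (fun i s hs => ?_) (hw l z).1 (hw l z).2
        (hw (l + 1) z).1 (hw (l + 1) z).2
      · refine (norm_le_pi_norm (w (l + 1) t z - w l t z) i).trans (hd.trans ?_)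
        refine mul_le_mul_of_nonneg_right ?_ hI0
        have hzp : 0 < ‖z‖ := by linarith
        rw [div_le_div_iff₀ (by positivity) (by positivity)]
        have : ‖k‖ ^ (m + 1) ≤ (2 * ‖z‖) ^ (m + 1) := by gcongr; linarith
        rw [mul_pow] at this
        calc C * ‖k‖ ^ (m + 1) ≤ C * (2 ^ (m + 1) * ‖z‖ ^ (m + 1)) := by gcongr
          _ = _ := by ring
      · exact (hz2 i c s ⟨by linarith [hs.1, ha (l + 1)], hs.2⟩).trans
          (mul_le_of_le_one_right (Real.exp_pos 8).le (norm_exp_expo_le_one hk.1 i hs.1))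
  refine ⟨fun l z => w (l + 1) t z i - w l t z i,
    fun l => A * ∫ s in anchor t l..anchor t (l + 1), (1 + s) ^ n * f s,
    fun l => (hwd (l + 1) t (le_anchor ht _) i).sub (hwd l t (le_anchor ht _) i), hJ0,
    hJs.mul_left A, ?_, hbound, fun k hk => ?_⟩
  · rw [tsum_mul_left]
    exact mul_le_mul_of_nonneg_left hJt hA0
  · have hsum : Summable fun l => w (l + 1) t k i - w l t k i := by
      refine Summable.of_norm_bounded ((hJs.mul_left A).mul_left
        (‖k‖ ^ (2 * 0) / (‖k‖ ^ (m + 1) * (1 + t) ^ (n - 0)))) fun l => ?_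
      simpa using hbound k hk 0 (Nat.zero_le n) l
    have hlim := tendsto_pi_nhds.1 ((isEigenT_iff.1 hT c k hk.1).tendsto_backward hg hlam hk.1
      (tendsto_anchor ht) ht (le_anchor ht) (fun l => (hw l k).2) fun l => (hw l k).1) i
    have h0 : w 0 t k i = That g lam m t k i c := by
      have := (hw 0 k).1 i
      rw [anchor_zero] at this
      rw [this, that_eq]
    refine tendsto_nhds_unique ?_ hsum.hasSum.tendsto_sum_nat
    have := hlim.sub_const (w 0 t k i)
    rw [h0] at this
    refine this.congr fun L => ?_
    rw [← h0]
    exact (Finset.sum_range_sub (fun l => w l t k i) L).symm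

/-- Smoothness of `T` up to the boundary, and the bounds for the derivatives of its error. -/
theorem exists_tErr_bound (hg : BoundaryAssumption m n g) (hlam : lam = 1 ∨ lam = -1)
    {T : ℝ → ℂ → Mat} (hT : IsEigenT g lam T) :
    ∃ K : ℝ, 1 ≤ K ∧ ∃ C : ℝ, 0 ≤ C ∧ ∀ t : ℝ, 0 ≤ t → ∀ (i c : Fin 2) (K' : ℝ), K ≤ K' →
      ContDiffOn ℂ n (fun k => T t k i c) (domMPLarge K' c) ∧
      ∀ j ≤ n, ∀ k ∈ domMPLarge K' c, ‖iteratedDerivWithin j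
        (fun z => (T t z - That g lam m t z) i c) (domMPLarge K' c) k‖ ≤
          C * (‖k‖ ^ (2 * j) / (‖k‖ ^ (m + 1) * (1 + t) ^ (n - j))) := by
  obtain ⟨K, hK1, C, hC0, hC⟩ := exists_tErr_series hg hlam hT
  refine ⟨K, hK1, C, hC0, fun t ht i c K' hK' => ?_⟩
  obtain ⟨H, J, hHd, hJ0, hJs, hJC, hb, hTH⟩ := hC t ht i c
  set S := domMPLarge K' c with hS
  have hSK : S ⊆ domMPLarge K c := fun k hk => ⟨hk.1, lt_of_le_of_lt hK' hk.2⟩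
  have hS0 : S ⊆ {0}ᶜ := fun k hk => norm_pos_iff.1 (by
    have : K' < ‖k‖ := hk.2
    linarith)
  obtain ⟨hcd, hit⟩ := contDiffOn_tsum_within (uniqueDiffOn_domMPLarge K' c)
    isOpen_compl_singleton hS0 hHd (N := n) fun x hx => by
      obtain ⟨r, hr, hconv⟩ := exists_convex_nhds (by linarith : 0 ≤ K') hx
      refine ⟨Metric.ball x r, Metric.ball_mem_nhds x hr, hconv, fun l => (‖x‖ + r) ^ (2 * n) * J l,
        hJs.mul_left _, fun j hj l z hz => (hb z (hSK hz.2) j hj l).trans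
          (mul_le_mul_of_nonneg_right ?_ (hJ0 l))⟩
      have hz1 : 1 ≤ ‖z‖ := by
        have : K' < ‖z‖ := hz.2.2
        linarith
      have hzx : ‖z‖ ≤ ‖x‖ + r := by
        have h1 := hz.1
        rw [Metric.mem_ball, dist_eq_norm] at h1
        have := norm_add_le x (z - x)
        rw [add_sub_cancel] at this
        linarith
      have hden : 1 ≤ ‖z‖ ^ (m + 1) * (1 + t) ^ (n - j) :=
        one_le_mul_of_one_le_of_one_le (one_le_pow₀ hz1) (one_le_pow₀ (by linarith))
      calc ‖z‖ ^ (2 * j) / (‖z‖ ^ (m + 1) * (1 + t) ^ (n - j)) ≤ ‖z‖ ^ (2 * j) :=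
            div_le_self (by positivity) hden
        _ ≤ ‖z‖ ^ (2 * n) := pow_le_pow_right₀ hz1 (by omega)
        _ ≤ _ := by gcongr
  have hE : ∀ k ∈ S, (T t k - That g lam m t k) i c = ∑' l, H l k := fun k hk => hTH k (hSK hk)
  refine ⟨?_, fun j hj k hk => ?_⟩
  · have hThat : ContDiffOn ℂ n (fun k => That g lam m t k i c) S := by
      simp only [that_eq]
      exact ((psum_differentiableOn _ _ t i c).contDiffOn isOpen_compl_singleton).mono hS0
    refine (hcd.add hThat).congr fun k hk => ?_
    change T t k i c = (∑' l, H l k) + That g lam m t k i c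
    rw [← hE k hk, Matrix.sub_apply, sub_add_cancel]
  · rw [iteratedDerivWithin_congr hE hk, hit j hj k hk]
    refine (tsum_of_norm_bounded (hJs.mul_left _).hasSum fun l => hb k (hSK hk) j hj l).trans ?_
    rw [tsum_mul_left, mul_comm C]
    have : 0 ≤ 1 + t := by linarith
    exact mul_le_mul_of_nonneg_left hJC (by positivity)

end Data

/-! ### From the sharp bounds to the stated ones -/

theorem domPM_other (c : Fin 2) : domPM (1 - c) = domMP c := by
  fin_cases c <;> simp [domPM, domMP]

theorem zpow_order {x : ℝ} (hx : 0 < x) (m j : ℕ) :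
    x ^ ((m : ℤ) + 1 - 2 * (j : ℤ)) = x ^ (m + 1) / x ^ (2 * j) := by
  rw [zpow_sub₀ hx.ne']
  norm_cast

/-- The bound for `U` loses a factor `(1+t)² exp(Ct/|k|^{m+1}) ≥ 1`. -/
theorem le_of_sharp_bound {A C t x : ℝ} (hA0 : 0 ≤ A) (hA : A ≤ C) (ht : 0 ≤ t) (hx : 0 < x)
    (m j : ℕ) : A * (1 + t) ^ j * (x ^ (2 * j) / x ^ (m + 1)) ≤
      C * (1 + t) ^ (j + 2) * Real.exp (C * t / x ^ (m + 1))
        / x ^ ((m : ℤ) + 1 - 2 * (j : ℤ)) := by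
  have hC0 : 0 ≤ C := hA0.trans hA
  have h1 : (1 + t) ^ j ≤ (1 + t) ^ (j + 2) := pow_le_pow_right₀ (by linarith) (by omega)
  have h2 : 1 ≤ Real.exp (C * t / x ^ (m + 1)) := Real.one_le_exp (by positivity)
  rw [zpow_order hx, div_div_eq_mul_div, mul_div_assoc]
  refine mul_le_mul_of_nonneg_right ?_ (by positivity)
  calc A * (1 + t) ^ j ≤ C * (1 + t) ^ (j + 2) := by gcongr
    _ ≤ _ := le_mul_of_one_le_right (by positivity) h2

theorem exists_eigenT {lam : ℝ} {m n : ℕ} {g : Fin 3 → ℝ → ℝ} (hg : BoundaryAssumption m n g)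
    (hlam : lam = 1 ∨ lam = -1) : ∃ T : ℝ → ℂ → Mat, IsEigenT g lam T := by
  choose! x hx using fun c k (hk : k ∈ domMP c) => exists_colT hg hlam hk
  exact ⟨fun t k => Matrix.of fun i c => x c k t i, isEigenT_iff.2 fun c k hk => hx c k hk⟩

end MKdV

end

theorem theorem4p2 (lam : ℝ) (hlam : lam = 1 ∨ lam = -1) (m n : ℕ) (hm : 1 ≤ m) (hn : 1 ≤ n)
    (g : Fin 3 → ℝ → ℝ) (hg : MKdV.BoundaryAssumption m n g) :
    -- the coefficients entering the truncated expansions are well defined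
    (∀ j : ℕ, 1 ≤ j → j ≤ m + 3 → MKdV.TWellDefined g lam j ∧ MKdV.VWWellDefined g lam j) ∧
    -- the eigenfunctions exist and are unique
    ∃ T U : ℝ → ℂ → MKdV.Mat,
      MKdV.IsEigenT g lam T ∧
      (∀ T' : ℝ → ℂ → MKdV.Mat, MKdV.IsEigenT g lam T' →
        ∀ c : Fin 2, ∀ k ∈ MKdV.domMP c, ∀ t : ℝ, 0 ≤ t → ∀ i, T' t k i c = T t k i c) ∧
      MKdV.IsEigenU g lam U ∧
      (∀ U' : ℝ → ℂ → MKdV.Mat, MKdV.IsEigenU g lam U' →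
        ∀ k : ℂ, ∀ t : ℝ, 0 ≤ t → U' t k = U t k) ∧
      -- `U` is entire in `k`
      (∀ t : ℝ, 0 ≤ t → ∀ i c, Differentiable ℂ (fun k => U t k i c)) ∧
      ∃ K : ℝ, 0 < K ∧ ∃ C : ℝ, 0 < C ∧
        -- the columns of `T` have `n` derivatives in `k` up to the boundary of their domain
        (∀ t : ℝ, 0 ≤ t → ∀ i c,
          ContDiffOn ℂ (n : WithTop ℕ∞) (fun k => T t k i c) (MKdV.domMPLarge K c)) ∧
        (∀ t : ℝ, 0 ≤ t → ∀ j : ℕ, j ≤ n → ∀ c : Fin 2, ∀ k ∈ MKdV.domMPLarge K c,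
          MKdV.colNorm (fun i => iteratedDerivWithin j
              (fun z => (T t z - MKdV.That g lam m t z) i c) (MKdV.domMPLarge K c) k)
            ≤ C / (‖k‖ ^ ((m : ℤ) + 1 - 2 * (j : ℤ)) * (1 + t) ^ (n - j))) ∧
        (∀ t : ℝ, 0 ≤ t → ∀ j : ℕ, j ≤ n → ∀ c : Fin 2, ∀ k ∈ MKdV.domPMLarge K c,
          MKdV.colNorm (fun i => iteratedDeriv j
              (fun z => (U t z - MKdV.Uhat g lam m t z) i c) k)
            ≤ C * (1 + t) ^ (j + 2) * Real.exp (C * t / ‖k‖ ^ (m + 1))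
                / ‖k‖ ^ ((m : ℤ) + 1 - 2 * (j : ℤ))) ∧
        (∀ t : ℝ, 0 ≤ t → ∀ j : ℕ, j ≤ n → ∀ c : Fin 2, ∀ k ∈ MKdV.domMPLarge K c,
          MKdV.colNorm (fun i => iteratedDeriv j
              (fun z => ((U t z - MKdV.Uhat g lam m t z) *
                MKdV.expSigma3 (-(8 * Complex.I * z ^ 3 * t))) i c) k)
            ≤ C * (1 + t) ^ (j + 2) * Real.exp (C * t / ‖k‖ ^ (m + 1))
                / ‖k‖ ^ ((m : ℤ) + 1 - 2 * (j : ℤ))) := by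
  refine ⟨fun j h1 hj => ⟨MKdV.tWellDefined lam hg h1 hj, MKdV.vwWellDefined lam hg h1 hj⟩, ?_⟩
  obtain ⟨T, hT⟩ := MKdV.exists_eigenT hg hlam
  obtain ⟨U, hU, hUd, hU0⟩ := MKdV.exists_eigenU hg hlam
  obtain ⟨K₁, hK₁, C₁, hC₁, hTb⟩ := MKdV.exists_tErr_bound hg hlam hT
  obtain ⟨K₂, hK₂, C₂, hC₂, hUb⟩ := MKdV.exists_iteratedDeriv_uErr_bound hg hlam
    (fun k c => (hU0 k c).1) (fun k c => (hU0 k c).2) hUd n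
  refine ⟨T, U, hT, fun T' hT' c k hk t ht i => ?_, hU, fun U' hU' k t ht =>
    MKdV.eigenU_unique hg hlam hU hU' k ht, hUd, max K₁ K₂, by positivity,
    2 * (C₁ + C₂) + 1, by positivity, fun t ht i c => (hTb t ht i c _ (le_max_left _ _)).1,
    fun t ht j hj c k hk => ?_, fun t ht j hj c k hk => ?_, fun t ht j hj c k hk => ?_⟩
  · exact congrFun ((MKdV.isEigenT_iff.1 hT' c k hk).unique hg hlam hk
      (MKdV.isEigenT_iff.1 hT c k hk) ht) i
  · have hkK : max K₁ K₂ < ‖k‖ := hk.2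
    have hkp : 0 < ‖k‖ := by linarith [le_max_left K₁ K₂]
    refine (MKdV.colNorm_le fun i => (hTb t ht i c _ (le_max_left _ _)).2 j hj k hk).trans ?_
    have e : ‖k‖ ^ (2 * j) / (‖k‖ ^ (m + 1) * (1 + t) ^ (n - j)) =
        1 / (‖k‖ ^ ((m : ℤ) + 1 - 2 * (j : ℤ)) * (1 + t) ^ (n - j)) := by
      rw [MKdV.zpow_order hkp]
      field_simp
    rw [e, ← mul_assoc, mul_one_div]
    gcongr
    linarith
  · have hkK : max K₁ K₂ < ‖k‖ := hk.2
    have hkp : 0 < ‖k‖ := by linarith [le_max_left K₁ K₂]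
    have e : ∀ i, (fun z => (U t z - MKdV.Uhat g lam m t z) i c)
        = fun z => MKdV.uErr g lam m U c c t z i := fun i => by
      funext z; simp [MKdV.uErr]
    simp only [e]
    refine (MKdV.colNorm_le fun i => hUb c c k hk.1 (by linarith [le_max_right K₁ K₂]) t ht j hj
      i).trans ?_
    rw [← mul_assoc, ← mul_assoc]
    exact MKdV.le_of_sharp_bound (by positivity) (by linarith) ht hkp m j
  · have hkK : max K₁ K₂ < ‖k‖ := hk.2
    have hkp : 0 < ‖k‖ := by linarith [le_max_left K₁ K₂]
    have e : ∀ i, (fun z => ((U t z - MKdV.Uhat g lam m t z) *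
          MKdV.expSigma3 (-(8 * Complex.I * z ^ 3 * t))) i c)
        = fun z => MKdV.uErr g lam m U c (1 - c) t z i := fun i => by
      funext z
      have h1 : MKdV.eps (1 - c) = -MKdV.eps c := by fin_cases c <;> simp [MKdV.eps]
      rw [MKdV.mul_expSigma3_apply, MKdV.uErr, h1, mul_comm, Matrix.sub_apply]
      congr 2
      ring
    simp only [e]
    refine (MKdV.colNorm_le fun i => hUb c (1 - c) k (by rw [MKdV.domPM_other]; exact hk.1)
      (by linarith [le_max_right K₁ K₂]) t ht j hj i).trans ?_
    rw [← mul_assoc, ← mul_assoc]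
    exact MKdV.le_of_sharp_bound (by positivity) (by linarith) ht hkp m j
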